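/- **Theorem.** For each $n$ let $p=p_n$, and let $X_1,\dots,X_n\sim N(\mu_X^*,\Omega_X^{*-1})$ and $Y_1,\dots,Y_n\sim N(\mu_Y^*,\Omega_Y^{*-1})$ be independent samples in $\mathbb R^p$, with $\Omega_X^*,\Omega_Y^*$ symmetric positive definite; all parameters may depend on $n$. Write $\Sigma=\Omega^{-1}$ with any sub- or superscripts, $\|\cdot\|$ for the Euclidean norm of vectors and the spectral norm of matrices, $\|\cdot\|_F$ for the Frobenius norm. Let $z=z_n\in\mathbb R^p$ be non-random and $$\Delta(\mu_X,\mu_Y,\Omega_X,\Omega_Y)=-(z-\mu_X)^T\Omega_X(z-\mu_X)+(z-\mu_Y)^T\Omega_Y(z-\mu_Y)+\log\frac{\det\Omega_X}{\det\Omega_Y}.$$ Let $\bar X=\frac1n\sum_iX_i$, $\hat\Sigma_X=\frac1n\sum_i(X_i-\bar X)(X_i-\bar X)^T$, similarly $\bar Y,\hat\Sigma_Y$, and $\hat\Delta=\Delta(\bar X,\bar Y,\hat\Sigma_X^{-1},\hat\Sigma_Y^{-1})$. Let $\theta=(\mu_X,\mu_Y,\Omega_X,\Omega_Y)$ and $l_n(\theta)=l_X(\mu_X,\Omega_X)+l_Y(\mu_Y,\Omega_Y)$,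 where $$l_X(\mu,\Omega)=\tfrac n2\log\det\Omega-\tfrac n2\operatorname{tr}\Big(\Omega\,\tfrac1n\sum_i(X_i-\mu)(X_i-\mu)^T\Big)$$ and $l_Y$ is defined likewise with $Y_i$. For a prior (probability measure) $\Pi=\Pi_n$ on $\theta$ with $\Omega_X,\Omega_Y$ positive definite almost surely, the posterior is $\Pi(B\mid X^n,Y^n)=\int_B e^{l_n(\theta)}d\Pi(\theta)\big/\int e^{l_n(\theta)}d\Pi(\theta)$. Put $$\Phi_X=-\Omega_X^*\big(\Sigma_X^*-(z-\mu_X^*)(z-\mu_X^*)^T\big)\Omega_X^*,\qquad \Phi_Y=\Omega_Y^*\big(\Sigma_Y^*-(z-\mu_Y^*)(z-\mu_Y^*)^T\big)\Omega_Y^*,$$ $$\xi_X=2(z-\mu_X^*),\qquad \xi_Y=2(\mu_Y^*-z),$$ $$V^2=2\|\Sigma_X^{*1/2}\Phi_X\Sigma_X^{*1/2}\|_F^2+2\|\Sigma_Y^{*1/2}\Phi_Y\Sigma_Y^{*1/2}\|_F^2+\xi_X^T\Omega_X^*\xi_X+\xi_Y^T\Omega_Y^*\xi_Y,\qquad V\ge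 0,$$ and for $t\in\mathbb R$ let $\theta_t=(\mu_{X,t},\mu_{Y,t},\Omega_{X,t},\Omega_{Y,t})$ with $$\Omega_{X,t}=\Omega_X+\tfrac{2t}{\sqrt n\,V}\Phi_X,\quad \Omega_{Y,t}=\Omega_Y+\tfrac{2t}{\sqrt n\,V}\Phi_Y,\quad \mu_{X,t}=\mu_X-\tfrac{t}{\sqrt n\,V}\xi_X,\quad \mu_{Y,t}=\mu_Y-\tfrac{t}{\sqrt n\,V}\xi_Y.$$ Let $\delta_n\to0$ and let $A_n$ be a measurable (non-random) set of parameters $\theta$ on which each of the following four quantities is at most $\delta_n$: $$\sqrt n\big(\|\mu_X-\mu_X^*\|^2+\|\mu_Y-\mu_Y^*\|^2+\|\Sigma_X-\Sigma_X^*\|^2+\|\Sigma_Y-\Sigma_Y^*\|^2\big),$$ $$\sqrt p\big(\|\mu_X-\mu_X^*\|+\|\mu_Y-\mu_Y^*\|+\|\Sigma_X-\Sigma_X^*\|+\|\Sigma_Y-\Sigma_Y^*\|\big),$$ $$\sqrt{n/p}\,\big(\|\Sigma_X-\Sigma_X^*\|_F^2+\|\Sigma_Y-\Sigma_Y^*\|_F^2\big),\qquad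 \sqrt p\,\big(\|\Sigma_X-\Sigma_X^*\|_F+\|\Sigma_Y-\Sigma_Y^*\|_F\big).$$ Assume that, as $n\to\infty$, $\|\Sigma_X^*\|\vee\|\Omega_X^*\|\vee\|\Sigma_Y^*\|\vee\|\Omega_Y^*\|=O(1)$, $V^{-1}=O(1)$ (that is, $V$ is eventually bounded below by a positive constant) and $p^3/n=o(1)$. If, with $o_P$ referring to the sampling distribution of the data, 1. $\Pi(A_n\mid X^n,Y^n)=1-o_P(1)$, and 2. for every fixed $t\in\mathbb R$, $\displaystyle\frac{\int_{A_n}e^{l_n(\theta_t)}\,d\Pi(\theta)}{\int_{A_n}e^{l_n(\theta)}\,d\Pi(\theta)}=1+o_P(1)$, then, with $Z\sim N(0,1)$, $$\sup_{t\in\mathbb R}\Big|\Pi\Big(\sqrt n\,V^{-1}\big(\Delta(\mu_X,\mu_Y,\Omega_X,\Omega_Y)-\hat\Delta\big)\le t\,\Big|\,X^n,Y^n\Big)-\mathbb P(Z\le t)\Big|=o_P(1).$$ -/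

import Mathlib

open MeasureTheory ProbabilityTheory Filter Topology Matrix
open scoped ENNReal MatrixOrder

noncomputable section

namespace QDA

/-- The Borel sigma-algebra on square real matrices (the product one, entry by entry). -/
instance instMeasurableSpaceMatrix (p : ℕ) : MeasurableSpace (Matrix (Fin p) (Fin p) ℝ) :=
  inferInstanceAs (MeasurableSpace (Fin p → Fin p → ℝ))

instance instBorelSpaceMatrix (p : ℕ) : BorelSpace (Matrix (Fin p) (Fin p) ℝ) :=
  inferInstanceAs (BorelSpace (Fin p → Fin p → ℝ))

/-- Vectors with the Euclidean norm. -/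
abbrev Vec (p : ℕ) : Type := EuclideanSpace ℝ (Fin p)

/-- Square real matrices. -/
abbrev Mat (p : ℕ) : Type := Matrix (Fin p) (Fin p) ℝ

/-- The parameter of one class: the pair (mean, precision matrix). -/
abbrev ClassParam (p : ℕ) : Type := Vec p × Mat p

/-- The parameter of both classes, `((μX, ΩX), (μY, ΩY))`. -/
abbrev Param (p : ℕ) : Type := ClassParam p × ClassParam p

/-- The two training samples `(Xⁿ, Yⁿ)`. -/
abbrev Data (n p : ℕ) : Type := (Fin n → Vec p) × (Fin n → Vec p)

/-- Spectral norm: the operator norm with respect to the Euclidean norm. -/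
def specNorm {p : ℕ} (A : Mat p) : ℝ := ‖Matrix.toEuclideanCLM (𝕜 := ℝ) A‖

/-- Frobenius norm. -/
def frobNorm {p : ℕ} (A : Mat p) : ℝ := Real.sqrt (∑ i, ∑ j, A i j ^ 2)

/-- `v vᵀ`. -/
def outer {p : ℕ} (v : Vec p) : Mat p := Matrix.vecMulVec v.ofLp v.ofLp

/-- `vᵀ A v`. -/
def quadForm {p : ℕ} (A : Mat p) (v : Vec p) : ℝ := v.ofLp ⬝ᵥ (A *ᵥ v.ofLp)

/-- Sample mean. -/
def sampleMean {n p : ℕ} (X : Fin n → Vec p) : Vec p := (n : ℝ)⁻¹ • ∑ i, X i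

/-- `(1/n) ∑ (Xᵢ - m)(Xᵢ - m)ᵀ`. -/
def scatter {n p : ℕ} (X : Fin n → Vec p) (m : Vec p) : Mat p :=
  (n : ℝ)⁻¹ • ∑ i, outer (X i - m)

/-- Sample covariance `(1/n) ∑ (Xᵢ - X̄)(Xᵢ - X̄)ᵀ`. -/
def sampleCov {n p : ℕ} (X : Fin n → Vec p) : Mat p := scatter X (sampleMean X)

/-- Both precision matrices are symmetric positive definite. -/
def Param.Valid {p : ℕ} (θ : Param p) : Prop := θ.1.2.PosDef ∧ θ.2.2.PosDef

/-- Sampling distribution of the data: `X₁, …, Xₙ` i.i.d. `N(μX, ΩX⁻¹)`, and independently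
`Y₁, …, Yₙ` i.i.d. `N(μY, ΩY⁻¹)`. -/
def dataLaw (n : ℕ) {p : ℕ} (θ : Param p) : Measure (Data n p) :=
  (Measure.pi fun _ : Fin n => multivariateGaussian θ.1.1 (θ.1.2)⁻¹).prod
    (Measure.pi fun _ : Fin n => multivariateGaussian θ.2.1 (θ.2.2)⁻¹)

/-- Gaussian log-likelihood of one class, up to an additive constant:
`(n/2) log det Ω - (n/2) tr(Ω Σ̃)` with `Σ̃ = (1/n) ∑ (Xᵢ - μ)(Xᵢ - μ)ᵀ`. -/
def classLogLik {n p : ℕ} (X : Fin n → Vec p) (η : ClassParam p) : ℝ :=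
  (n : ℝ) / 2 * Real.log η.2.det - (n : ℝ) / 2 * (η.2 * scatter X η.1).trace

/-- Log-likelihood of both samples. -/
def logLik {n p : ℕ} (D : Data n p) (θ : Param p) : ℝ :=
  classLogLik D.1 θ.1 + classLogLik D.2 θ.2

/-- `∫_B exp(lₙ(s θ)) dΠ(θ)` for a map `s` of the parameter space. -/
def likIntegral {n p : ℕ} (prior : Measure (Param p)) (D : Data n p) (s : Param p → Param p)
    (B : Set (Param p)) : ℝ≥0∞ :=
  ∫⁻ θ in B, ENNReal.ofReal (Real.exp (logLik D (s θ))) ∂prior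

/-- Posterior probability `Π(B | Xⁿ, Yⁿ) = ∫_B exp(lₙ) dΠ / ∫ exp(lₙ) dΠ`. -/
def posterior {n p : ℕ} (prior : Measure (Param p)) (D : Data n p) (B : Set (Param p)) : ℝ :=
  (likIntegral prior D id B / likIntegral prior D id Set.univ).toReal

/-- The quadratic discriminant functional. -/
def disc {p : ℕ} (z : Vec p) (θ : Param p) : ℝ :=
  -quadForm θ.1.2 (z - θ.1.1) + quadForm θ.2.2 (z - θ.2.1)
    + Real.log (θ.1.2.det / θ.2.2.det)

/-- The plug-in centering `Δ(X̄, Ȳ, Σ̂X⁻¹, Σ̂Y⁻¹)`. -/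
def discHat {n p : ℕ} (z : Vec p) (D : Data n p) : ℝ :=
  disc z ((sampleMean D.1, (sampleCov D.1)⁻¹), (sampleMean D.2, (sampleCov D.2)⁻¹))

/-- `ΦX = -ΩX (ΣX - (z - μX)(z - μX)ᵀ) ΩX`. -/
def PhiX {p : ℕ} (z : Vec p) (θ : Param p) : Mat p :=
  -(θ.1.2 * ((θ.1.2)⁻¹ - outer (z - θ.1.1)) * θ.1.2)

/-- `ΦY = ΩY (ΣY - (z - μY)(z - μY)ᵀ) ΩY`. -/
def PhiY {p : ℕ} (z : Vec p) (θ : Param p) : Mat p :=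
  θ.2.2 * ((θ.2.2)⁻¹ - outer (z - θ.2.1)) * θ.2.2

/-- `ξX = 2 (z - μX)`. -/
def xiX {p : ℕ} (z : Vec p) (θ : Param p) : Vec p := (2 : ℝ) • (z - θ.1.1)

/-- `ξY = 2 (μY - z)`. -/
def xiY {p : ℕ} (z : Vec p) (θ : Param p) : Vec p := (2 : ℝ) • (θ.2.1 - z)

/-- `V`, where `V² = 2‖ΣX^{1/2} ΦX ΣX^{1/2}‖_F² + 2‖ΣY^{1/2} ΦY ΣY^{1/2}‖_F²
+ ξXᵀ ΩX ξX + ξYᵀ ΩY ξY`. -/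
def stdDev {p : ℕ} (z : Vec p) (θ : Param p) : ℝ :=
  Real.sqrt
    (2 * frobNorm (CFC.sqrt (θ.1.2)⁻¹ * PhiX z θ * CFC.sqrt (θ.1.2)⁻¹) ^ 2
      + 2 * frobNorm (CFC.sqrt (θ.2.2)⁻¹ * PhiY z θ * CFC.sqrt (θ.2.2)⁻¹) ^ 2
      + quadForm θ.1.2 (xiX z θ) + quadForm θ.2.2 (xiY z θ))

/-- The perturbed parameter `θ_t`, for the truth `θs`:
`Ω_t = Ω + (2t / (√n V)) Φ` and `μ_t = μ - (t / (√n V)) ξ` in each class. -/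
def perturb (n : ℕ) {p : ℕ} (z : Vec p) (θs : Param p) (t : ℝ) (θ : Param p) : Param p :=
  ((θ.1.1 - (t / (Real.sqrt n * stdDev z θs)) • xiX z θs,
    θ.1.2 + (2 * t / (Real.sqrt n * stdDev z θs)) • PhiX z θs),
   (θ.2.1 - (t / (Real.sqrt n * stdDev z θs)) • xiY z θs,
    θ.2.2 + (2 * t / (Real.sqrt n * stdDev z θs)) • PhiY z θs))

/-- The shrinking neighbourhood of the truth `θs` in which the sets `Aₙ` lie. -/
def nbhd (n : ℕ) {p : ℕ} (θs : Param p) (δ : ℝ) : Set (Param p) :=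
  {θ |
    Real.sqrt n * (‖θ.1.1 - θs.1.1‖ ^ 2 + ‖θ.2.1 - θs.2.1‖ ^ 2
      + specNorm ((θ.1.2)⁻¹ - (θs.1.2)⁻¹) ^ 2 + specNorm ((θ.2.2)⁻¹ - (θs.2.2)⁻¹) ^ 2) ≤ δ ∧
    Real.sqrt p * (‖θ.1.1 - θs.1.1‖ + ‖θ.2.1 - θs.2.1‖
      + specNorm ((θ.1.2)⁻¹ - (θs.1.2)⁻¹) + specNorm ((θ.2.2)⁻¹ - (θs.2.2)⁻¹)) ≤ δ ∧
    Real.sqrt ((n : ℝ) / p) * (frobNorm ((θ.1.2)⁻¹ - (θs.1.2)⁻¹) ^ 2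
      + frobNorm ((θ.2.2)⁻¹ - (θs.2.2)⁻¹) ^ 2) ≤ δ ∧
    Real.sqrt p * (frobNorm ((θ.1.2)⁻¹ - (θs.1.2)⁻¹)
      + frobNorm ((θ.2.2)⁻¹ - (θs.2.2)⁻¹)) ≤ δ}

/-- `Zₙ = o_P(1)` under the laws `Pₙ`, which may live on different spaces. -/
def IsLittleOP {S : ℕ → Type} [∀ n, MeasurableSpace (S n)] (P : ∀ n, Measure (S n))
    (Z : ∀ n, S n → ℝ) : Prop :=
  ∀ ε : ℝ, 0 < ε → Tendsto (fun n => P n {ω | ε ≤ |Z n ω|}) atTop (𝓝 0)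

end QDA

end

/-!
# Posterior normality of the quadratic discriminant

Write `h(θ) = √n V⁻¹ (Δ(θ) - Δ̂)`. The argument compares Laplace transforms.

*Local asymptotic normality.* The perturbation `θ ↦ θ_t` moves the parameter in the least favourable
direction for `Δ`: on `A_n`, and for typical data,
`lₙ(θ_t) - lₙ(θ) = t h(θ) - t² / 2 + o(1)` uniformly in `θ` (`abs_logLik_perturb_sub_le`). Both
classes contribute in the same way (`abs_classLogLik_perturb_error_le`), class `Y` being class `X`
with the sign of `t` reversed. For one class, the log-likelihood is expanded to second order
(`abs_classLogLik_perturb_sub_le`), and its linear part is the difference between the linear parts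
of the discriminant at `θ` and at the sample moments (`abs_classDisc_sub_le`). In the covariance
coordinate `Σ = Ω⁻¹` the quadratic remainder of the discriminant collapses to a single quadratic
form in `(Σ - Σ*) Ω* (z - μ*) + (μ - μ*)`, plus the remainder of `log det`. All errors are at most a
constant times `δ_n + √(p³ / n)`: this rests on the closed form `V² = ∑ (2 p + 2 β²)` with
`β = (z - μ*)ᵀ Ω* (z - μ*)`, summed over the classes (`classVar_eq`), which makes `V` dominate
`√p`, `‖z - μ*‖²` and `‖Φ‖_F`.

*Typical data.* The expansion uses the sample only through the error of the mean, the Frobenius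
error of the covariance, and the error of the covariance in the direction `Ω* (z - μ*)`. All three
are sums of squares of empirical averages, and Chebyshev's inequality with fourth moments suffices
(`measure_not_goodSample_le`).

*From Laplace transforms to distribution functions.* By local asymptotic normality the Laplace
transform at `t` of `h` under the posterior conditioned on `A_n` is `exp (t² / 2 + o(1))` times
`∫_{A_n} exp lₙ(θ_t) dΠ / ∫_{A_n} exp lₙ(θ) dΠ`, and this ratio is `1 + o_P(1)`. Pointwise
convergence of Laplace transforms to `exp (t² / 2)` implies weak convergence to the normal law, by
tightness, Prokhorov's theorem and uniqueness of the transform (`laplaceFilter_le_nhds`), hence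
convergence in Kolmogorov distance. Since the data are random, this is needed in a form without
sequences: a Kolmogorov distance at most `ε` is guaranteed by closeness of the transform at finitely
many points (`exists_finset_laplace_imp_kolmogorov`), so that the exceptional events are finite in
number. Conditioning on `A_n` changes posterior probabilities by at most `1 - Π(A_n | Xⁿ, Yⁿ)`.
-/

namespace QDA

/-! ### Laplace transforms and the Kolmogorov distance to the normal law -/

/-- The two-sided Laplace transform, with values in `ℝ≥0∞` so that no integrability is needed. -/
noncomputable def laplace (t : ℝ) (μ : ProbabilityMeasure ℝ) : ℝ≥0∞ :=
  ∫⁻ x, ENNReal.ofReal (Real.exp (t * x)) ∂(μ : Measure ℝ)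

/-- The standard normal distribution, as a point of the space of probability measures. -/
noncomputable def stdNormal : ProbabilityMeasure ℝ := ⟨gaussianReal 0 1, inferInstance⟩

/-- The filter of convergence of all Laplace transforms to that of the standard normal law. -/
noncomputable def laplaceFilter : Filter (ProbabilityMeasure ℝ) :=
  ⨅ t : ℝ, comap (laplace t) (𝓝 (ENNReal.ofReal (Real.exp (t ^ 2 / 2))))

lemma tendsto_laplace_laplaceFilter (t : ℝ) :
    Tendsto (laplace t) laplaceFilter (𝓝 (ENNReal.ofReal (Real.exp (t ^ 2 / 2)))) :=
  tendsto_comap.mono_left (iInf_le _ t)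

/-- By Markov's inequality for `exp x + exp (-x)`. -/
lemma isTightMeasureSet_of_laplace_le (C : ℝ) :
    IsTightMeasureSet {((μ : ProbabilityMeasure ℝ) : Measure ℝ) |
      μ ∈ {μ | laplace 1 μ ≤ ENNReal.ofReal C ∧ laplace (-1) μ ≤ ENNReal.ofReal C}} := by
  rw [isTightMeasureSet_iff_exists_isCompact_measure_compl_le]
  intro ε hε
  obtain ⟨n, hn⟩ : ∃ n : ℕ, ENNReal.ofReal (2 * C) / ENNReal.ofReal (Real.exp n) ≤ ε := by
    have h : Tendsto (fun n : ℕ => ENNReal.ofReal (2 * C) / ENNReal.ofReal (Real.exp n))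
        atTop (𝓝 (ENNReal.ofReal (2 * C) / ∞)) := by
      refine ENNReal.Tendsto.const_div ?_ (Or.inr ENNReal.ofReal_ne_top)
      exact ENNReal.tendsto_ofReal_atTop.comp
        (Real.tendsto_exp_atTop.comp tendsto_natCast_atTop_atTop)
    rw [ENNReal.div_top] at h
    exact (h.eventually (ge_mem_nhds hε)).exists
  refine ⟨Metric.closedBall 0 n, isCompact_closedBall _ _, ?_⟩
  rintro _ ⟨μ, ⟨h1, h2⟩, rfl⟩
  refine le_trans ?_ hn
  have hC : 0 ≤ C := by
    by_contra h
    have h0 : laplace 1 μ = 0 := by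
      simpa [ENNReal.ofReal_of_nonpos (not_le.1 h).le] using h1
    rw [laplace, lintegral_eq_zero_iff (by fun_prop)] at h0
    have : ∀ᵐ x ∂(μ : Measure ℝ), False := by
      filter_upwards [h0] with x hx
      simp only [Pi.zero_apply, ENNReal.ofReal_eq_zero] at hx
      exact absurd (Real.exp_pos (1 * x)) (not_lt.2 hx)
    simp at this
    exact IsProbabilityMeasure.ne_zero _ this
  have hmark := meas_ge_le_lintegral_div (μ := (μ : Measure ℝ))
    (f := fun x => ENNReal.ofReal (Real.exp (1 * x)) + ENNReal.ofReal (Real.exp (-1 * x)))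
    (by fun_prop) (ε := ENNReal.ofReal (Real.exp n)) (by simp [Real.exp_pos])
    ENNReal.ofReal_ne_top
  refine (measure_mono ?_).trans (hmark.trans ?_)
  · intro x hx
    simp only [Set.mem_compl_iff, Metric.mem_closedBall, dist_zero_right, Real.norm_eq_abs,
      not_le] at hx
    show ENNReal.ofReal (Real.exp n) ≤ _
    rcases le_total 0 x with h | h
    · rw [abs_of_nonneg h] at hx
      refine le_add_right (ENNReal.ofReal_le_ofReal (Real.exp_le_exp.2 ?_))
      linarith
    · rw [abs_of_nonpos h] at hx
      refine le_add_left (ENNReal.ofReal_le_ofReal (Real.exp_le_exp.2 ?_))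
      linarith
  · rw [lintegral_add_left (by fun_prop)]
    gcongr
    rw [two_mul, ENNReal.ofReal_add hC hC]
    exact add_le_add h1 h2

/-- Truncating `exp (t x)` at level `N` costs at most the transform at `2 t` divided by `N`. -/
lemma laplace_le_truncated_add (t : ℝ) (N : ℕ) (hN : 0 < N) (μ : ProbabilityMeasure ℝ) :
    laplace t μ ≤ ∫⁻ x, min (ENNReal.ofReal (Real.exp (t * x))) N ∂(μ : Measure ℝ)
      + (N : ℝ≥0∞)⁻¹ * laplace (2 * t) μ := by
  rw [laplace, laplace, ← lintegral_const_mul _ (by fun_prop),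
    ← lintegral_add_right _ (by fun_prop)]
  refine lintegral_mono fun x => ?_
  rcases le_total (ENNReal.ofReal (Real.exp (t * x))) N with h | h
  · rw [min_eq_left h]; exact le_self_add
  · refine le_add_left ?_
    have e : ENNReal.ofReal (Real.exp (2 * t * x))
        = ENNReal.ofReal (Real.exp (t * x)) * ENNReal.ofReal (Real.exp (t * x)) := by
      rw [← ENNReal.ofReal_mul (Real.exp_pos _).le, ← Real.exp_add]; ring_nf
    rw [e, ← mul_assoc]
    calc ENNReal.ofReal (Real.exp (t * x)) = 1 * ENNReal.ofReal (Real.exp (t * x)) :=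
          (one_mul _).symm
      _ ≤ _ := by
        gcongr
        rw [← ENNReal.inv_mul_cancel (a := (N : ℝ≥0∞)) (by simp [hN.ne']) (by simp)]
        gcongr

lemma tendsto_truncated {U : Filter (ProbabilityMeasure ℝ)} {ν : ProbabilityMeasure ℝ}
    (hU : U ≤ 𝓝 ν) (t : ℝ) (N : ℕ) :
    Tendsto (fun μ : ProbabilityMeasure ℝ =>
        ∫⁻ x, min (ENNReal.ofReal (Real.exp (t * x))) N ∂(μ : Measure ℝ)) U
      (𝓝 (∫⁻ x, min (ENNReal.ofReal (Real.exp (t * x))) N ∂(ν : Measure ℝ))) := by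
  have h := (ProbabilityMeasure.tendsto_iff_forall_lintegral_tendsto (μs := id) (F := U)
    (μ := ν)).1 (tendsto_id.mono_left hU)
    (BoundedContinuousFunction.mkOfBound
      ⟨fun x : ℝ => min (Real.exp (t * x)).toNNReal N, by fun_prop⟩ (N : ℝ) (by
        intro x y
        rw [NNReal.dist_eq, abs_le]
        have h1 : (min (Real.exp (t * x)).toNNReal (N : NNReal) : NNReal) ≤ N := min_le_right _ _
        have h2 : (min (Real.exp (t * y)).toNNReal (N : NNReal) : NNReal) ≤ N := min_le_right _ _
        have h1' : ((min (Real.exp (t * x)).toNNReal (N : NNReal) : NNReal) : ℝ) ≤ N := by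
          exact_mod_cast h1
        have h2' : ((min (Real.exp (t * y)).toNNReal (N : NNReal) : NNReal) : ℝ) ≤ N := by
          exact_mod_cast h2
        have h3 := (min (Real.exp (t * x)).toNNReal (N : NNReal)).coe_nonneg
        have h4 := (min (Real.exp (t * y)).toNNReal (N : NNReal)).coe_nonneg
        simp only [ContinuousMap.coe_mk]
        constructor <;> linarith))
  simpa [ENNReal.ofReal] using h

/-- The uniform integrability provided by the transform at `2 t` makes the transform at `t`
continuous along weak limits. -/
lemma laplace_eq_of_le_nhds {U : Filter (ProbabilityMeasure ℝ)} [U.NeBot] (hU : U ≤ laplaceFilter)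
    {ν : ProbabilityMeasure ℝ} (hν : U ≤ 𝓝 ν) (t : ℝ) :
    laplace t ν = ENNReal.ofReal (Real.exp (t ^ 2 / 2)) := by
  have hL := fun s => (tendsto_laplace_laplaceFilter s).mono_left hU
  have hup : ∀ N : ℕ, ∫⁻ x, min (ENNReal.ofReal (Real.exp (t * x))) N ∂(ν : Measure ℝ)
      ≤ ENNReal.ofReal (Real.exp (t ^ 2 / 2)) := fun N =>
    le_of_tendsto_of_tendsto' (tendsto_truncated hν t N) (hL t)
      fun μ => lintegral_mono fun x => min_le_left _ _
  have hlow : ∀ N : ℕ, 0 < N → ENNReal.ofReal (Real.exp (t ^ 2 / 2)) ≤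
      ∫⁻ x, min (ENNReal.ofReal (Real.exp (t * x))) N ∂(ν : Measure ℝ)
      + (N : ℝ≥0∞)⁻¹ * ENNReal.ofReal (Real.exp ((2 * t) ^ 2 / 2)) := fun N hN =>
    le_of_tendsto_of_tendsto' (hL t) ((tendsto_truncated hν t N).add
      (ENNReal.Tendsto.const_mul (hL (2 * t)) (Or.inr (by simp [hN.ne']))))
      (laplace_le_truncated_add t N hN)
  apply le_antisymm
  · have hmono : Tendsto (fun N : ℕ =>
        ∫⁻ x, min (ENNReal.ofReal (Real.exp (t * x))) N ∂(ν : Measure ℝ)) atTop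
        (𝓝 (laplace t ν)) := by
      refine lintegral_tendsto_of_tendsto_of_monotone (fun N => by fun_prop)
        (ae_of_all _ fun x a b hab => ?_) (ae_of_all _ fun x => ?_)
      · exact min_le_min le_rfl (by exact_mod_cast hab)
      · refine tendsto_const_nhds.congr' ?_
        obtain ⟨M, hM⟩ := exists_nat_ge (Real.exp (t * x))
        filter_upwards [eventually_ge_atTop M] with N hN
        rw [min_eq_left]
        rw [← ENNReal.ofReal_natCast]
        exact ENNReal.ofReal_le_ofReal (hM.trans (by exact_mod_cast hN))
    exact le_of_tendsto' hmono hup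
  · have hlim : Tendsto (fun N : ℕ => laplace t ν
        + (N : ℝ≥0∞)⁻¹ * ENNReal.ofReal (Real.exp ((2 * t) ^ 2 / 2))) atTop
        (𝓝 (laplace t ν + 0 * ENNReal.ofReal (Real.exp ((2 * t) ^ 2 / 2)))) :=
      tendsto_const_nhds.add
        (ENNReal.Tendsto.mul_const ENNReal.tendsto_inv_nat_nhds_zero (Or.inr ENNReal.ofReal_ne_top))
    rw [zero_mul, add_zero] at hlim
    refine ge_of_tendsto hlim ?_
    filter_upwards [eventually_gt_atTop 0] with N hN
    exact (hlow N hN).trans (by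
      gcongr
      exact lintegral_mono fun x => min_le_left _ _)

/-- The Laplace transform extends analytically to the characteristic function, which determines the
law. -/
lemma eq_stdNormal_of_laplace {ν : ProbabilityMeasure ℝ}
    (h : ∀ t, laplace t ν = ENNReal.ofReal (Real.exp (t ^ 2 / 2))) : ν = stdNormal := by
  have hmgf : mgf id (gaussianReal 0 1) = mgf id (ν : Measure ℝ) := by
    funext t
    rw [mgf_id_gaussianReal, mgf]
    simp only [id]
    rw [integral_eq_lintegral_of_nonneg_ae (ae_of_all _ fun x => (Real.exp_pos _).le)
      (by fun_prop)]
    have := h t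
    rw [laplace] at this
    rw [this, ENNReal.toReal_ofReal (Real.exp_pos _).le]
    simp
  have hE := eqOn_complexMGF_of_mgf hmgf
  rw [integrableExpSet_id_gaussianReal] at hE
  have : gaussianReal 0 1 = (ν : Measure ℝ) :=
    Measure.ext_of_complexMGF_id_eq (funext fun z => hE (by simp))
  exact Subtype.ext this.symm

/-- Convergence of all Laplace transforms to the one of the standard normal law implies weak
convergence: by Prokhorov's theorem any ultrafilter finer than `laplaceFilter` has a weak limit,
and that limit has the transform of the standard normal law. -/
theorem laplaceFilter_le_nhds : laplaceFilter ≤ 𝓝 stdNormal := by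
  rw [le_iff_ultrafilter]
  intro U hU
  have hb : ∀ t : ℝ, ∀ᶠ μ in (U : Filter (ProbabilityMeasure ℝ)),
      laplace t μ ≤ ENNReal.ofReal (Real.exp (t ^ 2 / 2) + 1) := fun t => by
    refine ((tendsto_laplace_laplaceFilter t).mono_left hU).eventually (ge_mem_nhds ?_)
    exact (ENNReal.ofReal_lt_ofReal_iff (by positivity)).2 (by linarith)
  have hmem : {μ | laplace 1 μ ≤ ENNReal.ofReal (Real.exp (1 ^ 2 / 2) + 1) ∧
      laplace (-1) μ ≤ ENNReal.ofReal (Real.exp (1 ^ 2 / 2) + 1)} ∈ U := by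
    filter_upwards [hb 1, hb (-1)] with μ h1 h2
    exact ⟨h1, by simpa using h2⟩
  obtain ⟨ν, -, hν⟩ := (isCompact_closure_of_isTightMeasureSet
    (isTightMeasureSet_of_laplace_le _)).ultrafilter_le_nhds U
    (le_principal_iff.2 (mem_of_superset hmem subset_closure))
  rwa [← eq_stdNormal_of_laplace fun t => laplace_eq_of_le_nhds hU hν t]

lemma continuous_gaussianReal_Iic :
    Continuous fun x : ℝ => (gaussianReal 0 1).real (Set.Iic x) := by
  have hc : Continuous (cdf (gaussianReal 0 1)) := by
    rw [continuous_iff_continuousAt]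
    intro x
    rw [continuousAt_iff_continuous_left_right]
    refine ⟨?_, (cdf (gaussianReal 0 1)).right_continuous x⟩
    have h0 : (cdf (gaussianReal 0 1)).measure {x} = 0 := by
      rw [measure_cdf]
      have := nullSingletonClass_gaussianReal (μ := 0) (v := 1) one_ne_zero
      exact measure_singleton x
    rw [StieltjesFunction.measure_singleton, ENNReal.ofReal_eq_zero] at h0
    have hle : Function.leftLim (cdf (gaussianReal 0 1)) x = cdf (gaussianReal 0 1) x :=
      le_antisymm ((monotone_cdf _).leftLim_le le_rfl) (by linarith)
    have := (monotone_cdf (gaussianReal 0 1)).continuousWithinAt_Iio_iff_leftLim_eq.2 hle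
    exact continuousWithinAt_Iio_iff_Iic.1 this
  have : (fun x : ℝ => (gaussianReal 0 1).real (Set.Iic x)) = cdf (gaussianReal 0 1) := by
    funext x; rw [cdf_eq_real]
  rwa [this]

lemma exists_gaussianReal_Iic_eq {q : ℝ} (h0 : 0 < q) (h1 : q < 1) :
    ∃ a : ℝ, (gaussianReal 0 1).real (Set.Iic a) = q := by
  have e : (fun x : ℝ => (gaussianReal 0 1).real (Set.Iic x)) = cdf (gaussianReal 0 1) := by
    funext x; rw [cdf_eq_real]
  have hl := tendsto_cdf_atBot (gaussianReal 0 1)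
  have hr := tendsto_cdf_atTop (gaussianReal 0 1)
  rw [← e] at hl hr
  exact mem_range_of_exists_le_of_exists_ge continuous_gaussianReal_Iic
    ((hl.eventually (ge_mem_nhds h0)).exists) ((hr.eventually (le_mem_nhds h1)).exists)

/-- Weak convergence to the standard normal law is convergence in Kolmogorov distance (Pólya's
theorem), by comparison on a finite grid of quantiles. -/
theorem kolmogorov_mem_nhds_stdNormal {ε : ℝ} (hε : 0 < ε) :
    {μ : ProbabilityMeasure ℝ | ∀ x, |(μ : Measure ℝ).real (Set.Iic x)
      - (gaussianReal 0 1).real (Set.Iic x)| ≤ ε} ∈ 𝓝 stdNormal := by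
  obtain ⟨m, hm⟩ := exists_nat_gt (3 / ε)
  have hm0 : (0 : ℝ) < m := lt_trans (by positivity) hm
  have h3 : 3 / (m : ℝ) ≤ ε := by
    rw [div_lt_iff₀ hε] at hm
    rw [div_le_iff₀ hm0]; linarith
  set G : ℝ → ℝ := fun x => (gaussianReal 0 1).real (Set.Iic x) with hG
  have hGmono : Monotone G := fun a b hab => measureReal_mono (Set.Iic_subset_Iic.2 hab)
  have hq : ∀ i : ℕ, ∃ a : ℝ, 0 < i → i < m → G a = i / m := by
    intro i
    by_cases hi : 0 < i ∧ i < m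
    · obtain ⟨a, ha⟩ := exists_gaussianReal_Iic_eq (q := i / m)
        (div_pos (by exact_mod_cast hi.1) hm0)
        ((div_lt_one hm0).2 (by exact_mod_cast hi.2))
      exact ⟨a, fun _ _ => ha⟩
    · exact ⟨0, fun h1 h2 => absurd ⟨h1, h2⟩ hi⟩
  choose a ha using hq
  have hconv : ∀ i : ℕ, ∀ᶠ μ : ProbabilityMeasure ℝ in 𝓝 stdNormal,
      |(μ : Measure ℝ).real (Set.Iic (a i)) - G (a i)| < 1 / m := by
    intro i
    have hfr : (stdNormal : Measure ℝ) (frontier (Set.Iic (a i))) = 0 := by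
      rw [frontier_Iic]
      have := nullSingletonClass_gaussianReal (μ := 0) (v := 1) one_ne_zero
      exact measure_singleton (μ := gaussianReal 0 1) (a i)
    have h := ProbabilityMeasure.tendsto_measure_of_null_frontier_of_tendsto'
      (μs := id) (L := 𝓝 stdNormal) (μ := stdNormal) tendsto_id hfr
    have h' := (ENNReal.tendsto_toReal (measure_ne_top _ _)).comp h
    exact (Metric.tendsto_nhds.1 h') (1 / m) (by positivity)
  filter_upwards [(Finset.range m).eventually_all.2 fun i _ => hconv i] with μ hμ x
  set F : ℝ → ℝ := fun x => (μ : Measure ℝ).real (Set.Iic x) with hF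
  have hFmono : Monotone F := fun a b hab => measureReal_mono (Set.Iic_subset_Iic.2 hab)
  have hF0 : 0 ≤ F x := measureReal_nonneg
  have hF1 : F x ≤ 1 := measureReal_le_one
  have hG0 : 0 ≤ G x := measureReal_nonneg
  have hG1 : G x ≤ 1 := measureReal_le_one
  set j := ⌊m * G x⌋₊ with hj
  have hj1 : (j : ℝ) ≤ m * G x := Nat.floor_le (by positivity)
  have hj2 : m * G x < j + 1 := Nat.lt_floor_add_one _
  refine (abs_le.2 ⟨?_, ?_⟩ : |F x - G x| ≤ ε)
  · suffices h : G x ≤ F x + 3 / m by linarith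
    rcases Nat.lt_or_ge j 2 with h | h
    · have : (j : ℝ) ≤ 1 := by exact_mod_cast Nat.lt_succ_iff.1 h
      have : G x ≤ 3 / m := by rw [le_div_iff₀ hm0]; linarith
      linarith
    · have hjm : j ≤ m := by
        have : (j : ℝ) ≤ m := hj1.trans (by nlinarith)
        exact_mod_cast this
      have hg := ha (j - 1) (by omega) (by omega)
      have hc := hμ (j - 1) (Finset.mem_range.2 (by omega))
      rw [hg, Nat.cast_sub (by omega), Nat.cast_one] at hc
      rw [Nat.cast_sub (by omega), Nat.cast_one] at hg
      have hlt : a (j - 1) < x := by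
        by_contra hcon
        have := hGmono (not_lt.1 hcon)
        rw [hg, le_div_iff₀ hm0] at this
        linarith
      have h5 := hFmono hlt.le
      have h6 := (abs_lt.1 hc).1
      have h7 : G x ≤ (j + 1) / m := by rw [le_div_iff₀ hm0]; linarith
      have h8 : ((j : ℝ) + 1) / m = (j - 1) / m - 1 / m + 3 / m := by ring
      linarith [show F (a (j-1)) = (μ : Measure ℝ).real (Set.Iic (a (j - 1))) from rfl]
  · suffices h : F x ≤ G x + 3 / m by linarith
    rcases Nat.lt_or_ge (j + 1) m with h | h
    · have hg := ha (j + 1) (by omega) h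
      have hc := hμ (j + 1) (Finset.mem_range.2 h)
      rw [hg] at hc
      push_cast at hg hc
      have hlt : x < a (j + 1) := by
        by_contra hcon
        have := hGmono (not_lt.1 hcon)
        rw [hg, div_le_iff₀ hm0] at this
        linarith
      have h5 := hFmono hlt.le
      have h6 := (abs_lt.1 hc).2
      have h7 : (j : ℝ) / m ≤ G x := by rw [div_le_iff₀ hm0]; linarith
      have h8 : ((j : ℝ) + 1) / m + 1 / m = j / m + 2 / m := by ring
      have h9 : 2 / (m : ℝ) ≤ 3 / m := by gcongr; norm_num
      linarith [show F (a (j+1)) = (μ : Measure ℝ).real (Set.Iic (a (j + 1))) from rfl]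
    · have h5 : (m : ℝ) ≤ j + 1 := by exact_mod_cast h
      have : 1 ≤ G x + 3 / m := by
        rw [← sub_le_iff_le_add, sub_le_iff_le_add', ← sub_le_iff_le_add, le_div_iff₀ hm0]
        nlinarith
      linarith

theorem kolmogorov_mem_laplaceFilter {ε : ℝ} (hε : 0 < ε) :
    {μ : ProbabilityMeasure ℝ | ∀ x, |(μ : Measure ℝ).real (Set.Iic x)
      - (gaussianReal 0 1).real (Set.Iic x)| ≤ ε} ∈ laplaceFilter :=
  laplaceFilter_le_nhds (kolmogorov_mem_nhds_stdNormal hε)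

/-- A quantitative form of the convergence: finitely many values of the Laplace transform control
the Kolmogorov distance to the standard normal law. -/
theorem exists_finset_laplace_imp_kolmogorov {ε : ℝ} (hε : 0 < ε) :
    ∃ (T : Finset ℝ) (η : ℝ), 0 < η ∧ ∀ μ : ProbabilityMeasure ℝ,
      (∀ t ∈ T, ENNReal.ofReal (Real.exp (t ^ 2 / 2 - η)) ≤ laplace t μ ∧
        laplace t μ ≤ ENNReal.ofReal (Real.exp (t ^ 2 / 2 + η))) →
      ∀ x, |(μ : Measure ℝ).real (Set.Iic x) - (gaussianReal 0 1).real (Set.Iic x)| ≤ ε := by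
  obtain ⟨I, hI, W, hW, -, hWeq, -⟩ := mem_iInf'.1 (kolmogorov_mem_laplaceFilter hε)
  have hW' : ∀ t, ∃ η : ℝ, 0 < η ∧ ∀ μ : ProbabilityMeasure ℝ,
      ENNReal.ofReal (Real.exp (t ^ 2 / 2 - η)) ≤ laplace t μ →
        laplace t μ ≤ ENNReal.ofReal (Real.exp (t ^ 2 / 2 + η)) → μ ∈ W t := by
    intro t
    obtain ⟨N, hN, hNW⟩ := mem_comap.1 (hW t)
    have hl : Tendsto (fun η : ℝ => ENNReal.ofReal (Real.exp (t ^ 2 / 2 - η))) (𝓝[>] 0)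
        (𝓝 (ENNReal.ofReal (Real.exp (t ^ 2 / 2)))) := by
      refine Tendsto.mono_left ?_ nhdsWithin_le_nhds
      have : Continuous fun η : ℝ => ENNReal.ofReal (Real.exp (t ^ 2 / 2 - η)) :=
        ENNReal.continuous_ofReal.comp (by fun_prop)
      simpa using this.tendsto 0
    have hr : Tendsto (fun η : ℝ => ENNReal.ofReal (Real.exp (t ^ 2 / 2 + η))) (𝓝[>] 0)
        (𝓝 (ENNReal.ofReal (Real.exp (t ^ 2 / 2)))) := by
      refine Tendsto.mono_left ?_ nhdsWithin_le_nhds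
      have : Continuous fun η : ℝ => ENNReal.ofReal (Real.exp (t ^ 2 / 2 + η)) :=
        ENNReal.continuous_ofReal.comp (by fun_prop)
      simpa using this.tendsto 0
    have hs := (hl.Icc hr).eventually (eventually_smallSets_subset.2 hN)
    obtain ⟨η, hη, hη0⟩ := (hs.and self_mem_nhdsWithin).exists
    exact ⟨η, hη0, fun μ h1 h2 => hNW (hη ⟨h1, h2⟩)⟩
  choose η hη0 hη using hW'
  obtain ⟨η', h0, hmin⟩ : ∃ η' : ℝ, 0 < η' ∧ ∀ t ∈ hI.toFinset, η' ≤ η t := by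
    rcases hI.toFinset.eq_empty_or_nonempty with h | h
    · exact ⟨1, one_pos, by simp [h]⟩
    · obtain ⟨t, -, ht⟩ := hI.toFinset.exists_min_image η h
      exact ⟨η t, hη0 t, ht⟩
  refine ⟨hI.toFinset, η', h0, fun μ hμ => ?_⟩
  have : μ ∈ ⋂ t ∈ I, W t := by
    refine Set.mem_iInter₂.2 fun t ht => ?_
    have ht' := hI.mem_toFinset.2 ht
    refine hη t μ (le_trans ?_ (hμ t ht').1) ((hμ t ht').2.trans ?_)
    · exact ENNReal.ofReal_le_ofReal (Real.exp_le_exp.2 (by linarith [hmin t ht']))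
    · exact ENNReal.ofReal_le_ofReal (Real.exp_le_exp.2 (by linarith [hmin t ht']))
  rw [← hWeq] at this
  exact this

/-! ### Matrix norms, square roots and the logarithm of the determinant -/

section

variable {p : ℕ}

section SpecNorm

open scoped Matrix.Norms.L2Operator

lemma specNorm_eq_norm (A : Mat p) : specNorm A = ‖A‖ := rfl

lemma specNorm_nonneg (A : Mat p) : 0 ≤ specNorm A := norm_nonneg _

lemma specNorm_add_le (A B : Mat p) : specNorm (A + B) ≤ specNorm A + specNorm B := by
  simpa only [specNorm_eq_norm] using norm_add_le A B

lemma specNorm_sub_le (A B : Mat p) : specNorm (A - B) ≤ specNorm A + specNorm B := by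
  simpa only [specNorm_eq_norm] using norm_sub_le A B

lemma specNorm_mul_le (A B : Mat p) : specNorm (A * B) ≤ specNorm A * specNorm B := by
  simpa only [specNorm_eq_norm] using norm_mul_le A B

lemma specNorm_transpose_mul_self (A : Mat p) : specNorm (Aᵀ * A) = specNorm A ^ 2 := by
  have := l2_opNorm_conjTranspose_mul_self A
  rw [conjTranspose_eq_transpose_of_trivial] at this
  rw [specNorm_eq_norm, specNorm_eq_norm, this, sq]

lemma specNorm_transpose (A : Mat p) : specNorm Aᵀ = specNorm A := by
  have := l2_opNorm_conjTranspose A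
  rwa [conjTranspose_eq_transpose_of_trivial] at this

end SpecNorm

/-- The matrix-vector product `A v` as a Euclidean vector. -/
noncomputable def act (A : Mat p) (v : Vec p) : Vec p := Matrix.toEuclideanCLM (𝕜 := ℝ) A v

lemma norm_act_le (A : Mat p) (v : Vec p) : ‖act A v‖ ≤ specNorm A * ‖v‖ :=
  ContinuousLinearMap.le_opNorm _ _

lemma act_mul (A B : Mat p) (v : Vec p) : act (A * B) v = act A (act B v) := by
  simp [act, map_mul]

lemma act_add (A B : Mat p) (v : Vec p) : act (A + B) v = act A v + act B v := by
  simp [act, map_add]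

lemma act_sub (A B : Mat p) (v : Vec p) : act (A - B) v = act A v - act B v := by
  simp [act, map_sub]

lemma act_smul (c : ℝ) (A : Mat p) (v : Vec p) : act (c • A) v = c • act A v := by
  simp [act, map_smul]

lemma act_vec_add (A : Mat p) (v w : Vec p) : act A (v + w) = act A v + act A w := map_add _ _ _

lemma act_vec_sub (A : Mat p) (v w : Vec p) : act A (v - w) = act A v - act A w := map_sub _ _ _

lemma act_vec_smul (A : Mat p) (c : ℝ) (v : Vec p) : act A (c • v) = c • act A v := map_smul _ _ _

lemma ofLp_act (A : Mat p) (v : Vec p) : (act A v).ofLp = A *ᵥ v.ofLp := ofLp_toEuclideanCLM A v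

lemma act_one (v : Vec p) : act 1 v = v := by simp [act]

lemma inner_act (A : Mat p) (v w : Vec p) : inner ℝ v (act A w) = v.ofLp ⬝ᵥ (A *ᵥ w.ofLp) :=
  inner_toEuclideanCLM A v w

lemma quadForm_eq_inner (A : Mat p) (v : Vec p) : quadForm A v = inner ℝ v (act A v) :=
  (inner_act A v v).symm

lemma inner_act_transpose (A : Mat p) (v w : Vec p) :
    inner ℝ v (act Aᵀ w) = inner ℝ (act A v) w := by
  rw [inner_act, real_inner_comm, inner_act, mulVec_transpose, dotProduct_comm,
    ← dotProduct_mulVec]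

lemma inner_act_comm {A : Mat p} (hA : Aᵀ = A) (v w : Vec p) :
    inner ℝ v (act A w) = inner ℝ (act A v) w := by
  rw [← inner_act_transpose, hA]

lemma abs_inner_act_le (A : Mat p) (v w : Vec p) :
    |inner ℝ v (act A w)| ≤ specNorm A * ‖v‖ * ‖w‖ := by
  refine (abs_real_inner_le_norm _ _).trans ?_
  calc ‖v‖ * ‖act A w‖ ≤ ‖v‖ * (specNorm A * ‖w‖) := by gcongr; exact norm_act_le A w
    _ = _ := by ring

lemma abs_quadForm_le (A : Mat p) (v : Vec p) : |quadForm A v| ≤ specNorm A * ‖v‖ ^ 2 := by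
  rw [quadForm_eq_inner, sq, ← mul_assoc]; exact abs_inner_act_le A v v

lemma trace_mul_outer (A : Mat p) (v : Vec p) : (A * outer v).trace = quadForm A v := by
  rw [outer, mul_vecMulVec, trace_vecMulVec, quadForm, dotProduct_comm]

section FrobNorm

lemma frobNorm_nonneg (A : Mat p) : 0 ≤ frobNorm A := Real.sqrt_nonneg _

lemma frobNorm_sq (A : Mat p) : frobNorm A ^ 2 = ∑ i, ∑ j, A i j ^ 2 :=
  Real.sq_sqrt (Finset.sum_nonneg fun _ _ => Finset.sum_nonneg fun _ _ => sq_nonneg _)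

lemma frobNorm_sq_eq_trace (A : Mat p) : frobNorm A ^ 2 = (Aᵀ * A).trace := by
  rw [frobNorm_sq, Finset.sum_comm]
  simp [trace, mul_apply, sq]

lemma frobNorm_transpose (A : Mat p) : frobNorm Aᵀ = frobNorm A := by
  rw [frobNorm, frobNorm, Finset.sum_comm]; rfl

section
open scoped Matrix.Norms.Frobenius

lemma frobNorm_eq_norm (A : Mat p) : frobNorm A = ‖A‖ := by
  rw [Matrix.frobenius_norm_def, frobNorm, Real.sqrt_eq_rpow]
  simp

lemma frobNorm_sub_le (A B : Mat p) : frobNorm (A - B) ≤ frobNorm A + frobNorm B := by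
  simpa only [frobNorm_eq_norm] using norm_sub_le A B

lemma frobNorm_neg (A : Mat p) : frobNorm (-A) = frobNorm A := by
  simp only [frobNorm_eq_norm, norm_neg]

lemma frobNorm_smul (c : ℝ) (A : Mat p) : frobNorm (c • A) = |c| * frobNorm A := by
  simp only [frobNorm_eq_norm, norm_smul, Real.norm_eq_abs]

end

lemma abs_trace_mul_le (A B : Mat p) : |(A * B).trace| ≤ frobNorm A * frobNorm B := by
  have h : (A * B).trace = ∑ x : Fin p × Fin p, A x.1 x.2 * B x.2 x.1 := by
    simp [trace, mul_apply, Fintype.sum_prod_type]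
  have hA : frobNorm A ^ 2 = ∑ x : Fin p × Fin p, A x.1 x.2 ^ 2 := by
    rw [frobNorm_sq, Fintype.sum_prod_type]
  have hB : frobNorm B ^ 2 = ∑ x : Fin p × Fin p, B x.2 x.1 ^ 2 := by
    rw [frobNorm_sq, Fintype.sum_prod_type, Finset.sum_comm]
  refine abs_le_of_sq_le_sq ?_ (mul_nonneg (frobNorm_nonneg _) (frobNorm_nonneg _))
  rw [h, mul_pow, hA, hB]
  exact Finset.sum_mul_sq_le_sq_mul_sq _ _ _

lemma frobNorm_mul_le (A B : Mat p) : frobNorm (A * B) ≤ specNorm A * frobNorm B := by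
  refine le_of_sq_le_sq ?_ (mul_nonneg (specNorm_nonneg _) (frobNorm_nonneg _))
  rw [mul_pow, frobNorm_sq, frobNorm_sq, Finset.sum_comm,
    Finset.sum_comm (f := fun i j => B i j ^ 2), Finset.mul_sum]
  refine Finset.sum_le_sum fun j _ => ?_
  have h := norm_act_le A (WithLp.toLp 2 fun i => B i j)
  have h2 := pow_le_pow_left₀ (norm_nonneg _) h 2
  rw [mul_pow, EuclideanSpace.real_norm_sq_eq, EuclideanSpace.real_norm_sq_eq] at h2
  exact h2

lemma frobNorm_mul_le' (A B : Mat p) : frobNorm (A * B) ≤ frobNorm A * specNorm B := by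
  rw [← frobNorm_transpose, transpose_mul, ← frobNorm_transpose A, ← specNorm_transpose B, mul_comm]
  exact frobNorm_mul_le _ _

lemma specNorm_le_frobNorm (A : Mat p) : specNorm A ≤ frobNorm A := by
  refine ContinuousLinearMap.opNorm_le_bound _ (frobNorm_nonneg _) fun v => ?_
  refine le_of_sq_le_sq ?_ (mul_nonneg (frobNorm_nonneg _) (norm_nonneg _))
  rw [mul_pow, EuclideanSpace.real_norm_sq_eq, EuclideanSpace.real_norm_sq_eq, frobNorm_sq,
    Finset.sum_mul]
  refine Finset.sum_le_sum fun i _ => ?_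
  exact Finset.sum_mul_sq_le_sq_mul_sq Finset.univ (A i) v.ofLp

lemma frobNorm_outer (v : Vec p) : frobNorm (outer v) = ‖v‖ ^ 2 := by
  refine (sq_eq_sq₀ (frobNorm_nonneg _) (sq_nonneg _)).1 ?_
  rw [frobNorm_sq, EuclideanSpace.real_norm_sq_eq, sq, Finset.sum_mul_sum]
  simp [outer, vecMulVec_apply, mul_pow]

end FrobNorm

section SquareRoots

lemma sqrt_mul_sqrt {A : Mat p} (hA : A.PosSemidef) : CFC.sqrt A * CFC.sqrt A = A :=
  CFC.sqrt_mul_sqrt_self _ hA.nonneg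

lemma transpose_sqrt (A : Mat p) : (CFC.sqrt A)ᵀ = CFC.sqrt A := by
  have h : (CFC.sqrt A).PosSemidef := nonneg_iff_posSemidef.1 (CFC.sqrt_nonneg A)
  have := h.isHermitian
  rwa [IsHermitian, conjTranspose_eq_transpose_of_trivial] at this

lemma transpose_eq_of_posDef {A : Mat p} (hA : A.PosDef) : Aᵀ = A := by
  have := hA.isHermitian
  rwa [IsHermitian, conjTranspose_eq_transpose_of_trivial] at this

lemma specNorm_sqrt_sq {A : Mat p} (hA : A.PosSemidef) :
    specNorm (CFC.sqrt A) ^ 2 = specNorm A := by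
  rw [← specNorm_transpose_mul_self, transpose_sqrt, sqrt_mul_sqrt hA]

lemma PosDef.isUnit_det {A : Mat p} (hA : A.PosDef) : IsUnit A.det :=
  isUnit_iff_ne_zero.2 hA.det_pos.ne'

lemma sqrt_inv_mul_sqrt {A : Mat p} (hA : A.PosDef) : CFC.sqrt A⁻¹ * CFC.sqrt A = 1 := by
  have hs : IsUnit (CFC.sqrt A).det := by
    have h : (CFC.sqrt A).det * (CFC.sqrt A).det = A.det := by
      rw [← det_mul, sqrt_mul_sqrt hA.posSemidef]
    refine isUnit_iff_ne_zero.2 fun h0 => hA.det_pos.ne' ?_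
    rw [← h, h0, zero_mul]
  rw [← hA.posSemidef.inv_sqrt]
  exact nonsing_inv_mul _ hs

lemma sqrt_mul_sqrt_inv {A : Mat p} (hA : A.PosDef) : CFC.sqrt A * CFC.sqrt A⁻¹ = 1 :=
  mul_eq_one_comm.1 (sqrt_inv_mul_sqrt hA)

lemma norm_act_sqrt_sq {A : Mat p} (hA : A.PosSemidef) (v : Vec p) :
    ‖act (CFC.sqrt A) v‖ ^ 2 = quadForm A v := by
  rw [← real_inner_self_eq_norm_sq, ← inner_act_transpose, transpose_sqrt, ← act_mul,
    sqrt_mul_sqrt hA, quadForm_eq_inner]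

/-- The smallest eigenvalue of `A` is at least `‖A⁻¹‖⁻¹`. -/
lemma norm_sq_le_quadForm {A : Mat p} (hA : A.PosDef) (v : Vec p) :
    ‖v‖ ^ 2 ≤ specNorm A⁻¹ * quadForm A v := by
  have h := norm_act_le (CFC.sqrt A⁻¹) (act (CFC.sqrt A) v)
  rw [← act_mul, sqrt_inv_mul_sqrt hA, act_one] at h
  have h2 := pow_le_pow_left₀ (norm_nonneg _) h 2
  rwa [mul_pow, specNorm_sqrt_sq hA.inv.posSemidef, norm_act_sqrt_sq hA.posSemidef] at h2

end SquareRoots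

section LogDet

lemma abs_log_one_add_sub_le {x : ℝ} (hx : |x| ≤ 1 / 2) : |Real.log (1 + x) - x| ≤ 2 * x ^ 2 := by
  have h := Real.abs_log_sub_add_sum_range_le (x := -x) (by rw [abs_neg]; linarith) 1
  simp only [Finset.sum_range_one, sub_neg_eq_add, abs_neg] at h
  norm_num at h
  rw [neg_add_eq_sub] at h
  refine h.trans ?_
  rw [div_le_iff₀ (by linarith), ← sq_abs x]
  nlinarith [sq_nonneg |x|]

lemma abs_log_one_add_sub_add_le {x : ℝ} (hx : |x| ≤ 1 / 2) :
    |Real.log (1 + x) - x + x ^ 2 / 2| ≤ 2 * |x| ^ 3 := by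
  have h := Real.abs_log_sub_add_sum_range_le (x := -x) (by rw [abs_neg]; linarith) 2
  simp only [Finset.sum_range_succ, Finset.sum_range_zero, sub_neg_eq_add, abs_neg] at h
  norm_num at h
  have e : -x + x ^ 2 / 2 + Real.log (1 + x) = Real.log (1 + x) - x + x ^ 2 / 2 := by ring
  rw [e] at h
  refine h.trans ?_
  rw [div_le_iff₀ (by linarith)]
  have : 0 ≤ |x| ^ 3 := by positivity
  nlinarith

/-- Simultaneous diagonalization of the quantities in the expansion of `log det (1 + H)`. -/
lemma exists_eigenvalues {H : Mat p} (hH : Hᵀ = H) : ∃ l : Fin p → ℝ,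
    (1 + H).det = ∏ i, (1 + l i) ∧ H.trace = ∑ i, l i ∧ (H * H).trace = ∑ i, l i ^ 2 := by
  have hh : H.IsHermitian := by rwa [IsHermitian, conjTranspose_eq_transpose_of_trivial]
  have hs := hh.spectral_theorem
  set U := hh.eigenvectorUnitary
  set D : Mat p := diagonal (RCLike.ofReal ∘ hh.eigenvalues) with hD
  have hU : star (U : Mat p) * (U : Mat p) = 1 := Unitary.coe_star_mul_self U
  have hU' : (U : Mat p) * star (U : Mat p) = 1 := Unitary.coe_mul_star_self U
  rw [Unitary.conjStarAlgAut_apply] at hs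
  refine ⟨hh.eigenvalues, ?_, ?_, ?_⟩
  · have : 1 + H = (U : Mat p) * (1 + D) * star (U : Mat p) := by
      rw [mul_add, add_mul, mul_one, hU', ← hs]
    rw [this, det_mul_right_comm, hU', one_mul, hD, ← diagonal_one, diagonal_add, det_diagonal]
    simp
  · simpa using hh.trace_eq_sum_eigenvalues
  · have : H * H = (U : Mat p) * (D * D) * star (U : Mat p) := by
      conv_lhs => rw [hs]
      simp only [mul_assoc]
      rw [← mul_assoc (star (U : Mat p)) (U : Mat p), hU, one_mul]
    rw [this, trace_mul_comm, ← mul_assoc, hU, one_mul, hD, diagonal_mul_diagonal, trace_diagonal]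
    simp [sq]

/-- Expansions of `log det (1 + H)` for a symmetric `H` of small Frobenius norm. -/
lemma det_one_add_pos {H : Mat p} (hH : Hᵀ = H) (hF : frobNorm H ≤ 1 / 2) : 0 < (1 + H).det ∧
    |Real.log (1 + H).det - H.trace| ≤ 2 * frobNorm H ^ 2 ∧
    |Real.log (1 + H).det - H.trace + (H * H).trace / 2| ≤ 2 * frobNorm H ^ 3 := by
  obtain ⟨l, hdet, htr, hsq⟩ := exists_eigenvalues hH
  have hF2 : frobNorm H ^ 2 = ∑ i, l i ^ 2 := by rw [frobNorm_sq_eq_trace, hH, hsq]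
  have hl : ∀ i, |l i| ≤ frobNorm H := fun i => by
    refine abs_le_of_sq_le_sq ?_ (frobNorm_nonneg H)
    rw [hF2]
    exact Finset.single_le_sum (f := fun i => l i ^ 2) (fun i _ => sq_nonneg _) (Finset.mem_univ i)
  have hpos : ∀ i, 0 < 1 + l i := fun i => by linarith [neg_abs_le (l i), hl i]
  have hlog : Real.log (1 + H).det = ∑ i, Real.log (1 + l i) := by
    rw [hdet, Real.log_prod fun i _ => (hpos i).ne']
  refine ⟨hdet ▸ Finset.prod_pos fun i _ => hpos i, ?_, ?_⟩
  · rw [hlog, htr, hF2, ← Finset.sum_sub_distrib, Finset.mul_sum]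
    exact (Finset.abs_sum_le_sum_abs _ _).trans
      (Finset.sum_le_sum fun i _ => abs_log_one_add_sub_le ((hl i).trans hF))
  · rw [hlog, htr, hsq, Finset.sum_div, ← Finset.sum_sub_distrib, ← Finset.sum_add_distrib]
    have e : 2 * frobNorm H ^ 3 = ∑ i, 2 * (frobNorm H * l i ^ 2) := by
      rw [← Finset.mul_sum, ← Finset.mul_sum, ← hF2]; ring
    rw [e]
    refine (Finset.abs_sum_le_sum_abs _ _).trans (Finset.sum_le_sum fun i _ => ?_)
    refine (abs_log_one_add_sub_add_le ((hl i).trans hF)).trans ?_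
    rw [pow_succ', sq_abs]
    gcongr
    exact hl i

/-- Expansion of `log det (A + E)` around a positive definite `A`, to first and second order. -/
lemma logdet_add {A E : Mat p} (hA : A.PosDef) (hE : Eᵀ = E)
    (hsmall : specNorm A⁻¹ * frobNorm E ≤ 1 / 2) : 0 < (A + E).det ∧
    |Real.log (A + E).det - Real.log A.det - (A⁻¹ * E).trace|
      ≤ 2 * (specNorm A⁻¹ * frobNorm E) ^ 2 ∧
    |Real.log (A + E).det - Real.log A.det - (A⁻¹ * E).trace
      + (A⁻¹ * E * (A⁻¹ * E)).trace / 2| ≤ 2 * (specNorm A⁻¹ * frobNorm E) ^ 3 := by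
  -- `A + E = A^{1/2} (1 + H) A^{1/2}` with `H = A^{-1/2} E A^{-1/2}` symmetric
  set R := CFC.sqrt A⁻¹ with hR
  set S := CFC.sqrt A with hS
  have hSS : S * S = A := sqrt_mul_sqrt hA.posSemidef
  have hRR : R * R = A⁻¹ := sqrt_mul_sqrt hA.inv.posSemidef
  have hRS : R * S = 1 := sqrt_inv_mul_sqrt hA
  have hSR : S * R = 1 := sqrt_mul_sqrt_inv hA
  set H := R * E * R with hH
  have hHt : Hᵀ = H := by
    rw [hH, transpose_mul, transpose_mul, hE, hR, transpose_sqrt, mul_assoc]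
  have hHF : frobNorm H ≤ specNorm A⁻¹ * frobNorm E := by
    rw [← specNorm_sqrt_sq hA.inv.posSemidef, ← hR]
    calc frobNorm H ≤ frobNorm (R * E) * specNorm R := frobNorm_mul_le' _ _
      _ ≤ specNorm R * frobNorm E * specNorm R := by
        gcongr
        · exact specNorm_nonneg _
        · exact frobNorm_mul_le _ _
      _ = _ := by ring
  obtain ⟨h0, h1, h2⟩ := det_one_add_pos hHt (hHF.trans hsmall)
  have hAE : A + E = S * (1 + H) * S := by
    rw [mul_add, add_mul, mul_one, hSS, hH]
    congr 1
    rw [← mul_assoc, ← mul_assoc, hSR, one_mul, mul_assoc, hRS, mul_one]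
  have hdet : (A + E).det = A.det * (1 + H).det := by
    rw [hAE, det_mul, det_mul, ← hSS, det_mul]; ring
  have htr : H.trace = (A⁻¹ * E).trace := by
    rw [hH, trace_mul_comm, ← mul_assoc, hRR]
  have htr2 : (H * H).trace = (A⁻¹ * E * (A⁻¹ * E)).trace := by
    have : H * H = R * (E * A⁻¹ * E * R) := by rw [hH, ← hRR]; simp only [mul_assoc]
    rw [this, trace_mul_comm, mul_assoc, mul_assoc, hRR, trace_mul_comm]
    simp only [mul_assoc]
    rw [trace_mul_comm]
    simp only [mul_assoc]
  have hlog : Real.log (A + E).det = Real.log A.det + Real.log (1 + H).det := by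
    rw [hdet, Real.log_mul hA.det_pos.ne' h0.ne']
  refine ⟨hdet ▸ mul_pos hA.det_pos h0, ?_, ?_⟩
  · rw [hlog, ← htr, add_sub_cancel_left]
    exact h1.trans (by gcongr; exact frobNorm_nonneg _)
  · rw [hlog, ← htr, ← htr2, add_sub_cancel_left]
    exact h2.trans (by gcongr; exact frobNorm_nonneg _)

end LogDet

section Perturbation

lemma posDef_add {A E : Mat p} (hA : A.PosDef) (hE : Eᵀ = E)
    (hsmall : specNorm A⁻¹ * specNorm E ≤ 1 / 2) : (A + E).PosDef := by
  refine PosDef.of_dotProduct_mulVec_pos ?_ fun {x} hx => ?_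
  · rw [IsHermitian, conjTranspose_eq_transpose_of_trivial, transpose_add, hE,
      transpose_eq_of_posDef hA]
  · have hv : 0 < ‖(WithLp.toLp 2 x : Vec p)‖ := by
      rw [norm_pos_iff]; simpa using hx
    have h1 := norm_sq_le_quadForm hA (WithLp.toLp 2 x)
    have h2 := abs_quadForm_le E (WithLp.toLp 2 x)
    have h3 : star x ⬝ᵥ ((A + E) *ᵥ x)
        = quadForm A (WithLp.toLp 2 x) + quadForm E (WithLp.toLp 2 x) := by
      simp [quadForm, add_mulVec]
    rw [h3]
    set v : Vec p := WithLp.toLp 2 x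
    have h4 := (abs_le.1 h2).1
    have h5 := specNorm_nonneg A⁻¹
    have h6 : specNorm A⁻¹ * quadForm E v ≥ -(1 / 2) * ‖v‖ ^ 2 := by
      nlinarith [mul_le_mul_of_nonneg_left h4 h5, sq_nonneg ‖v‖,
        mul_le_mul_of_nonneg_right hsmall (sq_nonneg ‖v‖)]
    have h7 : 0 < specNorm A⁻¹ * (quadForm A v + quadForm E v) := by
      nlinarith [pow_pos hv 2]
    exact pos_of_mul_pos_right h7 h5

/-- The resolvent identity for inverse matrices. -/
lemma inv_sub_inv {A B : Mat p} (hA : A.PosDef) (hB : B.PosDef) :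
    A - B = -(B * (A⁻¹ - B⁻¹) * A) := by
  rw [mul_sub, sub_mul, mul_nonsing_inv _ (PosDef.isUnit_det hB), one_mul, mul_assoc,
    nonsing_inv_mul _ (PosDef.isUnit_det hA), mul_one, neg_sub]

lemma specNorm_le_two_mul {A B : Mat p} (hA : A.PosDef) (hB : B.PosDef)
    (hsmall : specNorm B * specNorm (A⁻¹ - B⁻¹) ≤ 1 / 2) : specNorm A ≤ 2 * specNorm B := by
  have h : A = B - B * (A⁻¹ - B⁻¹) * A := by
    have := inv_sub_inv hA hB
    rw [sub_eq_iff_eq_add] at this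
    rw [sub_eq_add_neg, add_comm]; exact this
  have h1 : specNorm A ≤ specNorm B + specNorm (B * (A⁻¹ - B⁻¹) * A) := by
    conv_lhs => rw [h]
    exact specNorm_sub_le _ _
  have h2 : specNorm (B * (A⁻¹ - B⁻¹) * A) ≤ 1 / 2 * specNorm A := by
    calc _ ≤ specNorm (B * (A⁻¹ - B⁻¹)) * specNorm A := specNorm_mul_le _ _
      _ ≤ specNorm B * specNorm (A⁻¹ - B⁻¹) * specNorm A := by
        gcongr
        · exact specNorm_nonneg _
        · exact specNorm_mul_le _ _
      _ ≤ _ := by gcongr; exact specNorm_nonneg _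
  linarith

end Perturbation

end

/-! ### Expansions of the discriminant and of the log-likelihood of one class -/

section

variable {p : ℕ}

/-- The contribution of one class to the discriminant, `-(z - μ)ᵀ Ω (z - μ) + log det Ω`. -/
noncomputable def classDisc (z : Vec p) (η : ClassParam p) : ℝ :=
  -quadForm η.2 (z - η.1) + Real.log η.2.det

/-- The derivative of `classDisc` with respect to the covariance matrix. -/
noncomputable def classPhi (z : Vec p) (η : ClassParam p) : Mat p :=
  -(η.2 * (η.2⁻¹ - outer (z - η.1)) * η.2)

/-- The contribution of one class to `V²`. -/
noncomputable def classVar (z : Vec p) (η : ClassParam p) : ℝ :=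
  2 * frobNorm (CFC.sqrt η.2⁻¹ * classPhi z η * CFC.sqrt η.2⁻¹) ^ 2
    + quadForm η.2 ((2 : ℝ) • (z - η.1))

lemma mul_outer_mul {A B : Mat p} (v : Vec p) :
    A * outer v * B = vecMulVec (act A v).ofLp (act Bᵀ v).ofLp := by
  rw [outer, mul_vecMulVec, vecMulVec_mul, ofLp_act, ofLp_act,
    mulVec_transpose]

lemma classPhi_eq {η : ClassParam p} (hη : η.2.PosDef) (z : Vec p) :
    classPhi z η = outer (act η.2 (z - η.1)) - η.2 := by
  rw [classPhi, mul_sub, sub_mul, mul_nonsing_inv _ (PosDef.isUnit_det hη), one_mul,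
    mul_outer_mul, transpose_eq_of_posDef hη, neg_sub]
  rfl

lemma outer_transpose (v : Vec p) : (outer v)ᵀ = outer v := by
  rw [outer, transpose_vecMulVec]

lemma classPhi_transpose {η : ClassParam p} (hη : η.2.PosDef) (z : Vec p) :
    (classPhi z η)ᵀ = classPhi z η := by
  rw [classPhi_eq hη, transpose_sub, outer_transpose, transpose_eq_of_posDef hη]

lemma frobNorm_one_sq : frobNorm (1 : Mat p) ^ 2 = p := by
  rw [frobNorm_sq_eq_trace]; simp

lemma frobNorm_sq_sqrt_mul_mul_sqrt {A P : Mat p} (hA : A.PosDef) (hP : Pᵀ = P) :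
    frobNorm (CFC.sqrt A * P * CFC.sqrt A) ^ 2 = (A * P * (A * P)).trace := by
  rw [frobNorm_sq_eq_trace, transpose_mul, transpose_mul, transpose_sqrt, hP]
  set R := CFC.sqrt A
  have hRR : R * R = A := sqrt_mul_sqrt hA.posSemidef
  have : R * (P * R) * (R * P * R) = R * (P * (R * R) * P * R) := by simp only [mul_assoc]
  rw [this, hRR, trace_mul_comm, mul_assoc, mul_assoc, hRR, trace_mul_comm, mul_assoc, mul_assoc,
    trace_mul_comm]
  simp only [mul_assoc]

/-- In closed form the variance contributed by a class is `2 p + 2 ((z - μ)ᵀ Ω (z - μ))²`. -/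
lemma classVar_eq {η : ClassParam p} (hη : η.2.PosDef) (z : Vec p) :
    classVar z η = 2 * p + 2 * quadForm η.2 (z - η.1) ^ 2 := by
  set w := z - η.1 with hw
  set a := act η.2 w with ha
  have hu := PosDef.isUnit_det hη
  have h1 : η.2⁻¹ * classPhi z η = η.2⁻¹ * outer a - 1 := by
    rw [classPhi_eq hη, mul_sub, nonsing_inv_mul _ hu]
  have hia : act η.2⁻¹ a = w := by rw [ha, ← act_mul, nonsing_inv_mul _ hu, act_one]
  have htr1 : (η.2⁻¹ * outer a).trace = quadForm η.2 w := by
    rw [trace_mul_outer, quadForm_eq_inner, hia, quadForm_eq_inner, real_inner_comm]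
  have hmul : η.2⁻¹ * outer a * (η.2⁻¹ * outer a) = quadForm η.2 w • (η.2⁻¹ * outer a) := by
    have : outer a * η.2⁻¹ * outer a = quadForm η.2 w • outer a := by
      rw [← htr1, trace_mul_outer, outer, vecMulVec_mul, vecMulVec_mul_vecMulVec, quadForm,
        dotProduct_mulVec, vecMulVec_smul]
    calc _ = η.2⁻¹ * (outer a * η.2⁻¹ * outer a) := by simp only [mul_assoc]
      _ = _ := by rw [this, mul_smul_comm]
  rw [classVar, frobNorm_sq_sqrt_mul_mul_sqrt hη.inv (classPhi_transpose hη z), h1, sub_mul,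
    mul_sub, mul_sub, hmul, trace_sub, trace_sub, trace_sub, mul_one, one_mul, one_mul,
    trace_smul, htr1, trace_one, Fintype.card_fin, smul_eq_mul]
  have : quadForm η.2 ((2 : ℝ) • w) = 4 * quadForm η.2 w := by
    rw [quadForm_eq_inner, quadForm_eq_inner, act_vec_smul, inner_smul_left, inner_smul_right]
    simp only [conj_trivial]; ring
  rw [this]; ring

/-- The linear expansion of `classDisc` in the mean and the covariance matrix. The quadratic parts
in the mean and in the inverse covariance combine into a single quadratic form. -/
lemma abs_classDisc_sub_le {η₀ η : ClassParam p} (h₀ : η₀.2.PosDef) (hη : η.2.PosDef) (z : Vec p)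
    (hsmall : specNorm η₀.2 * frobNorm (η.2⁻¹ - η₀.2⁻¹) ≤ 1 / 2) :
    |classDisc z η - classDisc z η₀ - ((classPhi z η₀ * (η.2⁻¹ - η₀.2⁻¹)).trace
        + 2 * inner ℝ (z - η₀.1) (act η₀.2 (η.1 - η₀.1)))|
      ≤ 2 * specNorm η₀.2 *
          ‖act (η.2⁻¹ - η₀.2⁻¹) (act η₀.2 (z - η₀.1)) + (η.1 - η₀.1)‖ ^ 2
        + 2 * (specNorm η₀.2 * frobNorm (η.2⁻¹ - η₀.2⁻¹)) ^ 2 := by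
  obtain ⟨m, Ωs⟩ := η₀
  obtain ⟨μ, Ω⟩ := η
  simp only at *
  set D := Ω⁻¹ - Ωs⁻¹ with hD
  set w := z - m with hw
  set e := μ - m with he
  set a := act Ωs w with ha
  set u := act D a with hu
  have hzm : z - μ = w - e := by rw [hw, he]; abel
  have hsp : specNorm Ωs * specNorm D ≤ 1 / 2 :=
    (mul_le_mul_of_nonneg_left (specNorm_le_frobNorm D) (specNorm_nonneg _)).trans hsmall
  have hΩle : specNorm Ω ≤ 2 * specNorm Ωs := specNorm_le_two_mul hη h₀ hsp
  have hΩu : act Ω u = a - act Ω w := by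
    rw [hu, ha, ← act_mul, ← act_mul, ← act_sub]
    congr 1
    rw [hD, mul_sub, sub_mul, mul_nonsing_inv _ (PosDef.isUnit_det hη), one_mul, mul_assoc,
      nonsing_inv_mul _ (PosDef.isUnit_det h₀), mul_one]
  have hΩt := transpose_eq_of_posDef hη
  have hΩst := transpose_eq_of_posDef h₀
  have htr : (classPhi z (m, Ωs) * D).trace = quadForm D a - (Ωs * D).trace := by
    rw [classPhi_eq (η := (m, Ωs)) h₀, sub_mul, trace_sub, trace_mul_comm, trace_mul_outer]
  -- completing the square: `a - Ω w = Ω u` turns the second order part into one quadratic form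
  have hquad : -quadForm Ω (w - e) + quadForm Ωs w - quadForm D a - 2 * inner ℝ w (act Ωs e)
      = -quadForm Ω (u + e) := by
    have e1 : inner ℝ u (act Ω w) = inner ℝ a w - inner ℝ (act Ω w) w := by
      rw [inner_act_comm hΩt, hΩu, inner_sub_left]
    have e2 : inner ℝ u (act Ω e) = inner ℝ a e - inner ℝ (act Ω w) e := by
      rw [inner_act_comm hΩt, hΩu, inner_sub_left]
    have e3 : inner ℝ w (act Ωs e) = inner ℝ a e := inner_act_comm hΩst w e
    have e4 : inner ℝ w (act Ω e) = inner ℝ (act Ω w) e := inner_act_comm hΩt w e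
    simp only [quadForm_eq_inner, act_vec_add, act_vec_sub, inner_add_left, inner_add_right,
      inner_sub_left, inner_sub_right]
    rw [← ha, ← hu, hΩu, e2, e3, e4, inner_sub_right u a, inner_sub_right e a, e1,
      real_inner_comm (act Ω w) w, real_inner_comm (act Ω w) e, real_inner_comm a u,
      real_inner_comm a w, real_inner_comm a e]
    ring
  have hlogdet := logdet_add (A := Ωs⁻¹) (E := D) h₀.inv
    (by rw [hD, transpose_sub, transpose_eq_of_posDef hη.inv, transpose_eq_of_posDef h₀.inv])
    (by rwa [nonsing_inv_nonsing_inv _ (PosDef.isUnit_det h₀)])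
  rw [nonsing_inv_nonsing_inv _ (PosDef.isUnit_det h₀), hD, add_sub_cancel, ← hD] at hlogdet
  have hli : ∀ {A : Mat p}, A.PosDef → Real.log A⁻¹.det = -Real.log A.det := fun {A} hA => by
    rw [det_nonsing_inv, Ring.inverse_eq_inv', Real.log_inv]
  have hl := hlogdet.2.1
  rw [hli hη, hli h₀] at hl
  have hkey : classDisc z (μ, Ω) - classDisc z (m, Ωs) - ((classPhi z (m, Ωs) * D).trace
      + 2 * inner ℝ w (act Ωs e))
      = -quadForm Ω (u + e) - (-Real.log Ω.det - -Real.log Ωs.det - (Ωs * D).trace) := by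
    rw [htr, ← hquad]
    simp only [classDisc, hzm]
    rw [← hw]; ring
  rw [hkey]
  refine (abs_sub _ _).trans (add_le_add ?_ hl)
  rw [abs_neg]
  refine (abs_quadForm_le _ _).trans ?_
  gcongr

section Sample

variable {n : ℕ}

/-- The scatter matrix around any centre is the sample covariance plus a rank one bias term. -/
lemma scatter_eq (hn : n ≠ 0) (X : Fin n → Vec p) (m : Vec p) :
    scatter X m = sampleCov X + outer (m - sampleMean X) := by
  have hn' : (n : ℝ) ≠ 0 := by exact_mod_cast hn
  ext i j
  have hmean : ∀ i, ∑ k, X k i = n * sampleMean X i := fun i => by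
    simp only [sampleMean, PiLp.smul_apply, smul_eq_mul, WithLp.ofLp_sum, Finset.sum_apply]
    field_simp
  have hexp : ∀ c : Vec p, (scatter X c) i j = (n : ℝ)⁻¹ * ∑ k, X k i * X k j
      - sampleMean X i * c j - c i * sampleMean X j + c i * c j := by
    intro c
    have : ∑ k, (X k i - c i) * (X k j - c j) = ∑ k, X k i * X k j
        - (n * sampleMean X i) * c j - c i * (n * sampleMean X j) + n * (c i * c j) := by
      rw [← hmean, ← hmean, Finset.sum_mul, Finset.mul_sum, ← Finset.sum_sub_distrib,
        ← Finset.sum_sub_distrib]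
      have : (n : ℝ) * (c i * c j) = ∑ _k : Fin n, c i * c j := by simp
      rw [this, ← Finset.sum_add_distrib]
      exact Finset.sum_congr rfl fun k _ => by ring
    simp only [scatter, Matrix.smul_apply, Matrix.sum_apply, outer, vecMulVec_apply,
      PiLp.sub_apply, smul_eq_mul]
    rw [this]
    field_simp
  rw [Matrix.add_apply, sampleCov, hexp, hexp]
  simp only [outer, vecMulVec_apply, PiLp.sub_apply]
  ring

lemma scatter_transpose (X : Fin n → Vec p) (m : Vec p) : (scatter X m)ᵀ = scatter X m := by
  simp only [scatter, transpose_smul, transpose_sum, outer_transpose]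

lemma classLogLik_eq (hn : n ≠ 0) (X : Fin n → Vec p) (η : ClassParam p) :
    classLogLik X η = (n : ℝ) / 2 * (Real.log η.2.det - (η.2 * sampleCov X).trace
      - quadForm η.2 (η.1 - sampleMean X)) := by
  rw [classLogLik, scatter_eq hn, mul_add, trace_add, trace_mul_outer]; ring

/-- Second order expansion of the log-likelihood of a class along a perturbation of its mean and
precision matrix. -/
lemma abs_classLogLik_perturb_sub_le (hn : n ≠ 0) (X : Fin n → Vec p) {μ ξ : Vec p} {Ω P : Mat p}
    (hΩ : Ω.PosDef) (hP : Pᵀ = P) {s : ℝ} (hsmall : specNorm Ω⁻¹ * frobNorm ((2 * s) • P) ≤ 1 / 2) :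
    |classLogLik X (μ - s • ξ, Ω + (2 * s) • P) - classLogLik X (μ, Ω)
      - (n * s * ((P * (Ω⁻¹ - sampleCov X)).trace + inner ℝ ξ (act Ω (μ - sampleMean X))
            - quadForm P (μ - sampleMean X - s • ξ))
          - n * s ^ 2 * ((Ω⁻¹ * P * (Ω⁻¹ * P)).trace + quadForm Ω ξ / 2))|
      ≤ n * (specNorm Ω⁻¹ * frobNorm ((2 * s) • P)) ^ 3 := by
  obtain ⟨-, -, h3⟩ := logdet_add hΩ (E := (2 * s) • P) (by rw [transpose_smul, hP]) hsmall
  set d := μ - sampleMean X with hd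
  have hd' : μ - s • ξ - sampleMean X = d - s • ξ := by rw [hd]; abel
  have hΩt := transpose_eq_of_posDef hΩ
  have hq : quadForm Ω (d - s • ξ)
      = quadForm Ω d - 2 * s * inner ℝ ξ (act Ω d) + s ^ 2 * quadForm Ω ξ := by
    have e4 : inner ℝ d (act Ω ξ) = inner ℝ ξ (act Ω d) := by
      rw [inner_act_comm hΩt, real_inner_comm]
    simp only [quadForm_eq_inner, act_vec_sub, act_vec_smul, inner_sub_left, inner_sub_right,
      inner_smul_left, inner_smul_right, conj_trivial]
    rw [e4]; ring
  have hq2 : quadForm (Ω + (2 * s) • P) (d - s • ξ)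
      = quadForm Ω (d - s • ξ) + 2 * s * quadForm P (d - s • ξ) := by
    simp only [quadForm_eq_inner, act_add, act_smul, inner_add_right, inner_smul_right]
  have ht1 : (Ω⁻¹ * (2 * s) • P).trace = 2 * s * (P * Ω⁻¹).trace := by
    rw [mul_smul_comm, trace_smul, trace_mul_comm, smul_eq_mul]
  have ht2 : (Ω⁻¹ * (2 * s) • P * (Ω⁻¹ * (2 * s) • P)).trace
      = 4 * s ^ 2 * (Ω⁻¹ * P * (Ω⁻¹ * P)).trace := by
    rw [mul_smul_comm, smul_mul_smul_comm, trace_smul, smul_eq_mul]; ring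
  have ht3 : ((Ω + (2 * s) • P) * sampleCov X).trace
      = (Ω * sampleCov X).trace + 2 * s * (P * sampleCov X).trace := by
    rw [add_mul, trace_add, smul_mul_assoc, trace_smul, smul_eq_mul]
  rw [ht1, ht2] at h3
  rw [classLogLik_eq hn, classLogLik_eq hn]
  simp only
  rw [hd', ht3, hq2, hq, mul_sub P, trace_sub, ← hd]
  set r := Real.log (Ω + (2 * s) • P).det - Real.log Ω.det - 2 * s * (P * Ω⁻¹).trace
      + 4 * s ^ 2 * (Ω⁻¹ * P * (Ω⁻¹ * P)).trace / 2 with hr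
  have hlog : Real.log (Ω + (2 * s) • P).det = r + Real.log Ω.det + 2 * s * (P * Ω⁻¹).trace
      - 4 * s ^ 2 * (Ω⁻¹ * P * (Ω⁻¹ * P)).trace / 2 := by rw [hr]; ring
  rw [hlog]
  have hfin : (n : ℝ) / 2 * |r| ≤ n * (specNorm Ω⁻¹ * frobNorm ((2 * s) • P)) ^ 3 := by
    have : (0 : ℝ) ≤ n / 2 := by positivity
    calc _ ≤ (n : ℝ) / 2 * (2 * (specNorm Ω⁻¹ * frobNorm ((2 * s) • P)) ^ 3) := by gcongr
      _ = _ := by ring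
  refine le_trans (le_of_eq ?_) hfin
  rw [← abs_of_nonneg (show (0 : ℝ) ≤ n / 2 by positivity), ← abs_mul]
  congr 1
  rw [abs_of_nonneg (show (0 : ℝ) ≤ n / 2 by positivity)]
  ring

end Sample

end

/-! ### Error bounds and local asymptotic normality for one class -/

section

variable {p : ℕ}

/-- The quantities attached to the true parameter of a class are at most of the order of `V`. The
point `z` is arbitrary, so `z - μ` need not be bounded; it is `V` that grows with it. -/
structure ClassScale (L V : ℝ) (z : Vec p) (η₀ : ClassParam p) : Prop where
  one_le : 1 ≤ L
  posDef : η₀.2.PosDef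
  prec : specNorm η₀.2 ≤ L
  cov : specNorm η₀.2⁻¹ ≤ L
  one_le_V : 1 ≤ V
  sqrt_dim : Real.sqrt p ≤ V
  norm : ‖z - η₀.1‖ ≤ L * V
  norm_sq : ‖z - η₀.1‖ ^ 2 ≤ L * V
  phi : frobNorm (classPhi z η₀) ≤ L * V

/-- The sample mean and covariance are within their typical distance from the truth. The error of
the sample covariance is controlled at the rate `p / √n` in Frobenius norm and at the rate
`√(p / n)` in the one direction `Ω (z - μ)`; both are moment bounds, and no concentration
of its spectral norm is needed. -/
structure GoodSample {n : ℕ} (L : ℝ) (z : Vec p) (η₀ : ClassParam p) (X : Fin n → Vec p) :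
    Prop where
  mean : Real.sqrt n * ‖sampleMean X - η₀.1‖ ≤ L * Real.sqrt p
  cov_act : Real.sqrt n * ‖act (sampleCov X - η₀.2⁻¹) (act η₀.2 (z - η₀.1))‖
    ≤ L * Real.sqrt p * ‖act η₀.2 (z - η₀.1)‖
  cov : Real.sqrt n * frobNorm (sampleCov X - η₀.2⁻¹) ≤ L * p

/-- The parameter of a class is in a shrinking neighbourhood of the truth, of the size at which all
remainders of the expansions are `O(ρ)`. -/
structure ClassClose (n : ℕ) (ρ : ℝ) (η₀ η : ClassParam p) : Prop where
  posDef : η.2.PosDef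
  sq : Real.sqrt n * (‖η.1 - η₀.1‖ ^ 2 + specNorm (η.2⁻¹ - η₀.2⁻¹) ^ 2) ≤ ρ
  spec : Real.sqrt p * specNorm (η.2⁻¹ - η₀.2⁻¹) ≤ ρ
  frob : Real.sqrt p * frobNorm (η.2⁻¹ - η₀.2⁻¹) ≤ ρ
  frob_sq : Real.sqrt n * frobNorm (η.2⁻¹ - η₀.2⁻¹) ^ 2 ≤ Real.sqrt p * ρ

/-- The closed form of the variance shows that `V` dominates `√p` as well as `(z - μ)ᵀ Ω (z - μ)`,
and with them every other quantity attached to the class. -/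
lemma classScale_of_classVar_le {Λ V : ℝ} {z : Vec p} {η₀ : ClassParam p} (hΛ : 1 ≤ Λ)
    (h₀ : η₀.2.PosDef) (h1 : specNorm η₀.2 ≤ Λ) (h2 : specNorm η₀.2⁻¹ ≤ Λ) (hV : 0 ≤ V)
    (hvar : classVar z η₀ ≤ V ^ 2) (hp : 1 ≤ p) : ClassScale (2 * Λ) V z η₀ := by
  rw [classVar_eq h₀] at hvar
  set w := z - η₀.1 with hw
  set β := quadForm η₀.2 w with hβ
  have hp1 : (1 : ℝ) ≤ p := by exact_mod_cast hp
  have hβV : β ≤ V := le_of_sq_le_sq (by nlinarith [sq_nonneg β]) hV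
  have hpV : Real.sqrt p ≤ V := by
    refine le_of_sq_le_sq ?_ hV
    rw [Real.sq_sqrt (by positivity)]; nlinarith [sq_nonneg β]
  have hV1 : 1 ≤ V := le_of_sq_le_sq (by nlinarith [sq_nonneg β]) hV
  have hw2 : ‖w‖ ^ 2 ≤ Λ * V := by
    have hβ0 : 0 ≤ β := by
      rw [hβ, ← norm_act_sqrt_sq h₀.posSemidef]; positivity
    calc ‖w‖ ^ 2 ≤ specNorm η₀.2⁻¹ * β := norm_sq_le_quadForm h₀ w
      _ ≤ Λ * V := by gcongr
  have hΩw : ‖act η₀.2 w‖ ^ 2 ≤ Λ * V := by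
    have h := norm_act_le (CFC.sqrt η₀.2) (act (CFC.sqrt η₀.2) w)
    rw [← act_mul, sqrt_mul_sqrt h₀.posSemidef] at h
    have h3 := pow_le_pow_left₀ (norm_nonneg _) h 2
    rw [mul_pow, specNorm_sqrt_sq h₀.posSemidef, norm_act_sqrt_sq h₀.posSemidef] at h3
    refine h3.trans ?_
    calc specNorm η₀.2 * β ≤ specNorm η₀.2 * V :=
          mul_le_mul_of_nonneg_left hβV (specNorm_nonneg _)
      _ ≤ Λ * V := by gcongr
  have hF : frobNorm η₀.2 ≤ Λ * V := by
    have h := frobNorm_mul_le η₀.2 1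
    rw [mul_one] at h
    have h4 : frobNorm (1 : Mat p) = Real.sqrt p := by
      rw [← frobNorm_one_sq, Real.sqrt_sq (frobNorm_nonneg _)]
    rw [h4] at h
    calc _ ≤ specNorm η₀.2 * Real.sqrt p := h
      _ ≤ Λ * V := by gcongr
  refine ⟨by linarith, h₀, by linarith, by linarith, hV1, hpV, ?_, ?_, ?_⟩
  · refine le_of_sq_le_sq ?_ (by positivity)
    refine hw2.trans ?_
    nlinarith [mul_le_mul hΛ hV1 zero_le_one (by linarith)]
  · nlinarith
  · rw [classPhi_eq h₀]
    refine (frobNorm_sub_le _ _).trans ?_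
    rw [frobNorm_outer]
    linarith

section Arithmetic

variable {L V N g ρ : ℝ}

lemma scaled_le (hN : 0 ≤ N) (hg : 0 ≤ g) (hgV : g * N * V ≤ L) {x y : ℝ} (hy : 0 ≤ y)
    (h : N * x ≤ V * y) : N ^ 2 * g * x ≤ L * y := by
  calc N ^ 2 * g * x = g * N * (N * x) := by ring
    _ ≤ g * N * (V * y) := by gcongr
    _ = g * N * V * y := by ring
    _ ≤ L * y := by gcongr

lemma scaled_sq_le (hN : 0 ≤ N) (hg : 0 ≤ g) (hV : 0 ≤ V) (hgV : g * N * V ≤ L) {x y : ℝ}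
    (hy : 0 ≤ y) (h : x ≤ V ^ 2 * y) : N ^ 2 * g ^ 2 * x ≤ L ^ 2 * y := by
  calc N ^ 2 * g ^ 2 * x ≤ N ^ 2 * g ^ 2 * (V ^ 2 * y) := by gcongr
    _ = (g * N * V) ^ 2 * y := by ring
    _ ≤ L ^ 2 * y := by gcongr

end Arithmetic

section Errors

variable {n : ℕ} {L V ρ s : ℝ} {z : Vec p} {η₀ η : ClassParam p} {X : Fin n → Vec p}

/-- The rate `ρ` dominates `√(p³ / n)` and is small compared with the constant `L`, so that
lower-order terms can be absorbed. -/
structure Scales (n p : ℕ) (L ρ : ℝ) : Prop where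
  n_pos : 1 ≤ n
  p_pos : 1 ≤ p
  rate : p * Real.sqrt p ≤ ρ * Real.sqrt n
  small : 8 * L ^ 3 * ρ ≤ 1

lemma Scales.sqrt_n_pos (h : Scales n p L ρ) : 0 < Real.sqrt n :=
  Real.sqrt_pos.2 (by exact_mod_cast h.n_pos)

lemma Scales.one_le_sqrt_p (h : Scales n p L ρ) : 1 ≤ Real.sqrt p :=
  Real.one_le_sqrt.2 (by exact_mod_cast h.p_pos)

lemma Scales.one_le_p (h : Scales n p L ρ) : (1 : ℝ) ≤ p := by exact_mod_cast h.p_pos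

lemma Scales.p_le (h : Scales n p L ρ) : (p : ℝ) ≤ ρ * Real.sqrt n :=
  le_trans (by nlinarith [h.one_le_sqrt_p, h.one_le_p]) h.rate

lemma Scales.rho_pos (h : Scales n p L ρ) : 0 < ρ :=
  pos_of_mul_pos_left (lt_of_lt_of_le one_pos (h.one_le_p.trans h.p_le)) h.sqrt_n_pos.le

lemma ClassClose.spec_le (hc : ClassClose n ρ η₀ η) (h : Scales n p L ρ) :
    specNorm (η.2⁻¹ - η₀.2⁻¹) ≤ ρ :=
  le_trans (le_mul_of_one_le_left (specNorm_nonneg _) h.one_le_sqrt_p) hc.spec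

lemma ClassClose.frob_le (hc : ClassClose n ρ η₀ η) (h : Scales n p L ρ) :
    frobNorm (η.2⁻¹ - η₀.2⁻¹) ≤ ρ :=
  le_trans (le_mul_of_one_le_left (frobNorm_nonneg _) h.one_le_sqrt_p) hc.frob

lemma ClassScale.L_rho_le (hS : ClassScale L V z η₀) (h : Scales n p L ρ) :
    L * ρ ≤ 1 / 8 ∧ L ^ 2 * ρ ≤ 1 / 8 ∧ ρ ≤ 1 / 8 := by
  have h1 := hS.one_le
  have h2 := h.rho_pos
  have h3 := h.small
  have h4 : L ≤ L ^ 3 := le_self_pow₀ h1 (by norm_num)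
  have h5 : L ^ 2 ≤ L ^ 3 := pow_le_pow_right₀ h1 (by norm_num)
  refine ⟨?_, ?_, ?_⟩ <;> nlinarith

lemma ClassClose.prec_le (hS : ClassScale L V z η₀) (hc : ClassClose n ρ η₀ η)
    (h : Scales n p L ρ) : specNorm η.2 ≤ 2 * L := by
  refine (specNorm_le_two_mul hc.posDef hS.posDef ?_).trans (by linarith [hS.prec])
  calc _ ≤ L * ρ := mul_le_mul hS.prec (hc.spec_le h) (specNorm_nonneg _) (by linarith [hS.one_le])
    _ ≤ 1 / 2 := by linarith [(hS.L_rho_le h).1]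

lemma ClassClose.cov_le (hS : ClassScale L V z η₀) (hc : ClassClose n ρ η₀ η)
    (h : Scales n p L ρ) : specNorm η.2⁻¹ ≤ 2 * L := by
  have := specNorm_add_le (η.2⁻¹ - η₀.2⁻¹) η₀.2⁻¹
  rw [sub_add_cancel] at this
  linarith [hc.spec_le h, hS.cov, hS.one_le, (hS.L_rho_le h).2.2]

lemma GoodSample.mean_sq_le (hX : GoodSample L z η₀ X)
    (h : Scales n p L ρ) : Real.sqrt n * ‖sampleMean X - η₀.1‖ ^ 2 ≤ L ^ 2 * ρ := by
  have h1 := pow_le_pow_left₀ (by positivity) hX.mean 2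
  rw [mul_pow, mul_pow, Real.sq_sqrt (Nat.cast_nonneg p)] at h1
  refine le_of_mul_le_mul_left ?_ h.sqrt_n_pos
  calc _ = Real.sqrt n ^ 2 * ‖sampleMean X - η₀.1‖ ^ 2 := by ring
    _ ≤ L ^ 2 * p := h1
    _ ≤ L ^ 2 * (ρ * Real.sqrt n) := by gcongr; exact h.p_le
    _ = _ := by ring

/-- Replacing the precision matrix by its true value in the score of the mean. -/
lemma abs_inner_prec_sub_le (hS : ClassScale L V z η₀) (hc : ClassClose n ρ η₀ η)
    (hX : GoodSample L z η₀ X) (h : Scales n p L ρ) :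
    Real.sqrt n * |inner ℝ ((2 : ℝ) • (z - η₀.1)) (act η.2 (η.1 - sampleMean X))
      - 2 * inner ℝ (z - η₀.1) (act η₀.2 (η.1 - sampleMean X))| ≤ V * (8 * L ^ 4 * ρ) := by
  set D := η.2⁻¹ - η₀.2⁻¹ with hD
  set N := Real.sqrt n
  have hL := hS.one_le
  have hV := hS.one_le_V
  have hdec : η.1 - sampleMean X = (η.1 - η₀.1) - (sampleMean X - η₀.1) := by abel
  set d := η.1 - sampleMean X
  have hd : ‖d‖ ≤ ‖η.1 - η₀.1‖ + ‖sampleMean X - η₀.1‖ := by rw [hdec]; exact norm_sub_le _ _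
  have e : inner ℝ ((2 : ℝ) • (z - η₀.1)) (act η.2 d) - 2 * inner ℝ (z - η₀.1) (act η₀.2 d)
      = -(2 * inner ℝ (z - η₀.1) (act (η₀.2 * D * η.2) d)) := by
    have := congrArg (fun A => inner ℝ (z - η₀.1) (act A d)) (inv_sub_inv hc.posDef hS.posDef)
    simp only [act_sub, inner_sub_right] at this
    rw [inner_smul_left, conj_trivial, ← mul_sub, this]
    have h2 : act (-(η₀.2 * (η.2⁻¹ - η₀.2⁻¹) * η.2)) d = -act (η₀.2 * D * η.2) d := by
      simp only [act, map_neg]; rfl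
    rw [h2, inner_neg_right]; ring
  have hsp : specNorm (η₀.2 * D * η.2) ≤ L * specNorm D * (2 * L) := by
    calc _ ≤ specNorm (η₀.2 * D) * specNorm η.2 := specNorm_mul_le _ _
      _ ≤ (specNorm η₀.2 * specNorm D) * specNorm η.2 := by
        gcongr
        · exact specNorm_nonneg _
        · exact specNorm_mul_le _ _
      _ ≤ L * specNorm D * (2 * L) := by
        have := specNorm_nonneg D
        gcongr
        · exact specNorm_nonneg _
        · exact hS.prec
        · exact hc.prec_le hS h
  rw [e, abs_neg, abs_mul, abs_two]
  have hN : 0 < N := h.sqrt_n_pos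
  have hDn := specNorm_nonneg D
  have h1 : N * (specNorm D * ‖η.1 - η₀.1‖) ≤ ρ := by
    refine le_trans ?_ hc.sq
    gcongr
    nlinarith [sq_nonneg (specNorm D - ‖η.1 - η₀.1‖), sq_nonneg ‖η.1 - η₀.1‖,
      sq_nonneg (specNorm D)]
  have h2 : N * (specNorm D * ‖sampleMean X - η₀.1‖) ≤ L * ρ := by
    calc _ = specNorm D * (N * ‖sampleMean X - η₀.1‖) := by ring
      _ ≤ specNorm D * (L * Real.sqrt p) := mul_le_mul_of_nonneg_left hX.mean hDn
      _ = L * (Real.sqrt p * specNorm D) := by ring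
      _ ≤ L * ρ := by gcongr; exact hc.spec
  calc N * (2 * |inner ℝ (z - η₀.1) (act (η₀.2 * D * η.2) d)|)
      ≤ N * (2 * (specNorm (η₀.2 * D * η.2) * ‖z - η₀.1‖ * ‖d‖)) := by
        gcongr; exact abs_inner_act_le _ _ _
    _ ≤ N * (2 * ((L * specNorm D * (2 * L)) * (L * V) *
          (‖η.1 - η₀.1‖ + ‖sampleMean X - η₀.1‖))) := by
        gcongr
        exact hS.norm
    _ = V * (4 * L ^ 3 * (N * (specNorm D * ‖η.1 - η₀.1‖)
          + N * (specNorm D * ‖sampleMean X - η₀.1‖))) := by ring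
    _ ≤ V * (4 * L ^ 3 * (ρ + L * ρ)) := by gcongr
    _ ≤ V * (8 * L ^ 4 * ρ) := by
        have : 0 ≤ L ^ 3 * ρ := by have := h.rho_pos; positivity
        have hle : 4 * L ^ 3 * (ρ + L * ρ) ≤ 8 * L ^ 4 * ρ := by
          nlinarith [mul_le_mul_of_nonneg_left hL this]
        exact mul_le_mul_of_nonneg_left hle (by linarith)

/-- The interaction between the perturbations of the mean and of the precision matrix. -/
lemma abs_quadForm_phi_le (hS : ClassScale L V z η₀) (hc : ClassClose n ρ η₀ η)
    (hX : GoodSample L z η₀ X) (h : Scales n p L ρ) (hs : |s| * Real.sqrt n * V ≤ L) :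
    Real.sqrt n * |quadForm (classPhi z η₀)
      (η.1 - sampleMean X - s • (2 : ℝ) • (z - η₀.1))| ≤ V * (18 * L ^ 5 * ρ) := by
  set N := Real.sqrt n
  have hN : 0 < N := h.sqrt_n_pos
  have hL := hS.one_le
  have hV := hS.one_le_V
  have hρ := h.rho_pos
  set a := ‖η.1 - η₀.1‖
  set b := ‖sampleMean X - η₀.1‖
  set c := ‖s • (2 : ℝ) • (z - η₀.1)‖ with hc'
  set v := η.1 - sampleMean X - s • (2 : ℝ) • (z - η₀.1) with hv
  have hvn : ‖v‖ ≤ a + b + c := by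
    have : v = (η.1 - η₀.1) - (sampleMean X - η₀.1) - s • (2 : ℝ) • (z - η₀.1) := by
      rw [hv]; abel
    rw [this]
    exact (norm_sub_le _ _).trans (add_le_add (norm_sub_le _ _) le_rfl)
  have hv2 : ‖v‖ ^ 2 ≤ 3 * (a ^ 2 + b ^ 2 + c ^ 2) := by
    calc ‖v‖ ^ 2 ≤ (a + b + c) ^ 2 := by gcongr
      _ ≤ _ := by nlinarith [sq_nonneg (a - b), sq_nonneg (b - c), sq_nonneg (a - c)]
  have h1 : N * a ^ 2 ≤ ρ := by
    refine le_trans ?_ hc.sq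
    gcongr
    exact le_add_of_nonneg_right (sq_nonneg _)
  have h2 : N * b ^ 2 ≤ L ^ 2 * ρ := hX.mean_sq_le h
  have h3 : N * c ^ 2 ≤ 4 * L ^ 4 * ρ := by
    have hcle : N * c ≤ 2 * L ^ 2 := by
      rw [hc', norm_smul, norm_smul, Real.norm_eq_abs, Real.norm_eq_abs, abs_two]
      calc _ ≤ N * (|s| * (2 * (L * V))) := by gcongr; exact hS.norm
        _ = 2 * L * (|s| * N * V) := by ring
        _ ≤ 2 * L * L := by gcongr
        _ = _ := by ring
    have h4 := pow_le_pow_left₀ (by positivity) hcle 2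
    refine le_of_mul_le_mul_left ?_ hN
    calc N * (N * c ^ 2) = (N * c) ^ 2 := by ring
      _ ≤ (2 * L ^ 2) ^ 2 := h4
      _ = 4 * L ^ 4 * 1 := by ring
      _ ≤ 4 * L ^ 4 * (ρ * N) := by gcongr; exact h.one_le_p.trans h.p_le
      _ = _ := by ring
  have hL2 : L ^ 2 ≤ L ^ 4 := pow_le_pow_right₀ hL (by norm_num)
  have hL0 : 1 ≤ L ^ 4 := one_le_pow₀ hL
  calc N * |quadForm (classPhi z η₀) v|
      ≤ N * (specNorm (classPhi z η₀) * ‖v‖ ^ 2) := by gcongr; exact abs_quadForm_le _ _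
    _ ≤ N * ((L * V) * (3 * (a ^ 2 + b ^ 2 + c ^ 2))) := by
        gcongr
        exact (specNorm_le_frobNorm _).trans hS.phi
    _ = V * (3 * L * (N * a ^ 2 + N * b ^ 2 + N * c ^ 2)) := by ring
    _ ≤ V * (3 * L * (ρ + L ^ 2 * ρ + 4 * L ^ 4 * ρ)) := by gcongr
    _ ≤ V * (3 * L * (6 * L ^ 4 * ρ)) := by gcongr; nlinarith
    _ = _ := by ring

lemma norm_add_sq_le_two_mul (u v : Vec p) : ‖u + v‖ ^ 2 ≤ 2 * (‖u‖ ^ 2 + ‖v‖ ^ 2) := by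
  have h := norm_add_le u v
  have h2 := pow_le_pow_left₀ (norm_nonneg _) h 2
  nlinarith [sq_nonneg (‖u‖ - ‖v‖)]

lemma norm_act_prec_sq_le (hS : ClassScale L V z η₀) :
    ‖act η₀.2 (z - η₀.1)‖ ^ 2 ≤ L ^ 3 * V := by
  have h := pow_le_pow_left₀ (norm_nonneg _) (norm_act_le η₀.2 (z - η₀.1)) 2
  rw [mul_pow] at h
  have hL := hS.one_le
  calc _ ≤ _ := h
    _ ≤ L ^ 2 * (L * V) := by
      gcongr
      · exact specNorm_nonneg _
      · exact hS.prec
      · exact hS.norm_sq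
    _ = _ := by ring

/-- Linearization error of the discriminant at a parameter of the neighbourhood. -/
lemma abs_classDisc_error_le (hS : ClassScale L V z η₀) (hc : ClassClose n ρ η₀ η)
    (h : Scales n p L ρ) :
    Real.sqrt n * |classDisc z η - classDisc z η₀ - ((classPhi z η₀ * (η.2⁻¹ - η₀.2⁻¹)).trace
        + 2 * inner ℝ (z - η₀.1) (act η₀.2 (η.1 - η₀.1)))| ≤ V * (6 * L ^ 4 * ρ) := by
  set D := η.2⁻¹ - η₀.2⁻¹ with hD
  set N := Real.sqrt n
  have hN : 0 < N := h.sqrt_n_pos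
  have hL := hS.one_le
  have hV := hS.one_le_V
  have hρ := h.rho_pos
  have hsm : specNorm η₀.2 * frobNorm D ≤ 1 / 2 := by
    calc _ ≤ L * ρ := mul_le_mul hS.prec (hc.frob_le h) (frobNorm_nonneg _) (by linarith)
      _ ≤ 1 / 2 := by linarith [(hS.L_rho_le h).1]
  set a := act η₀.2 (z - η₀.1)
  have hDa : ‖act D a‖ ^ 2 ≤ specNorm D ^ 2 * (L ^ 3 * V) := by
    have h1 := pow_le_pow_left₀ (norm_nonneg _) (norm_act_le D a) 2
    rw [mul_pow] at h1
    refine h1.trans ?_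
    gcongr
    exact norm_act_prec_sq_le hS
  have hFsq : N * frobNorm D ^ 2 ≤ V * ρ := hc.frob_sq.trans (by gcongr; exact hS.sqrt_dim)
  have hb := abs_classDisc_sub_le hS.posDef hc.posDef z hsm
  have hsq : N * (‖η.1 - η₀.1‖ ^ 2 + specNorm D ^ 2) ≤ ρ := hc.sq
  have hL3 : 1 ≤ L ^ 3 * V := by nlinarith [one_le_pow₀ hL (n := 3)]
  calc _ ≤ N * (2 * specNorm η₀.2 * ‖act D a + (η.1 - η₀.1)‖ ^ 2
          + 2 * (specNorm η₀.2 * frobNorm D) ^ 2) := by gcongr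
    _ ≤ N * (2 * L * (2 * (specNorm D ^ 2 * (L ^ 3 * V) + ‖η.1 - η₀.1‖ ^ 2 * (L ^ 3 * V)))
          + 2 * (L * frobNorm D) ^ 2) := by
        have h1 := norm_add_sq_le_two_mul (act D a) (η.1 - η₀.1)
        have h2 : ‖η.1 - η₀.1‖ ^ 2 ≤ ‖η.1 - η₀.1‖ ^ 2 * (L ^ 3 * V) :=
          le_mul_of_one_le_right (sq_nonneg _) hL3
        have h3 := frobNorm_nonneg D
        have h4 := specNorm_nonneg η₀.2
        gcongr
        · exact hS.prec
        · linarith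
        · exact hS.prec
    _ = V * (4 * L ^ 4 * (N * (‖η.1 - η₀.1‖ ^ 2 + specNorm D ^ 2)))
          + 2 * L ^ 2 * (N * frobNorm D ^ 2) := by ring
    _ ≤ V * (4 * L ^ 4 * ρ) + 2 * L ^ 2 * (V * ρ) := by gcongr
    _ ≤ V * (6 * L ^ 4 * ρ) := by
        have : L ^ 2 ≤ L ^ 4 := pow_le_pow_right₀ hL (by norm_num)
        have : V * ρ * L ^ 2 ≤ V * ρ * L ^ 4 := by gcongr
        nlinarith

lemma GoodSample.posDef_sampleCov (hS : ClassScale L V z η₀) (hX : GoodSample L z η₀ X)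
    (h : Scales n p L ρ) : specNorm η₀.2 * frobNorm (sampleCov X - η₀.2⁻¹) ≤ 1 / 2 ∧
      (sampleCov X).PosDef := by
  have hN := h.sqrt_n_pos
  have hL := hS.one_le
  have hF : frobNorm (sampleCov X - η₀.2⁻¹) ≤ L * ρ := by
    refine le_of_mul_le_mul_left ?_ hN
    calc _ ≤ L * p := hX.cov
      _ ≤ L * (ρ * Real.sqrt n) := by gcongr; exact h.p_le
      _ = _ := by ring
  have hsm : specNorm η₀.2 * frobNorm (sampleCov X - η₀.2⁻¹) ≤ 1 / 2 := by
    calc _ ≤ L * (L * ρ) := mul_le_mul hS.prec hF (frobNorm_nonneg _) (by linarith)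
      _ ≤ 1 / 2 := by nlinarith [(hS.L_rho_le h).2.1]
  refine ⟨hsm, ?_⟩
  have := posDef_add hS.posDef.inv (E := sampleCov X - η₀.2⁻¹) (by
    rw [transpose_sub, sampleCov, scatter_transpose, transpose_eq_of_posDef hS.posDef.inv]) (by
    rw [nonsing_inv_nonsing_inv _ (PosDef.isUnit_det hS.posDef)]
    exact (mul_le_mul_of_nonneg_left (specNorm_le_frobNorm _) (specNorm_nonneg _)).trans hsm)
  rwa [add_sub_cancel] at this

/-- Linearization error of the discriminant at the sample mean and covariance. -/
lemma abs_classDisc_hat_error_le (hS : ClassScale L V z η₀) (hX : GoodSample L z η₀ X)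
    (h : Scales n p L ρ) :
    Real.sqrt n * |classDisc z (sampleMean X, (sampleCov X)⁻¹) - classDisc z η₀
      - ((classPhi z η₀ * (sampleCov X - η₀.2⁻¹)).trace
        + 2 * inner ℝ (z - η₀.1) (act η₀.2 (sampleMean X - η₀.1)))| ≤ V * (10 * L ^ 6 * ρ) := by
  obtain ⟨hsm, hpd⟩ := hX.posDef_sampleCov hS h
  set N := Real.sqrt n
  have hN : 0 < N := h.sqrt_n_pos
  have hL := hS.one_le
  have hV := hS.one_le_V
  have hρ := h.rho_pos
  have hinv : (sampleCov X)⁻¹⁻¹ = sampleCov X := nonsing_inv_nonsing_inv _ (PosDef.isUnit_det hpd)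
  have hb := abs_classDisc_sub_le (η := (sampleMean X, (sampleCov X)⁻¹)) hS.posDef hpd.inv z
    (by rw [hinv]; exact hsm)
  simp only [hinv] at hb
  set D := sampleCov X - η₀.2⁻¹ with hD
  set a := act η₀.2 (z - η₀.1)
  set b := ‖sampleMean X - η₀.1‖
  have h1 : N ^ 2 * ‖act D a‖ ^ 2 ≤ L ^ 5 * V * (ρ * N) := by
    have h2 := pow_le_pow_left₀ (by positivity) hX.cov_act 2
    rw [mul_pow, mul_pow, mul_pow, Real.sq_sqrt (Nat.cast_nonneg p)] at h2
    refine h2.trans ?_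
    calc L ^ 2 * p * ‖a‖ ^ 2 ≤ L ^ 2 * (ρ * N) * (L ^ 3 * V) := by
          gcongr
          · exact h.p_le
          · exact norm_act_prec_sq_le hS
      _ = _ := by ring
  have h2 : N ^ 2 * b ^ 2 ≤ L ^ 2 * (ρ * N) := by
    have := mul_le_mul_of_nonneg_left (hX.mean_sq_le h) hN.le
    calc _ = N * (N * b ^ 2) := by ring
      _ ≤ _ := this
      _ = _ := by ring
  have h3 : N ^ 2 * frobNorm D ^ 2 ≤ L ^ 2 * V * (ρ * N) := by
    have h2 := pow_le_pow_left₀ (mul_nonneg hN.le (frobNorm_nonneg _)) hX.cov 2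
    rw [mul_pow, mul_pow] at h2
    refine h2.trans ?_
    calc L ^ 2 * (p : ℝ) ^ 2 = L ^ 2 * (Real.sqrt p * (p * Real.sqrt p)) := by
          have := Real.mul_self_sqrt (Nat.cast_nonneg (α := ℝ) p)
          calc L ^ 2 * (p : ℝ) ^ 2 = L ^ 2 * (p * (Real.sqrt p * Real.sqrt p)) := by
                rw [this]; ring
            _ = _ := by ring
      _ ≤ L ^ 2 * (V * (ρ * N)) := by
          exact mul_le_mul_of_nonneg_left (mul_le_mul hS.sqrt_dim h.rate (by positivity)
            (by linarith)) (by positivity)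
      _ = _ := by ring
  refine le_of_mul_le_mul_left ?_ hN
  calc _ = N ^ 2 * |classDisc z (sampleMean X, (sampleCov X)⁻¹) - classDisc z η₀
      - ((classPhi z η₀ * D).trace
        + 2 * inner ℝ (z - η₀.1) (act η₀.2 (sampleMean X - η₀.1)))| := by ring
    _ ≤ N ^ 2 * (2 * specNorm η₀.2 * ‖act D a + (sampleMean X - η₀.1)‖ ^ 2
          + 2 * (specNorm η₀.2 * frobNorm D) ^ 2) := by gcongr
    _ ≤ N ^ 2 * (2 * L * (2 * (‖act D a‖ ^ 2 + b ^ 2)) + 2 * (L * frobNorm D) ^ 2) := by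
        have h1 := norm_add_sq_le_two_mul (act D a) (sampleMean X - η₀.1)
        have h3 := frobNorm_nonneg D
        have h4 := specNorm_nonneg η₀.2
        gcongr
        · exact hS.prec
        · exact hS.prec
    _ = 4 * L * (N ^ 2 * ‖act D a‖ ^ 2 + N ^ 2 * b ^ 2)
          + 2 * L ^ 2 * (N ^ 2 * frobNorm D ^ 2) := by ring
    _ ≤ 4 * L * (L ^ 5 * V * (ρ * N) + L ^ 2 * (ρ * N))
          + 2 * L ^ 2 * (L ^ 2 * V * (ρ * N)) := by gcongr
    _ = (4 * L ^ 6 * V + 4 * L ^ 3 + 2 * L ^ 4 * V) * (ρ * N) := by ring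
    _ ≤ (4 * L ^ 6 * V + 4 * (L ^ 6 * V) + 2 * (L ^ 6 * V)) * (ρ * N) := by
        have e1 : L ^ 3 ≤ L ^ 6 * V :=
          (pow_le_pow_right₀ hL (by norm_num)).trans (le_mul_of_one_le_right (by positivity) hV)
        have e2 : L ^ 4 ≤ L ^ 6 := pow_le_pow_right₀ hL (by norm_num)
        have e3 : L ^ 4 * V ≤ L ^ 6 * V := by gcongr
        gcongr (?_ : ℝ) * (ρ * N)
        linarith
    _ = _ := by ring

/-- Replacing the parameter by its true value in the curvature of the log-likelihood. -/
lemma abs_curvature_sub_le (hS : ClassScale L V z η₀) (hc : ClassClose n ρ η₀ η)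
    (h : Scales n p L ρ) :
    |(η.2⁻¹ * classPhi z η₀ * (η.2⁻¹ * classPhi z η₀)).trace
        + quadForm η.2 ((2 : ℝ) • (z - η₀.1)) / 2 - classVar z η₀ / 2|
      ≤ V ^ 2 * (7 * L ^ 4 * ρ) := by
  set D := η.2⁻¹ - η₀.2⁻¹ with hD
  set P := classPhi z η₀ with hP
  set w := z - η₀.1 with hw
  have hL := hS.one_le
  have hV := hS.one_le_V
  have hρ := h.rho_pos
  have hDρ : specNorm D ≤ ρ := hc.spec_le h
  have hF := frobNorm_nonneg P
  have hsplit : (η.2⁻¹ * P * (η.2⁻¹ * P)).trace - (η₀.2⁻¹ * P * (η₀.2⁻¹ * P)).trace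
      = (D * P * (η.2⁻¹ * P)).trace + (η₀.2⁻¹ * P * (D * P)).trace := by
    rw [← trace_sub, ← trace_add]
    congr 1
    rw [hD]; noncomm_ring
  have hb : ∀ {A B : Mat p} {x y : ℝ}, specNorm A ≤ x → specNorm B ≤ y → 0 ≤ x → 0 ≤ y →
      |(A * P * (B * P)).trace| ≤ x * y * (L * V) ^ 2 := by
    intro A B x y hA hB hx hy
    calc _ ≤ frobNorm (A * P) * frobNorm (B * P) := abs_trace_mul_le _ _
      _ ≤ (specNorm A * frobNorm P) * (specNorm B * frobNorm P) :=
        mul_le_mul (frobNorm_mul_le _ _) (frobNorm_mul_le _ _) (frobNorm_nonneg _)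
          (mul_nonneg (specNorm_nonneg _) hF)
      _ ≤ (x * (L * V)) * (y * (L * V)) := by
        have := hS.phi
        have := specNorm_nonneg A
        have := specNorm_nonneg B
        gcongr
      _ = _ := by ring
  have hq : |quadForm η.2 w - quadForm η₀.2 w| ≤ 2 * L ^ 2 * ρ * (L * V) ^ 2 := by
    have e : quadForm η.2 w - quadForm η₀.2 w = quadForm (-(η₀.2 * D * η.2)) w := by
      rw [hD, ← inv_sub_inv hc.posDef hS.posDef]
      simp only [quadForm_eq_inner, act_sub, inner_sub_right]
    rw [e]
    refine (abs_quadForm_le _ _).trans ?_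
    have hneg : specNorm (-(η₀.2 * D * η.2)) = specNorm (η₀.2 * D * η.2) := by
      simp only [specNorm, map_neg, norm_neg]
    rw [hneg]
    calc _ ≤ (L * ρ * (2 * L)) * (L * V) ^ 2 := by
          gcongr
          · calc _ ≤ specNorm (η₀.2 * D) * specNorm η.2 := specNorm_mul_le _ _
              _ ≤ (specNorm η₀.2 * specNorm D) * specNorm η.2 := by
                gcongr
                · exact specNorm_nonneg _
                · exact specNorm_mul_le _ _
              _ ≤ L * ρ * (2 * L) := by
                have := specNorm_nonneg D
                gcongr
                · exact specNorm_nonneg _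
                · exact hS.prec
                · exact hc.prec_le hS h
          · exact hS.norm
      _ = _ := by ring
  have hq2 : ∀ A : Mat p, quadForm A ((2 : ℝ) • w) = 4 * quadForm A w := fun A => by
    simp only [quadForm_eq_inner, act_vec_smul, inner_smul_left, inner_smul_right, conj_trivial]
    ring
  have hvar : classVar z η₀ = 2 * (η₀.2⁻¹ * P * (η₀.2⁻¹ * P)).trace + 4 * quadForm η₀.2 w := by
    rw [classVar, frobNorm_sq_sqrt_mul_mul_sqrt hS.posDef.inv (classPhi_transpose hS.posDef z),
      hq2]
  have h1 := hb hDρ (hc.cov_le hS h) hρ.le (by linarith)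
  have h2 := hb hS.cov hDρ (by linarith) hρ.le
  have hfin : (η.2⁻¹ * P * (η.2⁻¹ * P)).trace + quadForm η.2 ((2 : ℝ) • w) / 2 - classVar z η₀ / 2
      = (D * P * (η.2⁻¹ * P)).trace + (η₀.2⁻¹ * P * (D * P)).trace
        + 2 * (quadForm η.2 w - quadForm η₀.2 w) := by
    rw [← hsplit, hvar, hq2]; ring
  rw [hfin]
  calc _ ≤ ρ * (2 * L) * (L * V) ^ 2 + L * ρ * (L * V) ^ 2
        + 2 * (2 * L ^ 2 * ρ * (L * V) ^ 2) := by
        refine (abs_add_le _ _).trans (add_le_add ((abs_add_le _ _).trans (add_le_add h1 h2)) ?_)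
        rw [abs_mul, abs_two]
        gcongr
    _ = V ^ 2 * ((3 * L ^ 3 + 4 * L ^ 4) * ρ) := by ring
    _ ≤ V ^ 2 * (7 * L ^ 4 * ρ) := by
        have : L ^ 3 ≤ L ^ 4 := pow_le_pow_right₀ hL (by norm_num)
        gcongr
        linarith

/-- Local asymptotic normality within a class: along the perturbation, the log-likelihood ratio is,
up to an error of order `ρ`, a linear term in the difference between the discriminant and its
plug-in estimate, minus half the variance. -/
theorem abs_classLogLik_perturb_error_le (hS : ClassScale L V z η₀) (hc : ClassClose n ρ η₀ η)
    (hX : GoodSample L z η₀ X) (h : Scales n p L ρ) (hs : |s| * Real.sqrt n * V ≤ L) :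
    |classLogLik X (η.1 - s • (2 : ℝ) • (z - η₀.1), η.2 + (2 * s) • classPhi z η₀)
      - classLogLik X η - (n * s * (classDisc z η - classDisc z (sampleMean X, (sampleCov X)⁻¹))
        - n * s ^ 2 * (classVar z η₀ / 2))| ≤ 113 * L ^ 9 * ρ := by
  have hL := hS.one_le
  have hV := hS.one_le_V
  have hρ := h.rho_pos
  have hN : 0 < Real.sqrt n := h.sqrt_n_pos
  have hn : (n : ℝ) = Real.sqrt n ^ 2 := (Real.sq_sqrt (Nat.cast_nonneg n)).symm
  have hgV : |s| * V ≤ L * ρ := by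
    refine le_of_mul_le_mul_left ?_ hN
    calc _ = |s| * Real.sqrt n * V := by ring
      _ ≤ L * 1 := by linarith
      _ ≤ L * (ρ * Real.sqrt n) := by gcongr; exact h.one_le_p.trans h.p_le
      _ = _ := by ring
  have hx : specNorm η.2⁻¹ * frobNorm ((2 * s) • classPhi z η₀) ≤ 4 * L ^ 2 * (|s| * V) := by
    rw [frobNorm_smul, abs_mul, abs_two]
    calc _ ≤ (2 * L) * (2 * |s| * (L * V)) := by
          have := frobNorm_nonneg (classPhi z η₀)
          gcongr
          · exact hc.cov_le hS h
          · exact hS.phi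
      _ = _ := by ring
  have hx0 : 0 ≤ specNorm η.2⁻¹ * frobNorm ((2 * s) • classPhi z η₀) :=
    mul_nonneg (specNorm_nonneg _) (frobNorm_nonneg _)
  have hsmall : specNorm η.2⁻¹ * frobNorm ((2 * s) • classPhi z η₀) ≤ 1 / 2 := by
    refine hx.trans ?_
    calc _ ≤ 4 * L ^ 2 * (L * ρ) := by gcongr
      _ = 8 * L ^ 3 * ρ / 2 := by ring
      _ ≤ 1 / 2 := by linarith [h.small]
  have hlik := abs_classLogLik_perturb_sub_le (by have := h.n_pos; omega) X (μ := η.1)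
    (ξ := (2 : ℝ) • (z - η₀.1)) hc.posDef (classPhi_transpose hS.posDef z) hsmall
  have hf : (n : ℝ) * (specNorm η.2⁻¹ * frobNorm ((2 * s) • classPhi z η₀)) ^ 3
      ≤ 64 * L ^ 9 * ρ := by
    calc _ ≤ (n : ℝ) * (4 * L ^ 2 * (|s| * V)) ^ 3 := by gcongr
      _ = Real.sqrt n ^ 2 * (4 * L ^ 2 * (|s| * V)) ^ 3 := by rw [← hn]
      _ = 64 * L ^ 6 * ((|s| * Real.sqrt n * V) ^ 2 * (|s| * V)) := by ring
      _ ≤ 64 * L ^ 6 * (L ^ 2 * (L * ρ)) := by gcongr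
      _ = _ := by ring
  have ha := scaled_le hN.le (abs_nonneg s) hs (by positivity) (abs_inner_prec_sub_le hS hc hX h)
  have hb := scaled_le hN.le (abs_nonneg s) hs (by positivity) (abs_quadForm_phi_le hS hc hX h hs)
  have hcc := scaled_le hN.le (abs_nonneg s) hs (by positivity) (abs_classDisc_error_le hS hc h)
  have hd := scaled_le hN.le (abs_nonneg s) hs (by positivity) (abs_classDisc_hat_error_le hS hX h)
  have he := scaled_sq_le hN.le (abs_nonneg s) (by linarith) hs (by positivity)
    (abs_curvature_sub_le hS hc h)
  rw [← hn] at ha hb hcc hd he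
  have hmul : ∀ x : ℝ, (n : ℝ) * |s| * |x| = |n * s * x| := fun x => by
    rw [abs_mul, abs_mul, Nat.abs_cast]
  have hmul2 : ∀ x : ℝ, (n : ℝ) * |s| ^ 2 * |x| = |n * s ^ 2 * x| := fun x => by
    rw [abs_mul, abs_mul, Nat.abs_cast, abs_pow]
  rw [hmul] at ha hb hcc hd
  rw [hmul2] at he
  -- the score at the parameter is the difference of the linear parts of the discriminant at the
  -- parameter and at the sample moments
  have htr : (classPhi z η₀ * (η.2⁻¹ - sampleCov X)).trace
      = (classPhi z η₀ * (η.2⁻¹ - η₀.2⁻¹)).trace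
        - (classPhi z η₀ * (sampleCov X - η₀.2⁻¹)).trace := by
    rw [← trace_sub, ← mul_sub, sub_sub_sub_cancel_right]
  have hin : inner ℝ (z - η₀.1) (act η₀.2 (η.1 - sampleMean X))
      = inner ℝ (z - η₀.1) (act η₀.2 (η.1 - η₀.1))
        - inner ℝ (z - η₀.1) (act η₀.2 (sampleMean X - η₀.1)) := by
    rw [← inner_sub_right, ← act_vec_sub, sub_sub_sub_cancel_right]
  rw [hin] at ha
  rw [htr] at hlik
  have hlik' := hlik.trans hf
  -- `64 + 8 + 18 + 6 + 10 + 7 = 113` collects the constants of the individual errors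
  have hpow : ∀ k ≤ 9, L ^ k * ρ ≤ L ^ 9 * ρ := fun k hk => by
    gcongr
  have p5 := hpow 5 (by norm_num)
  have p6 := hpow 6 (by norm_num)
  have p7 := hpow 7 (by norm_num)
  rw [abs_le] at *
  constructor <;> linarith [ha.1, ha.2, hb.1, hb.2, hcc.1, hcc.2, hd.1, hd.2, he.1, he.2,
    hlik'.1, hlik'.2]

end Errors

end

/-! ### Moments of Gaussian samples -/

section

section Chebyshev

variable {E : Type*} [MeasurableSpace E] {μ : Measure E} [IsProbabilityMeasure μ]

lemma integral_sampleAverage_sub_sq {f : E → ℝ} (hf : MemLp f 2 μ) {n : ℕ} (hn : n ≠ 0) :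
    Integrable (fun X : Fin n → E => ((n : ℝ)⁻¹ * ∑ k, f (X k) - ∫ x, f x ∂μ) ^ 2)
      (Measure.pi fun _ => μ) ∧
    ∫ X : Fin n → E, ((n : ℝ)⁻¹ * ∑ k, f (X k) - ∫ x, f x ∂μ) ^ 2 ∂(Measure.pi fun _ => μ)
      = (n : ℝ)⁻¹ * Var[f; μ] := by
  have hn' : (n : ℝ) ≠ 0 := by exact_mod_cast hn
  set S : (Fin n → E) → ℝ := ∑ k, fun X : Fin n → E => f (X k) with hS
  have hcomp : ∀ k : Fin n, MemLp (fun X : Fin n → E => f (X k)) 2 (Measure.pi fun _ => μ) :=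
    fun k => hf.comp_measurePreserving (measurePreserving_eval (fun _ : Fin n => μ) k)
  have hSL : MemLp S 2 (Measure.pi fun _ => μ) := memLp_finsetSum' _ fun k _ => hcomp k
  have hSint : ∫ X, S X ∂(Measure.pi fun _ => μ) = n * ∫ x, f x ∂μ := by
    simp only [hS, Finset.sum_apply]
    rw [integral_finsetSum _ fun k _ => (hcomp k).integrable (by norm_num)]
    have : ∀ k : Fin n, ∫ X : Fin n → E, f (X k) ∂(Measure.pi fun _ => μ) = ∫ x, f x ∂μ := by
      intro k
      have hmp := measurePreserving_eval (fun _ : Fin n => μ) k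
      conv_rhs => rw [← hmp.map_eq]
      rw [integral_map hmp.measurable.aemeasurable]
      rw [hmp.map_eq]; exact hf.aestronglyMeasurable
    simp [this]
  have hvar : Var[S; Measure.pi fun _ => μ] = n * Var[f; μ] := by
    rw [hS, variance_sum_pi (X := fun _ : Fin n => f) fun _ => hf]
    simp
  have heq : ∀ X : Fin n → E, ((n : ℝ)⁻¹ * ∑ k, f (X k) - ∫ x, f x ∂μ) ^ 2
      = ((n : ℝ) ^ 2)⁻¹ * (S X - ∫ X, S X ∂(Measure.pi fun _ => μ)) ^ 2 := by
    intro X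
    rw [hSint]
    simp only [hS, Finset.sum_apply]
    field_simp
  simp only [heq]
  constructor
  · exact ((hSL.sub (memLp_const _)).integrable_sq).const_mul _
  · rw [integral_const_mul, ← variance_eq_integral hSL.aestronglyMeasurable.aemeasurable, hvar]
    field_simp

/-- Chebyshev's inequality for finitely many empirical averages at once. -/
lemma measure_pi_sum_sq_gt_le {J : Type*} [Fintype J] {f : J → E → ℝ}
    (hf : ∀ j, MemLp (f j) 2 μ) {K : ℝ} (hK : ∀ j, Var[f j; μ] ≤ K) {n : ℕ} (hn : n ≠ 0)
    {t : ℝ} (ht : 0 < t) :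
    (Measure.pi fun _ : Fin n => μ)
      {X | t < n * ∑ j, ((n : ℝ)⁻¹ * ∑ k, f j (X k) - ∫ x, f j x ∂μ) ^ 2}
      ≤ ENNReal.ofReal (Fintype.card J * K / t) := by
  have hn' : (n : ℝ) ≠ 0 := by exact_mod_cast hn
  set g : (Fin n → E) → ℝ :=
    fun X => n * ∑ j, ((n : ℝ)⁻¹ * ∑ k, f j (X k) - ∫ x, f j x ∂μ) ^ 2 with hg
  have hint : Integrable g (Measure.pi fun _ => μ) :=
    (integrable_finsetSum _ fun j _ => (integral_sampleAverage_sub_sq (hf j) hn).1).const_mul _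
  have hval : ∫ X, g X ∂(Measure.pi fun _ => μ) ≤ Fintype.card J * K := by
    rw [hg, integral_const_mul,
      integral_finsetSum _ fun j _ => (integral_sampleAverage_sub_sq (hf j) hn).1, Finset.mul_sum]
    calc _ = ∑ j, Var[f j; μ] := by
          refine Finset.sum_congr rfl fun j _ => ?_
          rw [(integral_sampleAverage_sub_sq (hf j) hn).2]
          field_simp
      _ ≤ ∑ _j : J, K := Finset.sum_le_sum fun j _ => hK j
      _ = _ := by simp
  have hmark := mul_meas_ge_le_integral_of_nonneg
    (ae_of_all (Measure.pi fun _ : Fin n => μ) fun X => by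
      show 0 ≤ g X
      positivity) hint t
  rw [← ofReal_measureReal]
  refine ENNReal.ofReal_le_ofReal ?_
  rw [le_div_iff₀ ht, mul_comm]
  refine le_trans ?_ (hmark.trans hval)
  exact mul_le_mul_of_nonneg_left (measureReal_mono fun X (hX : t < g X) => hX.le) ht.le

end Chebyshev

lemma pow_four_le_exp (y : ℝ) : y ^ 4 ≤ 24 * (Real.exp y + Real.exp (-y)) := by
  have h : ∀ x : ℝ, 0 ≤ x → x ^ 4 ≤ 24 * Real.exp x := fun x hx => by
    have := Real.pow_div_factorial_le_exp x hx 4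
    rw [div_le_iff₀ (by positivity)] at this
    norm_num [Nat.factorial] at this
    linarith
  rcases le_total 0 y with hy | hy
  · linarith [h y hy, Real.exp_pos (-y)]
  · have := h (-y) (by linarith)
    rw [Even.neg_pow (by decide)] at this
    linarith [Real.exp_pos y]

/-- A crude bound on the fourth central moment, from the moment generating function at `1` and
`-1`. -/
lemma integral_gaussianReal_pow_four_le (m : ℝ) (v : NNReal) :
    Integrable (fun x => (x - m) ^ 4) (gaussianReal m v) ∧
      ∫ x, (x - m) ^ 4 ∂(gaussianReal m v) ≤ 48 * Real.exp (v / 2) := by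
  have hexp : ∀ t : ℝ, Integrable (fun x => Real.exp (t * (x - m))) (gaussianReal m v) ∧
      ∫ x, Real.exp (t * (x - m)) ∂(gaussianReal m v) = Real.exp (v * t ^ 2 / 2) := by
    intro t
    have e : ∀ x, Real.exp (t * (x - m)) = Real.exp (t * x) * Real.exp (-(m * t)) := fun x => by
      rw [← Real.exp_add]; ring_nf
    simp only [e]
    refine ⟨(integrable_exp_mul_gaussianReal t).mul_const _, ?_⟩
    rw [integral_mul_const]
    have := congrFun (mgf_fun_id_gaussianReal (μ := m) (v := v)) t
    rw [mgf] at this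
    rw [this, ← Real.exp_add]; ring_nf
  have hdom : Integrable (fun x => 24 * (Real.exp (1 * (x - m)) + Real.exp (-1 * (x - m))))
      (gaussianReal m v) := ((hexp 1).1.add (hexp (-1)).1).const_mul _
  have hle : ∀ x : ℝ, (x - m) ^ 4
      ≤ 24 * (Real.exp (1 * (x - m)) + Real.exp (-1 * (x - m))) := fun x => by
    rw [one_mul, neg_one_mul]; exact pow_four_le_exp _
  have hint : Integrable (fun x => (x - m) ^ 4) (gaussianReal m v) := by
    refine hdom.mono' (by fun_prop) (ae_of_all _ fun x => ?_)
    rw [Real.norm_eq_abs, abs_of_nonneg (by positivity)]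
    exact hle x
  refine ⟨hint, (integral_mono hint hdom hle).trans (le_of_eq ?_)⟩
  rw [integral_const_mul, integral_add (hexp 1).1 (hexp (-1)).1, (hexp 1).2, (hexp (-1)).2]
  norm_num
  ring

variable {p : ℕ}

section GaussianMoments

variable {m : Vec p} {S : Mat p}

lemma variance_inner_multivariateGaussian (hS : S.PosSemidef) (c : Vec p) :
    Var[fun x => inner ℝ c x; multivariateGaussian m S] = quadForm S c := by
  rw [← covarianceBilin_self IsGaussian.memLp_two_id, covarianceBilin_multivariateGaussian hS]
  rfl

lemma integral_inner_multivariateGaussian (c : Vec p) :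
    ∫ x, inner ℝ c x ∂(multivariateGaussian m S) = inner ℝ c m := by
  have := IsGaussian.integral_dual (μ := multivariateGaussian m S) (innerSL ℝ c)
  simpa using this

lemma integral_inner_pow_four_le (hS : S.PosSemidef) (c : Vec p) :
    Integrable (fun x => inner ℝ c (x - m) ^ 4) (multivariateGaussian m S) ∧
      ∫ x, inner ℝ c (x - m) ^ 4 ∂(multivariateGaussian m S)
        ≤ 48 * Real.exp (quadForm S c / 2) := by
  have hmap : (multivariateGaussian m S).map (innerSL ℝ c)
      = gaussianReal (inner ℝ c m) (quadForm S c).toNNReal := by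
    have h := IsGaussian.map_eq_gaussianReal (μ := multivariateGaussian m S) (innerSL ℝ c)
    rw [h]
    congr 1
    · exact integral_inner_multivariateGaussian c
    · congr 1
      exact variance_inner_multivariateGaussian hS c
  have h0 : 0 ≤ quadForm S c := by
    rw [← variance_inner_multivariateGaussian (m := m) hS]; exact variance_nonneg _ _
  obtain ⟨h1, h2⟩ := integral_gaussianReal_pow_four_le (inner ℝ c m) (quadForm S c).toNNReal
  rw [← hmap] at h1 h2
  rw [Real.coe_toNNReal _ h0] at h2
  have hm : AEMeasurable (innerSL ℝ c) (multivariateGaussian m S) := by fun_prop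
  have e : ∀ x : Vec p, inner ℝ c (x - m) = (innerSL ℝ c) x - inner ℝ c m := fun x => by
    rw [inner_sub_right]; rfl
  simp only [e]
  refine ⟨h1.comp_aemeasurable hm, ?_⟩
  rw [integral_map hm (by fun_prop)] at h2
  exact h2

/-- Products of two centred linear forms of a Gaussian vector: mean and a bound on the variance. -/
lemma inner_mul_inner_multivariateGaussian (hS : S.PosSemidef) {Λ : ℝ} (c d : Vec p)
    (hc : quadForm S c ≤ Λ) (hd : quadForm S d ≤ Λ) :
    MemLp (fun x => inner ℝ c (x - m) * inner ℝ d (x - m)) 2 (multivariateGaussian m S) ∧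
    ∫ x, inner ℝ c (x - m) * inner ℝ d (x - m) ∂(multivariateGaussian m S)
      = inner ℝ c (act S d) ∧
    Var[fun x => inner ℝ c (x - m) * inner ℝ d (x - m); multivariateGaussian m S]
      ≤ 48 * Real.exp (Λ / 2) := by
  obtain ⟨i1, v1⟩ := integral_inner_pow_four_le (m := m) hS c
  obtain ⟨i2, v2⟩ := integral_inner_pow_four_le (m := m) hS d
  have hmeas : AEStronglyMeasurable (fun x : Vec p => inner ℝ c (x - m) * inner ℝ d (x - m))
      (multivariateGaussian m S) := by fun_prop
  have hdom : Integrable (fun x => (inner ℝ c (x - m) ^ 4 + inner ℝ d (x - m) ^ 4) / 2)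
      (multivariateGaussian m S) := (i1.add i2).div_const 2
  have hle : ∀ x : Vec p, (inner ℝ c (x - m) * inner ℝ d (x - m)) ^ 2
      ≤ (inner ℝ c (x - m) ^ 4 + inner ℝ d (x - m) ^ 4) / 2 := fun x => by
    nlinarith [sq_nonneg (inner ℝ c (x - m) ^ 2 - inner ℝ d (x - m) ^ 2)]
  have hsq : Integrable (fun x => (inner ℝ c (x - m) * inner ℝ d (x - m)) ^ 2)
      (multivariateGaussian m S) := by
    refine hdom.mono' (by fun_prop) (ae_of_all _ fun x => ?_)
    rw [Real.norm_eq_abs, abs_of_nonneg (sq_nonneg _)]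
    exact hle x
  refine ⟨(memLp_two_iff_integrable_sq hmeas).2 hsq, ?_, ?_⟩
  · have h := covarianceBilin_apply (μ := multivariateGaussian m S) IsGaussian.memLp_two_id c d
    rw [covarianceBilin_multivariateGaussian hS, integral_id_multivariateGaussian'] at h
    rw [← h, inner_act]
  · refine (variance_le_expectation_sq hmeas).trans ?_
    refine (integral_mono hsq hdom hle).trans ?_
    rw [integral_div, integral_add i1 i2]
    have e1 : Real.exp (quadForm S c / 2) ≤ Real.exp (Λ / 2) := Real.exp_le_exp.2 (by linarith)
    have e2 : Real.exp (quadForm S d / 2) ≤ Real.exp (Λ / 2) := Real.exp_le_exp.2 (by linarith)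
    linarith

end GaussianMoments

section GoodSample

variable {n : ℕ}

lemma quadForm_le_of_norm_le_one {S : Mat p} {c : Vec p} (hc : ‖c‖ ≤ 1) {Λ : ℝ}
    (hS : specNorm S ≤ Λ) : quadForm S c ≤ Λ := by
  refine (le_abs_self _).trans ((abs_quadForm_le S c).trans ?_)
  calc specNorm S * ‖c‖ ^ 2 ≤ specNorm S * 1 := by
        gcongr
        · exact specNorm_nonneg _
        · exact pow_le_one₀ (norm_nonneg _) hc
    _ ≤ Λ := by linarith

lemma inner_act_scatter (X : Fin n → Vec p) (m c d : Vec p) :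
    inner ℝ c (act (scatter X m) d)
      = (n : ℝ)⁻¹ * ∑ k, inner ℝ c (X k - m) * inner ℝ d (X k - m) := by
  have h : ∀ v : Vec p, inner ℝ c (act (outer v) d) = inner ℝ c v * inner ℝ d v := fun v => by
    rw [inner_act, outer, vecMulVec_mulVec]
    simp only [EuclideanSpace.inner_eq_star_dotProduct, star_trivial, dotProduct_smul,
      MulOpposite.smul_eq_mul_unop, MulOpposite.unop_op]
    rw [dotProduct_comm c.ofLp]
  have h2 : act (scatter X m) d = (n : ℝ)⁻¹ • ∑ k, act (outer (X k - m)) d := by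
    simp only [scatter, act, map_smul, map_sum, _root_.smul_apply,
      _root_.sum_apply]
  rw [h2, inner_smul_right, inner_sum]
  simp only [h]

lemma inner_single_left (i : Fin p) (v : Vec p) :
    inner ℝ (EuclideanSpace.single i (1 : ℝ)) v = v i := by
  simp [EuclideanSpace.inner_single_left]

lemma norm_sq_eq_sum_inner (v : Vec p) :
    ‖v‖ ^ 2 = ∑ i, inner ℝ (EuclideanSpace.single i (1 : ℝ)) v ^ 2 := by
  simp only [inner_single_left, EuclideanSpace.real_norm_sq_eq]

lemma frobNorm_sq_eq_sum_inner (A : Mat p) :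
    frobNorm A ^ 2 = ∑ x : Fin p × Fin p, inner ℝ (EuclideanSpace.single x.1 (1 : ℝ))
      (act A (EuclideanSpace.single x.2 (1 : ℝ))) ^ 2 := by
  rw [frobNorm_sq, Fintype.sum_prod_type]
  simp only [inner_single_left, ofLp_act]
  simp

lemma inner_sampleMean_sub (X : Fin n → Vec p) (m c : Vec p) :
    inner ℝ c (sampleMean X - m) = (n : ℝ)⁻¹ * ∑ k, inner ℝ c (X k) - inner ℝ c m := by
  rw [inner_sub_right, sampleMean, inner_smul_right, inner_sum]

/-- Deviations of the mean and of the scatter matrix around the true mean suffice for a good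
sample: recentring at the sample mean costs a term of smaller order. -/
lemma goodSample_of_scatter {M : ℝ} (hM : 1 ≤ M) {z : Vec p} {η₀ : ClassParam p}
    {X : Fin n → Vec p} (hn : n ≠ 0) (hp : 1 ≤ p) (hpn : p ≤ n)
    (h1 : n * ‖sampleMean X - η₀.1‖ ^ 2 ≤ M ^ 2 * p)
    (h2 : n * frobNorm (scatter X η₀.1 - η₀.2⁻¹) ^ 2 ≤ M ^ 2 * p ^ 2)
    (h3 : n * ‖act (scatter X η₀.1 - η₀.2⁻¹) (act η₀.2 (z - η₀.1))‖ ^ 2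
      ≤ M ^ 2 * p * ‖act η₀.2 (z - η₀.1)‖ ^ 2) :
    GoodSample (2 * M ^ 2) z η₀ X := by
  set a := act η₀.2 (z - η₀.1)
  have hn0 : (0 : ℝ) ≤ n := Nat.cast_nonneg n
  have hp0 : (0 : ℝ) ≤ p := Nat.cast_nonneg p
  have hp1 : (1 : ℝ) ≤ p := by exact_mod_cast hp
  have hMM : M ≤ M ^ 2 := by nlinarith
  have hsq := Real.sq_sqrt hn0
  have hsp := Real.sq_sqrt hp0
  have hN1 : 1 ≤ Real.sqrt n := Real.one_le_sqrt.2 (by exact_mod_cast Nat.one_le_iff_ne_zero.2 hn)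
  have hPN : Real.sqrt p ≤ Real.sqrt n := Real.sqrt_le_sqrt (by exact_mod_cast hpn)
  have hPp : Real.sqrt p ≤ p := by
    have : 1 ≤ Real.sqrt p := Real.one_le_sqrt.2 hp1
    nlinarith
  have b1 : Real.sqrt n * ‖sampleMean X - η₀.1‖ ≤ M * Real.sqrt p :=
    le_of_sq_le_sq (by rw [mul_pow, mul_pow, hsq, hsp]; exact h1) (by positivity)
  have b2 : Real.sqrt n * frobNorm (scatter X η₀.1 - η₀.2⁻¹) ≤ M * p :=
    le_of_sq_le_sq (by rw [mul_pow, mul_pow, hsq]; exact h2) (by positivity)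
  have b3 : Real.sqrt n * ‖act (scatter X η₀.1 - η₀.2⁻¹) a‖ ≤ M * Real.sqrt p * ‖a‖ :=
    le_of_sq_le_sq (by rw [mul_pow, mul_pow, mul_pow, hsq, hsp]; exact h3) (by positivity)
  -- the recentring term, with `p ≤ n`
  have b4 : Real.sqrt n * ‖sampleMean X - η₀.1‖ ^ 2 ≤ M ^ 2 * Real.sqrt p := by
    refine le_of_mul_le_mul_left ?_ (lt_of_lt_of_le one_pos hN1)
    calc _ = n * ‖sampleMean X - η₀.1‖ ^ 2 := by rw [← mul_assoc, ← sq, hsq]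
      _ ≤ M ^ 2 * p := h1
      _ = M ^ 2 * (Real.sqrt p * Real.sqrt p) := by rw [← sq, hsp]
      _ ≤ M ^ 2 * (Real.sqrt n * Real.sqrt p) := by gcongr
      _ = _ := by ring
  have hcov : sampleCov X - η₀.2⁻¹
      = (scatter X η₀.1 - η₀.2⁻¹) - outer (η₀.1 - sampleMean X) := by
    rw [scatter_eq hn]; abel
  have ho : frobNorm (outer (η₀.1 - sampleMean X)) = ‖sampleMean X - η₀.1‖ ^ 2 := by
    rw [frobNorm_outer, norm_sub_rev]
  refine ⟨b1.trans ?_, ?_, ?_⟩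
  · gcongr
    nlinarith
  · rw [hcov, act_sub]
    calc _ ≤ Real.sqrt n * (‖act (scatter X η₀.1 - η₀.2⁻¹) a‖
            + ‖sampleMean X - η₀.1‖ ^ 2 * ‖a‖) := by
          gcongr
          refine (norm_sub_le _ _).trans (add_le_add le_rfl ((norm_act_le _ _).trans ?_))
          rw [← ho]
          gcongr
          exact specNorm_le_frobNorm _
      _ = Real.sqrt n * ‖act (scatter X η₀.1 - η₀.2⁻¹) a‖
            + Real.sqrt n * ‖sampleMean X - η₀.1‖ ^ 2 * ‖a‖ := by ring
      _ ≤ M ^ 2 * Real.sqrt p * ‖a‖ + M ^ 2 * Real.sqrt p * ‖a‖ := by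
          refine add_le_add (b3.trans ?_) ?_
          · gcongr
          · gcongr
      _ = _ := by ring
  · rw [hcov]
    calc _ ≤ Real.sqrt n * (frobNorm (scatter X η₀.1 - η₀.2⁻¹)
            + ‖sampleMean X - η₀.1‖ ^ 2) := by
          gcongr
          rw [← ho]
          exact frobNorm_sub_le _ _
      _ = Real.sqrt n * frobNorm (scatter X η₀.1 - η₀.2⁻¹)
            + Real.sqrt n * ‖sampleMean X - η₀.1‖ ^ 2 := by ring
      _ ≤ M ^ 2 * p + M ^ 2 * p := by
          refine add_le_add (b2.trans ?_) (b4.trans ?_)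
          · gcongr
          · gcongr
      _ = _ := by ring

lemma norm_single_le_one (i : Fin p) : ‖(EuclideanSpace.single i (1 : ℝ) : Vec p)‖ ≤ 1 := by simp

/-- Gaussian samples are good with probability at least `1 - O(M⁻²)`. -/
theorem measure_not_goodSample_le {Λ M : ℝ} (hM : 1 ≤ M) (z : Vec p) {η₀ : ClassParam p}
    (h₀ : η₀.2.PosDef) (hΛ : specNorm η₀.2⁻¹ ≤ Λ) (hn : n ≠ 0) (hp : 1 ≤ p) (hpn : p ≤ n) :
    (Measure.pi fun _ : Fin n => multivariateGaussian η₀.1 η₀.2⁻¹)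
      {X | ¬ GoodSample (2 * M ^ 2) z η₀ X}
      ≤ ENNReal.ofReal ((Λ + 96 * Real.exp (Λ / 2)) / M ^ 2) := by
  set m := η₀.1
  set S := η₀.2⁻¹
  set μ := multivariateGaussian m S with hμ
  have hS : S.PosSemidef := h₀.inv.posSemidef
  set K := 48 * Real.exp (Λ / 2) with hK
  have hp1 : (1 : ℝ) ≤ p := by exact_mod_cast hp
  have hp0 : (0 : ℝ) < p := by linarith
  have hM0 : 0 < M := by linarith
  have hq : ∀ i : Fin p, quadForm S (EuclideanSpace.single i (1 : ℝ)) ≤ Λ := fun i =>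
    quadForm_le_of_norm_le_one (norm_single_le_one i) hΛ
  set a := act η₀.2 (z - m) with ha
  -- the direction `a`, normalized (and zero if `a` is zero)
  set d : Vec p := ‖a‖⁻¹ • a with hd
  have hdn : ‖d‖ ≤ 1 := by
    rw [hd, norm_smul, norm_inv, norm_norm]
    exact inv_mul_le_one
  have hda : a = ‖a‖ • d := by
    rcases eq_or_ne a 0 with h | h
    · simp [h]
    · rw [hd, smul_smul, mul_inv_cancel₀ (norm_ne_zero_iff.2 h), one_smul]
  have hqd : quadForm S d ≤ Λ := quadForm_le_of_norm_le_one hdn hΛ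
  have hscat : ∀ (X : Fin n → Vec p) (c e : Vec p), inner ℝ c (act (scatter X m - S) e)
      = (n : ℝ)⁻¹ * ∑ k, inner ℝ c (X k - m) * inner ℝ e (X k - m) - inner ℝ c (act S e) := by
    intro X c e
    rw [act_sub, inner_sub_right, inner_act_scatter]
  -- the three deviation events
  set B1 := {X : Fin n → Vec p | M ^ 2 * p < n * ∑ i : Fin p, ((n : ℝ)⁻¹ *
    ∑ k, inner ℝ (EuclideanSpace.single i (1 : ℝ)) (X k)
      - ∫ x, inner ℝ (EuclideanSpace.single i (1 : ℝ)) x ∂μ) ^ 2} with hB1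
  set B2 := {X : Fin n → Vec p | M ^ 2 * p ^ 2 < n * ∑ x : Fin p × Fin p, ((n : ℝ)⁻¹ *
    ∑ k, inner ℝ (EuclideanSpace.single x.1 (1 : ℝ)) (X k - m)
        * inner ℝ (EuclideanSpace.single x.2 (1 : ℝ)) (X k - m)
      - ∫ y, inner ℝ (EuclideanSpace.single x.1 (1 : ℝ)) (y - m)
        * inner ℝ (EuclideanSpace.single x.2 (1 : ℝ)) (y - m) ∂μ) ^ 2} with hB2
  set B3 := {X : Fin n → Vec p | M ^ 2 * p < n * ∑ i : Fin p, ((n : ℝ)⁻¹ *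
    ∑ k, inner ℝ (EuclideanSpace.single i (1 : ℝ)) (X k - m) * inner ℝ d (X k - m)
      - ∫ y, inner ℝ (EuclideanSpace.single i (1 : ℝ)) (y - m) * inner ℝ d (y - m) ∂μ) ^ 2}
    with hB3
  have p1 : (Measure.pi fun _ : Fin n => μ) B1 ≤ ENNReal.ofReal (Λ / M ^ 2) := by
    refine (measure_pi_sum_sq_gt_le (J := Fin p) (K := Λ)
      (f := fun i x => inner ℝ (EuclideanSpace.single i (1 : ℝ)) x) (fun i => ?_) (fun i => ?_)
      hn (by positivity)).trans (le_of_eq ?_)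
    · exact IsGaussian.memLp_dual μ (innerSL ℝ (EuclideanSpace.single i (1 : ℝ))) 2 (by norm_num)
    · rw [hμ, variance_inner_multivariateGaussian hS]; exact hq i
    · rw [Fintype.card_fin, mul_comm (M ^ 2), mul_div_mul_left _ _ hp0.ne']
  have p2 : (Measure.pi fun _ : Fin n => μ) B2 ≤ ENNReal.ofReal (K / M ^ 2) := by
    refine (measure_pi_sum_sq_gt_le (J := Fin p × Fin p) (K := K)
      (f := fun x y => inner ℝ (EuclideanSpace.single x.1 (1 : ℝ)) (y - m)
        * inner ℝ (EuclideanSpace.single x.2 (1 : ℝ)) (y - m))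
      (fun x => (inner_mul_inner_multivariateGaussian hS _ _ (hq _) (hq _)).1)
      (fun x => (inner_mul_inner_multivariateGaussian hS _ _ (hq _) (hq _)).2.2)
      hn (by positivity)).trans (le_of_eq ?_)
    rw [Fintype.card_prod, Fintype.card_fin, Nat.cast_mul, ← sq, mul_comm (M ^ 2),
      mul_div_mul_left _ _ (by positivity)]
  have p3 : (Measure.pi fun _ : Fin n => μ) B3 ≤ ENNReal.ofReal (K / M ^ 2) := by
    refine (measure_pi_sum_sq_gt_le (J := Fin p) (K := K)
      (f := fun i y => inner ℝ (EuclideanSpace.single i (1 : ℝ)) (y - m) * inner ℝ d (y - m))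
      (fun x => (inner_mul_inner_multivariateGaussian hS _ _ (hq _) hqd).1)
      (fun x => (inner_mul_inner_multivariateGaussian hS _ _ (hq _) hqd).2.2)
      hn (by positivity)).trans (le_of_eq ?_)
    rw [Fintype.card_fin, mul_comm (M ^ 2), mul_div_mul_left _ _ hp0.ne']
  have hsub : {X | ¬ GoodSample (2 * M ^ 2) z η₀ X} ⊆ B1 ∪ B2 ∪ B3 := by
    intro X hX
    by_contra hcon
    simp only [Set.mem_union, not_or] at hcon
    obtain ⟨⟨c1, c2⟩, c3⟩ := hcon
    simp only [hB1, hB2, hB3, Set.mem_ofPred_eq, not_lt] at c1 c2 c3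
    refine hX (goodSample_of_scatter hM hn hp hpn ?_ ?_ ?_)
    · change n * ‖sampleMean X - m‖ ^ 2 ≤ M ^ 2 * p
      rw [norm_sq_eq_sum_inner]
      simp only [inner_sampleMean_sub]
      simpa only [hμ, integral_inner_multivariateGaussian] using c1
    · change n * frobNorm (scatter X m - S) ^ 2 ≤ M ^ 2 * p ^ 2
      rw [frobNorm_sq_eq_sum_inner]
      simp only [hscat]
      refine le_trans (le_of_eq ?_) c2
      congr 1
      refine Finset.sum_congr rfl fun x _ => ?_
      rw [(inner_mul_inner_multivariateGaussian (m := m) hS _ _ (hq x.1) (hq x.2)).2.1]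
    · have c3' : n * ‖act (scatter X m - S) d‖ ^ 2 ≤ M ^ 2 * p := by
        rw [norm_sq_eq_sum_inner]
        simp only [hscat]
        refine le_trans (le_of_eq ?_) c3
        congr 1
        refine Finset.sum_congr rfl fun x _ => ?_
        rw [(inner_mul_inner_multivariateGaussian (m := m) hS _ _ (hq x) hqd).2.1]
      have e : act (scatter X m - S) a = ‖a‖ • act (scatter X m - S) d := by
        conv_lhs => rw [hda]
        rw [act_vec_smul]
      change n * ‖act (scatter X m - S) a‖ ^ 2 ≤ M ^ 2 * p * ‖a‖ ^ 2
      rw [e, norm_smul, norm_norm, mul_pow]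
      calc _ = (n * ‖act (scatter X m - S) d‖ ^ 2) * ‖a‖ ^ 2 := by ring
        _ ≤ _ := by gcongr
  have hK0 : 0 ≤ K := by positivity
  have hΛ0 : 0 ≤ Λ := (specNorm_nonneg _).trans hΛ
  calc _ ≤ (Measure.pi fun _ : Fin n => μ) (B1 ∪ B2 ∪ B3) := measure_mono hsub
    _ ≤ (Measure.pi fun _ : Fin n => μ) B1 + (Measure.pi fun _ : Fin n => μ) B2
        + (Measure.pi fun _ : Fin n => μ) B3 :=
      (measure_union_le _ _).trans (add_le_add (measure_union_le _ _) le_rfl)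
    _ ≤ ENNReal.ofReal (Λ / M ^ 2) + ENNReal.ofReal (K / M ^ 2) + ENNReal.ofReal (K / M ^ 2) := by
      gcongr
    _ = _ := by
      rw [← ENNReal.ofReal_add (by positivity) (by positivity),
        ← ENNReal.ofReal_add (by positivity) (by positivity), hK]
      congr 1; ring

end GoodSample

end

/-! ### The two classes together and the posterior -/

section TwoClasses

variable {n p : ℕ} {L ρ t : ℝ} {z : Vec p} {θs θ : Param p} {D : Data n p}

lemma PhiY_eq (z : Vec p) (θ : Param p) : PhiY z θ = -classPhi z θ.2 := by
  rw [PhiY, classPhi, neg_neg]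

lemma xiY_eq (z : Vec p) (θ : Param p) : xiY z θ = -((2 : ℝ) • (z - θ.2.1)) := by
  rw [xiY, ← smul_neg, neg_sub]

lemma stdDev_eq (z : Vec p) (θ : Param p) :
    stdDev z θ = Real.sqrt (classVar z θ.1 + classVar z θ.2) := by
  have hq : quadForm θ.2.2 (xiY z θ) = quadForm θ.2.2 ((2 : ℝ) • (z - θ.2.1)) := by
    rw [xiY_eq]
    simp only [quadForm, WithLp.ofLp_neg, mulVec_neg, neg_dotProduct_neg]
  rw [stdDev, PhiY_eq, mul_neg, neg_mul, frobNorm_neg, hq]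
  congr 1
  simp only [classVar]
  have : PhiX z θ = classPhi z θ.1 := rfl
  rw [this, xiX]
  ring

lemma disc_eq (z : Vec p) (θ : Param p) (h1 : θ.1.2.PosDef) (h2 : θ.2.2.PosDef) :
    disc z θ = classDisc z θ.1 - classDisc z θ.2 := by
  rw [disc, Real.log_div h1.det_pos.ne' h2.det_pos.ne', classDisc, classDisc]; ring

/-- The studentized discriminant whose posterior law is studied. -/
noncomputable def studentized (n : ℕ) {p : ℕ} (z : Vec p) (θs : Param p) (D : Data n p)
    (θ : Param p) : ℝ :=
  Real.sqrt n * (stdDev z θs)⁻¹ * (disc z θ - discHat z D)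

/-- Local asymptotic normality for both samples: class `Y` is class `X` with the sign of the
perturbation reversed, and the choice of `V` normalizes the total curvature to one. -/
theorem abs_logLik_perturb_sub_le (hS1 : ClassScale L (stdDev z θs) z θs.1)
    (hS2 : ClassScale L (stdDev z θs) z θs.2) (hX : GoodSample L z θs.1 D.1)
    (hY : GoodSample L z θs.2 D.2) (hc1 : ClassClose n ρ θs.1 θ.1)
    (hc2 : ClassClose n ρ θs.2 θ.2) (h : Scales n p L ρ) (ht : |t| ≤ L) :
    |logLik D (perturb n z θs t θ) - logLik D θ - (t * studentized n z θs D θ - t ^ 2 / 2)|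
      ≤ 226 * L ^ 9 * ρ := by
  set V := stdDev z θs with hV
  have hVpos : 0 < V := by linarith [hS1.one_le_V]
  have hN : 0 < Real.sqrt n := h.sqrt_n_pos
  have hn : (n : ℝ) = Real.sqrt n ^ 2 := (Real.sq_sqrt (Nat.cast_nonneg n)).symm
  have hV2 : classVar z θs.1 + classVar z θs.2 = V ^ 2 := by
    rw [hV, stdDev_eq, Real.sq_sqrt]
    rw [classVar_eq hS1.posDef, classVar_eq hS2.posDef]; positivity
  set s := t / (Real.sqrt n * V) with hs
  have hsV : |s| * Real.sqrt n * V ≤ L := by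
    rw [hs, abs_div, abs_of_pos (mul_pos hN hVpos), mul_assoc,
      div_mul_cancel₀ _ (mul_pos hN hVpos).ne']
    exact ht
  have e1 := abs_classLogLik_perturb_error_le hS1 hc1 hX h hsV
  have e2 := abs_classLogLik_perturb_error_le hS2 hc2 hY h (s := -s) (by rwa [abs_neg])
  have hp1 : (perturb n z θs t θ).1
      = (θ.1.1 - s • (2 : ℝ) • (z - θs.1.1), θ.1.2 + (2 * s) • classPhi z θs.1) := by
    rw [perturb, ← hV, mul_div_assoc]; rfl
  have hp2 : (perturb n z θs t θ).2
      = (θ.2.1 - (-s) • (2 : ℝ) • (z - θs.2.1), θ.2.2 + (2 * -s) • classPhi z θs.2) := by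
    rw [perturb, ← hV, mul_div_assoc, ← hs, PhiY_eq, xiY_eq]
    simp only [smul_neg, neg_smul, mul_neg]
  have hdisc := disc_eq z θ hc1.posDef hc2.posDef
  have hhat : discHat z D = classDisc z (sampleMean D.1, (sampleCov D.1)⁻¹)
      - classDisc z (sampleMean D.2, (sampleCov D.2)⁻¹) :=
    disc_eq z _ (hX.posDef_sampleCov hS1 h).2.inv (hY.posDef_sampleCov hS2 h).2.inv
  have hns : (n : ℝ) * s = t * (Real.sqrt n * V⁻¹) := by
    rw [hs]
    conv_lhs => rw [hn]
    rw [Real.sqrt_sq hN.le]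
    field_simp
  have hns2 : (n : ℝ) * s ^ 2 * V ^ 2 = t ^ 2 := by
    rw [hs]
    conv_lhs => rw [hn]
    rw [Real.sqrt_sq hN.le]
    field_simp
  have hst : t * studentized n z θs D θ = n * s * (disc z θ - discHat z D) := by
    rw [studentized, hns, ← hV]; ring
  rw [hst, hdisc, hhat, ← hns2, ← hV2, logLik, logLik, hp1, hp2]
  rw [neg_sq] at e2
  rw [abs_le] at *
  constructor <;> linarith [e1.1, e1.2, e2.1, e2.2]

lemma classClose_of_mem_nbhd {δ : ℝ} (h : Scales n p L ρ) (hδ : δ ≤ ρ) (hθ : θ.Valid)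
    (hmem : θ ∈ nbhd n θs δ) : ClassClose n ρ θs.1 θ.1 ∧ ClassClose n ρ θs.2 θ.2 := by
  obtain ⟨g1, g2, g3, g4⟩ := hmem
  have hP : 0 < Real.sqrt p := lt_of_lt_of_le one_pos h.one_le_sqrt_p
  have hN := h.sqrt_n_pos
  rw [Real.sqrt_div (Nat.cast_nonneg n), div_mul_eq_mul_div, div_le_iff₀ hP] at g3
  set a1 := ‖θ.1.1 - θs.1.1‖
  set a2 := ‖θ.2.1 - θs.2.1‖
  set s1 := specNorm ((θ.1.2)⁻¹ - (θs.1.2)⁻¹)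
  set s2 := specNorm ((θ.2.2)⁻¹ - (θs.2.2)⁻¹)
  set f1 := frobNorm ((θ.1.2)⁻¹ - (θs.1.2)⁻¹)
  set f2 := frobNorm ((θ.2.2)⁻¹ - (θs.2.2)⁻¹)
  have ha1 : 0 ≤ a1 := norm_nonneg _
  have ha2 : 0 ≤ a2 := norm_nonneg _
  have hs1 : 0 ≤ s1 := specNorm_nonneg _
  have hs2 : 0 ≤ s2 := specNorm_nonneg _
  have hf1 : 0 ≤ f1 := frobNorm_nonneg _
  have hf2 : 0 ≤ f2 := frobNorm_nonneg _
  have key : ∀ {c x y b : ℝ}, 0 ≤ c → x ≤ y → c * y ≤ b → c * x ≤ b := fun hc hxy hb =>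
    (mul_le_mul_of_nonneg_left hxy hc).trans hb
  have q1 := sq_nonneg a1
  have q2 := sq_nonneg a2
  have q3 := sq_nonneg s1
  have q4 := sq_nonneg s2
  have q5 := sq_nonneg f1
  have q6 := sq_nonneg f2
  have hδP : δ * Real.sqrt p ≤ Real.sqrt p * ρ := by nlinarith
  exact ⟨⟨hθ.1, (key hN.le (by linarith) g1).trans hδ, (key hP.le (by linarith) g2).trans hδ,
      (key hP.le (by linarith) g4).trans hδ, (key hN.le (by linarith) g3).trans hδP⟩,
    ⟨hθ.2, (key hN.le (by linarith) g1).trans hδ, (key hP.le (by linarith) g2).trans hδ,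
      (key hP.le (by linarith) g4).trans hδ, (key hN.le (by linarith) g3).trans hδP⟩⟩

lemma ClassScale.mono {V L' : ℝ} {η₀ : ClassParam p} (hS : ClassScale L V z η₀) (hL : L ≤ L') :
    ClassScale L' V z η₀ := by
  have hV := hS.one_le_V
  have : L * V ≤ L' * V := by gcongr
  exact ⟨hS.one_le.trans hL, hS.posDef, hS.prec.trans hL, hS.cov.trans hL, hV, hS.sqrt_dim,
    hS.norm.trans this, hS.norm_sq.trans this, hS.phi.trans this⟩

lemma GoodSample.mono {L' : ℝ} {η₀ : ClassParam p} {X : Fin n → Vec p}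
    (hX : GoodSample L z η₀ X) (hL : L ≤ L') : GoodSample L' z η₀ X := by
  refine ⟨hX.mean.trans ?_, hX.cov_act.trans ?_, hX.cov.trans ?_⟩ <;> gcongr

end TwoClasses

section Measurability

variable {n p : ℕ}

lemma measurable_matrix_entry (i j : Fin p) : Measurable fun M : Mat p => M i j :=
  (measurable_pi_apply j).comp (measurable_pi_apply (X := fun _ : Fin p => Fin p → ℝ) i)

variable {α : Type*} [MeasurableSpace α]

lemma measurable_entry {f : α → Mat p} (hf : Measurable f) (i j : Fin p) :
    Measurable fun a => f a i j := (measurable_matrix_entry i j).comp hf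

lemma measurable_det {f : α → Mat p} (hf : Measurable f) : Measurable fun a => (f a).det := by
  simp only [det_apply']
  exact Finset.measurable_fun_sum _ fun σ _ => measurable_const.mul
    (Finset.measurable_fun_prod _ fun i _ => measurable_entry hf _ _)

lemma measurable_quadForm {f : α → Mat p} (hf : Measurable f) {v : α → Vec p}
    (hv : Measurable v) : Measurable fun a => quadForm (f a) (v a) := by
  have hvi : ∀ i, Measurable fun a => v a i := fun i => by fun_prop
  simp only [quadForm, dotProduct, mulVec]
  exact Finset.measurable_fun_sum _ fun i _ => (hvi i).mul
    (Finset.measurable_fun_sum _ fun j _ => (measurable_entry hf i j).mul (hvi j))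

lemma measurable_disc (z : Vec p) : Measurable (disc z) := by
  have h1 : Measurable fun θ : Param p => θ.1.2 := by fun_prop
  have h2 : Measurable fun θ : Param p => θ.2.2 := by fun_prop
  exact ((measurable_quadForm h1 (by fun_prop)).neg.add (measurable_quadForm h2 (by fun_prop))).add
    (((measurable_det h1).div (measurable_det h2)).log)

lemma measurable_studentized (z : Vec p) (θs : Param p) (D : Data n p) :
    Measurable (studentized n z θs D) :=
  ((measurable_disc z).sub_const _).const_mul _

lemma measurable_classLogLik (X : Fin n → Vec p) : Measurable (classLogLik X) := by
  have h2 : Measurable fun η : ClassParam p => η.2 := measurable_snd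
  have e : classLogLik X = fun η : ClassParam p => (n : ℝ) / 2 * Real.log η.2.det
      - (n : ℝ) / 2 * ((n : ℝ)⁻¹ * ∑ k, quadForm η.2 (X k - η.1)) := by
    funext η
    rw [classLogLik, scatter, mul_smul_comm, trace_smul, Finset.mul_sum, trace_sum]
    simp only [trace_mul_outer, smul_eq_mul]
  rw [e]
  exact ((measurable_det h2).log.const_mul _).sub (((Finset.measurable_fun_sum _ fun k _ =>
    measurable_quadForm h2 (by fun_prop)).const_mul _).const_mul _)

lemma measurable_logLik (D : Data n p) : Measurable (logLik D) :=
  ((measurable_classLogLik D.1).comp measurable_fst).add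
    ((measurable_classLogLik D.2).comp measurable_snd)

end Measurability

section Posterior

variable {n p : ℕ} {prior : Measure (Param p)} {D : Data n p} {A : Set (Param p)}

/-- The unnormalized posterior. -/
noncomputable def likMeasure (prior : Measure (Param p)) (D : Data n p) : Measure (Param p) :=
  prior.withDensity fun θ => ENNReal.ofReal (Real.exp (logLik D θ))

lemma likMeasure_apply {B : Set (Param p)} (hB : MeasurableSet B) :
    likMeasure prior D B = likIntegral prior D id B := withDensity_apply _ hB

lemma posterior_eq {B : Set (Param p)} (hB : MeasurableSet B) :
    posterior prior D B = (likMeasure prior D).real B / (likMeasure prior D).real Set.univ := by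
  rw [posterior, ENNReal.toReal_div, ← likMeasure_apply hB, ← likMeasure_apply MeasurableSet.univ]
  rfl

lemma likMeasure_ne_top_of_posterior_pos (h : 0 < posterior prior D A) :
    likMeasure prior D Set.univ ≠ ∞ ∧ likIntegral prior D id A ≠ 0 := by
  rw [likMeasure_apply MeasurableSet.univ]
  rw [posterior, ENNReal.toReal_pos_iff] at h
  constructor
  · intro htop
    rw [htop, ENNReal.div_top] at h
    exact lt_irrefl _ h.1
  · intro h0
    rw [h0, ENNReal.zero_div] at h
    exact lt_irrefl _ h.1

/-- Conditioning the posterior on an event of posterior probability `π` changes probabilities by at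
most `1 - π`. -/
lemma abs_posterior_sub_le {B : Set (Param p)} (hA : MeasurableSet A) (hB : MeasurableSet B)
    (h : 0 < posterior prior D A) :
    |posterior prior D B - (likMeasure prior D).real (B ∩ A) / (likMeasure prior D).real A|
      ≤ 1 - posterior prior D A := by
  obtain ⟨htop, h0⟩ := likMeasure_ne_top_of_posterior_pos h
  set κ := likMeasure prior D with hκ
  have : IsFiniteMeasure κ := ⟨htop.lt_top⟩
  rw [posterior_eq hB, posterior_eq hA, ← hκ]
  have hapos : 0 < κ.real A := by
    rw [measureReal_def, ENNReal.toReal_pos_iff]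
    exact ⟨pos_iff_ne_zero.2 (by rw [hκ, likMeasure_apply hA]; exact h0), measure_lt_top _ _⟩
  set a := κ.real A
  set W := κ.real Set.univ
  set b := κ.real (B ∩ A)
  have haW : a ≤ W := measureReal_mono (Set.subset_univ _)
  have hba : b ≤ a := measureReal_mono Set.inter_subset_right
  have hb0 : 0 ≤ b := measureReal_nonneg
  have hW : 0 < W := hapos.trans_le haW
  have hsplit : κ.real B = b + κ.real (B \ A) := (measureReal_inter_add_sdiff hA).symm
  have hc : κ.real (B \ A) ≤ W - a := by
    rw [← measureReal_compl hA]
    exact measureReal_mono fun x hx => hx.2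
  have hc0 : 0 ≤ κ.real (B \ A) := measureReal_nonneg
  rw [hsplit]
  set c := κ.real (B \ A)
  have h1 : b / W ≤ b / a := by gcongr
  have h2 : c / W ≤ 1 - a / W := by
    rw [div_le_iff₀ hW, sub_mul, div_mul_cancel₀ _ hW.ne']; linarith
  have h3 : b / a - b / W ≤ 1 - a / W := by
    have e : b / a - b / W = b / a * (1 - a / W) := by field_simp
    have h4 : b / a ≤ 1 := (div_le_one hapos).2 hba
    have h5 : 0 ≤ 1 - a / W := by rw [sub_nonneg, div_le_one hW]; exact haW
    rw [e]
    nlinarith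
  rw [add_div, abs_le]
  constructor
  · have : 0 ≤ c / W := by positivity
    linarith
  · linarith

/-- If the log-likelihood ratio of a perturbation is `t h - t² / 2` up to `η / 2` on `A`, then the
Laplace transform at `t` of `h` under the posterior conditioned on `A` is comparable to
`exp (t² / 2)` times the ratio of the integrated likelihoods. -/
lemma setLIntegral_exp_bounds {h : Param p → ℝ} {pert : Param p → Param p} {t η : ℝ}
    (hA : MeasurableSet A)
    (hLAN : ∀ᵐ θ ∂prior, θ ∈ A →
      |logLik D (pert θ) - logLik D θ - (t * h θ - t ^ 2 / 2)| ≤ η) (hh : Measurable h) :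
    ENNReal.ofReal (Real.exp (t ^ 2 / 2 - η)) * likIntegral prior D pert A
        ≤ ∫⁻ θ in A, ENNReal.ofReal (Real.exp (t * h θ)) ∂(likMeasure prior D) ∧
      ∫⁻ θ in A, ENNReal.ofReal (Real.exp (t * h θ)) ∂(likMeasure prior D)
        ≤ ENNReal.ofReal (Real.exp (t ^ 2 / 2 + η)) * likIntegral prior D pert A := by
  have hl : Measurable fun θ => ENNReal.ofReal (Real.exp (logLik D θ)) :=
    (measurable_logLik D).exp.ennreal_ofReal
  have hmid : ∫⁻ θ in A, ENNReal.ofReal (Real.exp (t * h θ)) ∂(likMeasure prior D)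
      = ∫⁻ θ in A, ENNReal.ofReal (Real.exp (logLik D θ + t * h θ)) ∂prior := by
    rw [likMeasure, setLIntegral_withDensity_eq_setLIntegral_mul _ hl
      ((hh.const_mul t).exp.ennreal_ofReal) hA]
    refine lintegral_congr fun θ => ?_
    rw [Pi.mul_apply, ← ENNReal.ofReal_mul (Real.exp_pos _).le, ← Real.exp_add]
  have hae : ∀ᵐ θ ∂(prior.restrict A),
      |logLik D (pert θ) - logLik D θ - (t * h θ - t ^ 2 / 2)| ≤ η :=
    (ae_restrict_iff' hA).2 hLAN
  rw [hmid, likIntegral, ← lintegral_const_mul' _ _ ENNReal.ofReal_ne_top,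
    ← lintegral_const_mul' _ _ ENNReal.ofReal_ne_top]
  constructor
  · refine lintegral_mono_ae ?_
    filter_upwards [hae] with θ hθ
    rw [← ENNReal.ofReal_mul (Real.exp_pos _).le, ← Real.exp_add]
    refine ENNReal.ofReal_le_ofReal (Real.exp_le_exp.2 ?_)
    linarith [(abs_le.1 hθ).2]
  · refine lintegral_mono_ae ?_
    filter_upwards [hae] with θ hθ
    rw [← ENNReal.ofReal_mul (Real.exp_pos _).le, ← Real.exp_add]
    refine ENNReal.ofReal_le_ofReal (Real.exp_le_exp.2 ?_)
    linarith [(abs_le.1 hθ).1]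

lemma ofReal_exp_le_of_abs_toReal_sub_lt {R : ℝ≥0∞} {x : ℝ} (hx : 0 < x)
    (hR : |R.toReal - 1| < 1 - Real.exp (-x)) :
    ENNReal.ofReal (Real.exp (-x)) ≤ R ∧ R ≤ ENNReal.ofReal (Real.exp x) := by
  have hlt : Real.exp (-x) < 1 := by simpa using hx
  have htop : R ≠ ∞ := fun h => by
    rw [h, ENNReal.toReal_top, zero_sub, abs_neg, abs_one] at hR
    linarith [Real.exp_pos (-x)]
  rw [abs_lt] at hR
  have hsum : 2 ≤ Real.exp x + Real.exp (-x) := by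
    have h1 := Real.add_one_le_exp x
    have h2 := Real.add_one_le_exp (-x)
    linarith
  constructor
  · rw [ENNReal.ofReal_le_iff_le_toReal htop]; linarith [hR.1]
  · rw [ENNReal.le_ofReal_iff_toReal_le htop (Real.exp_pos _).le]; linarith [hR.2]

/-- The deterministic core: for data where the posterior charges `A`, local asymptotic normality
holds on `A` and the likelihood ratios are close to one, the posterior law of `h` is close to the
standard normal law. -/
theorem posterior_kolmogorov_le {h : Param p → ℝ} {pert : ℝ → Param p → Param p}
    {ε η : ℝ} {T : Finset ℝ} (hε : ε ≤ 1) (hη : 0 < η)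
    (hT : ∀ μ : ProbabilityMeasure ℝ,
      (∀ t ∈ T, ENNReal.ofReal (Real.exp (t ^ 2 / 2 - η)) ≤ laplace t μ ∧
        laplace t μ ≤ ENNReal.ofReal (Real.exp (t ^ 2 / 2 + η))) →
      ∀ x, |(μ : Measure ℝ).real (Set.Iic x) - (gaussianReal 0 1).real (Set.Iic x)| ≤ ε)
    (hA : MeasurableSet A) (hh : Measurable h)
    (hLAN : ∀ t ∈ T, ∀ᵐ θ ∂prior, θ ∈ A →
      |logLik D (pert t θ) - logLik D θ - (t * h θ - t ^ 2 / 2)| ≤ η / 2)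
    (hpost : |posterior prior D A - 1| < ε)
    (hR : ∀ t ∈ T, |(likIntegral prior D (pert t) A / likIntegral prior D id A).toReal - 1|
      < 1 - Real.exp (-(η / 2))) (x : ℝ) :
    |posterior prior D {θ | h θ ≤ x} - (gaussianReal 0 1).real (Set.Iic x)| ≤ 2 * ε := by
  have hpos : 0 < posterior prior D A := by linarith [(abs_lt.1 hpost).1]
  obtain ⟨htop, h0⟩ := likMeasure_ne_top_of_posterior_pos hpos
  set κ := likMeasure prior D with hκ
  have : IsFiniteMeasure κ := ⟨htop.lt_top⟩
  have hκA : κ A = likIntegral prior D id A := likMeasure_apply hA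
  have hκ0 : κ A ≠ 0 := by rw [hκA]; exact h0
  have hκtop : κ A ≠ ∞ := measure_ne_top _ _
  have hprob : IsProbabilityMeasure ((κ A)⁻¹ • κ.restrict A) := ⟨by
    rw [Measure.smul_apply, Measure.restrict_apply_univ, smul_eq_mul,
      ENNReal.inv_mul_cancel hκ0 hκtop]⟩
  have hprob' : IsProbabilityMeasure (((κ A)⁻¹ • κ.restrict A).map h) :=
    Measure.isProbabilityMeasure_map hh.aemeasurable
  set ν : ProbabilityMeasure ℝ := ⟨((κ A)⁻¹ • κ.restrict A).map h, hprob'⟩ with hν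
  have hlap : ∀ t ∈ T, ENNReal.ofReal (Real.exp (t ^ 2 / 2 - η)) ≤ laplace t ν ∧
        laplace t ν ≤ ENNReal.ofReal (Real.exp (t ^ 2 / 2 + η)) := by
    intro t ht
    have hval : laplace t ν
        = (κ A)⁻¹ * ∫⁻ θ in A, ENNReal.ofReal (Real.exp (t * h θ)) ∂κ := by
      have : laplace t ν = ∫⁻ x, ENNReal.ofReal (Real.exp (t * x))
          ∂(((κ A)⁻¹ • κ.restrict A).map h) := rfl
      rw [this, lintegral_map (by fun_prop) hh, lintegral_smul_measure, smul_eq_mul]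
    obtain ⟨b1, b2⟩ := setLIntegral_exp_bounds hA (hLAN t ht) hh
    obtain ⟨r1, r2⟩ := ofReal_exp_le_of_abs_toReal_sub_lt (by positivity) (hR t ht)
    rw [ENNReal.div_eq_inv_mul, ← hκA] at r1 r2
    rw [hval]
    constructor
    · calc _ = ENNReal.ofReal (Real.exp (t ^ 2 / 2 - η / 2))
            * ENNReal.ofReal (Real.exp (-(η / 2))) := by
            rw [← ENNReal.ofReal_mul (Real.exp_pos _).le, ← Real.exp_add]; ring_nf
        _ ≤ ENNReal.ofReal (Real.exp (t ^ 2 / 2 - η / 2))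
            * ((κ A)⁻¹ * likIntegral prior D (pert t) A) := by gcongr
        _ = (κ A)⁻¹ * (ENNReal.ofReal (Real.exp (t ^ 2 / 2 - η / 2))
            * likIntegral prior D (pert t) A) := by ring
        _ ≤ _ := by gcongr
    · calc _ ≤ (κ A)⁻¹ * (ENNReal.ofReal (Real.exp (t ^ 2 / 2 + η / 2))
            * likIntegral prior D (pert t) A) := by gcongr
        _ = ENNReal.ofReal (Real.exp (t ^ 2 / 2 + η / 2))
            * ((κ A)⁻¹ * likIntegral prior D (pert t) A) := by ring
        _ ≤ ENNReal.ofReal (Real.exp (t ^ 2 / 2 + η / 2))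
            * ENNReal.ofReal (Real.exp (η / 2)) := by gcongr
        _ = _ := by
            rw [← ENNReal.ofReal_mul (Real.exp_pos _).le, ← Real.exp_add]; ring_nf
  have hk := hT ν hlap x
  have hB : MeasurableSet {θ | h θ ≤ x} := hh measurableSet_Iic
  have hνx : (ν : Measure ℝ).real (Set.Iic x) = κ.real ({θ | h θ ≤ x} ∩ A) / κ.real A := by
    have : (ν : Measure ℝ) (Set.Iic x) = (κ A)⁻¹ * κ ({θ | h θ ≤ x} ∩ A) := by
      change ((κ A)⁻¹ • κ.restrict A).map h (Set.Iic x) = _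
      rw [Measure.map_apply hh measurableSet_Iic, Measure.smul_apply, smul_eq_mul,
        Measure.restrict_apply (hh measurableSet_Iic)]
      rfl
    rw [measureReal_def, this, ENNReal.toReal_mul, ENNReal.toReal_inv, mul_comm, ← div_eq_mul_inv]
    rfl
  have hcond := abs_posterior_sub_le hA hB hpos
  rw [← hκ, ← hνx] at hcond
  rw [abs_le] at *
  rw [abs_lt] at hpost
  constructor <;> linarith [hcond.1, hcond.2, hk.1, hk.2, hpost.1]

end Posterior

/-! ### Normality of the posterior law of the discriminant -/

/-- Bad samples have small probability under the joint law of the two samples. -/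
lemma dataLaw_not_goodSample_le {n p : ℕ} {Λ M : ℝ} (hM : 1 ≤ M) (z : Vec p) {θs : Param p}
    (hθs : θs.Valid) (h1 : specNorm (θs.1.2)⁻¹ ≤ Λ) (h2 : specNorm (θs.2.2)⁻¹ ≤ Λ) (hn : n ≠ 0)
    (hp : 1 ≤ p) (hpn : p ≤ n) :
    dataLaw n θs {D | ¬ (GoodSample (2 * M ^ 2) z θs.1 D.1 ∧ GoodSample (2 * M ^ 2) z θs.2 D.2)}
      ≤ ENNReal.ofReal ((Λ + 96 * Real.exp (Λ / 2)) / M ^ 2)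
        + ENNReal.ofReal ((Λ + 96 * Real.exp (Λ / 2)) / M ^ 2) := by
  have hsub : {D : Data n p |
      ¬ (GoodSample (2 * M ^ 2) z θs.1 D.1 ∧ GoodSample (2 * M ^ 2) z θs.2 D.2)}
      ⊆ {X | ¬ GoodSample (2 * M ^ 2) z θs.1 X} ×ˢ Set.univ
        ∪ Set.univ ×ˢ {Y | ¬ GoodSample (2 * M ^ 2) z θs.2 Y} := by
    intro D hD
    by_cases h : GoodSample (2 * M ^ 2) z θs.1 D.1
    · exact Or.inr ⟨trivial, fun h' => hD ⟨h, h'⟩⟩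
    · exact Or.inl ⟨h, trivial⟩
  refine (measure_mono hsub).trans ((measure_union_le _ _).trans ?_)
  rw [dataLaw, Measure.prod_prod, Measure.prod_prod, measure_univ, measure_univ, mul_one, one_mul]
  exact add_le_add (measure_not_goodSample_le hM z hθs.1 h1 hn hp hpn)
    (measure_not_goodSample_le hM z hθs.2 h2 hn hp hpn)

lemma stdDev_eq_zero_of_dim_zero {p : ℕ} (hp : p = 0) (z : Vec p) (θ : Param p) :
    stdDev z θ = 0 := by
  subst hp
  simp [stdDev, frobNorm, quadForm]

/-- Each class contributes a nonnegative part of `V²`, so `V` dominates the scales of both. -/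
lemma classScale_of_stdDev {p : ℕ} {Λ : ℝ} {z : Vec p} {θs : Param p} (hΛ : 1 ≤ Λ)
    (hθs : θs.Valid) (h1 : specNorm (θs.1.2)⁻¹ ≤ Λ) (h2 : specNorm θs.1.2 ≤ Λ)
    (h3 : specNorm (θs.2.2)⁻¹ ≤ Λ) (h4 : specNorm θs.2.2 ≤ Λ) (hp : 1 ≤ p) :
    ClassScale (2 * Λ) (stdDev z θs) z θs.1 ∧ ClassScale (2 * Λ) (stdDev z θs) z θs.2 := by
  have c1 : 0 ≤ classVar z θs.1 := by rw [classVar_eq hθs.1]; positivity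
  have c2 : 0 ≤ classVar z θs.2 := by rw [classVar_eq hθs.2]; positivity
  have hV : stdDev z θs ^ 2 = classVar z θs.1 + classVar z θs.2 := by
    rw [stdDev_eq, Real.sq_sqrt (by positivity)]
  have h0 : 0 ≤ stdDev z θs := by rw [stdDev_eq]; positivity
  exact ⟨classScale_of_classVar_le hΛ hθs.1 h2 h1 h0 (by linarith) hp,
    classScale_of_classVar_le hΛ hθs.2 h4 h3 h0 (by linarith) hp⟩

lemma scales_of_dim {n p : ℕ} {L δ : ℝ} (hn : 1 ≤ n) (hp : 1 ≤ p)
    (h : 8 * L ^ 3 * (|δ| + Real.sqrt ((p : ℝ) ^ 3 / n)) ≤ 1) :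
    Scales n p L (|δ| + Real.sqrt ((p : ℝ) ^ 3 / n)) := by
  have hn0 : (0 : ℝ) < n := by exact_mod_cast hn
  refine ⟨hn, hp, ?_, h⟩
  have e : (p : ℝ) * Real.sqrt p = Real.sqrt ((p : ℝ) ^ 3 / n) * Real.sqrt n := by
    rw [← Real.sqrt_mul (by positivity), div_mul_cancel₀ _ hn0.ne', pow_succ,
      Real.sqrt_mul (by positivity), Real.sqrt_sq (by positivity)]
  rw [e]
  gcongr
  exact le_add_of_nonneg_left (abs_nonneg _)

end QDA

theorem mainTheorem6
    -- dimensions, true parameters, the point to be classified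
    (p : ℕ → ℕ) (θs : ∀ n, QDA.Param (p n)) (hθs : ∀ n, (θs n).Valid)
    (z : ∀ n, QDA.Vec (p n))
    -- priors, supported on positive definite precision matrices
    (prior : ∀ n, Measure (QDA.Param (p n))) [∀ n, IsProbabilityMeasure (prior n)]
    (hprior : ∀ n, ∀ᵐ θ ∂(prior n), θ.Valid)
    -- the spectral norms of all covariance and precision matrices are O(1)
    (hbound : ∃ Λ : ℝ, ∀ᶠ n in atTop,
      QDA.specNorm ((θs n).1.2)⁻¹ ≤ Λ ∧ QDA.specNorm (θs n).1.2 ≤ Λ ∧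
      QDA.specNorm ((θs n).2.2)⁻¹ ≤ Λ ∧ QDA.specNorm (θs n).2.2 ≤ Λ)
    -- 1 / V = O(1)
    (hV : ∃ c : ℝ, 0 < c ∧ ∀ᶠ n in atTop, c ≤ QDA.stdDev (z n) (θs n))
    -- p ^ 3 / n = o(1)
    (hp : Tendsto (fun n : ℕ => (p n : ℝ) ^ 3 / (n : ℝ)) atTop (𝓝 0))
    -- the localizing sets
    (A : ∀ n, Set (QDA.Param (p n))) (hAmeas : ∀ n, MeasurableSet (A n))
    (δ : ℕ → ℝ) (hδ : Tendsto δ atTop (𝓝 0)) (hA : ∀ n, A n ⊆ QDA.nbhd n (θs n) (δ n))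
    -- condition 1
    (h1 : QDA.IsLittleOP (fun n => QDA.dataLaw n (θs n))
      (fun n D => QDA.posterior (prior n) D (A n) - 1))
    -- condition 2
    (h2 : ∀ t : ℝ, QDA.IsLittleOP (fun n => QDA.dataLaw n (θs n))
      (fun n D =>
        (QDA.likIntegral (prior n) D (QDA.perturb n (z n) (θs n) t) (A n) /
          QDA.likIntegral (prior n) D id (A n)).toReal - 1)) :
    QDA.IsLittleOP (fun n => QDA.dataLaw n (θs n))
      (fun n D => ⨆ t : ℝ,
        |QDA.posterior (prior n) D
            {θ | Real.sqrt n * (QDA.stdDev (z n) (θs n))⁻¹ *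
              (QDA.disc (z n) θ - QDA.discHat (z n) D) ≤ t}
          - (gaussianReal 0 1).real (Set.Iic t)|) := by
  intro ε₀ hε₀
  -- the Kolmogorov distance will be at most `2 ε < ε₀`
  set ε := min (ε₀ / 4) 1 with hε
  have hε0 : 0 < ε := lt_min (by linarith) one_pos
  obtain ⟨T, η, hη, hT⟩ := QDA.exists_finset_laplace_imp_kolmogorov hε0
  obtain ⟨Λ₀, hΛ₀⟩ := hbound
  obtain ⟨c, hc, hVc⟩ := hV
  set Λ := max Λ₀ 1 with hΛ
  have hΛ1 : 1 ≤ Λ := le_max_right _ _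
  -- ratios within `γ` of one lie between `exp (-η / 2)` and `exp (η / 2)`
  set γ := 1 - Real.exp (-(η / 2)) with hγ
  have hγ0 : 0 < γ := by
    have : Real.exp (-(η / 2)) < 1 := by simpa using hη
    rw [hγ]; linarith
  rw [ENNReal.tendsto_nhds_zero]
  intro κ hκ
  -- the level `M` making bad samples improbable
  obtain ⟨M, hM1, hM⟩ : ∃ M : ℝ, 1 ≤ M ∧
      ENNReal.ofReal ((Λ + 96 * Real.exp (Λ / 2)) / M ^ 2)
        + ENNReal.ofReal ((Λ + 96 * Real.exp (Λ / 2)) / M ^ 2) ≤ κ / 2 := by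
    have hlim : Tendsto (fun M : ℝ => (Λ + 96 * Real.exp (Λ / 2)) / M ^ 2) atTop (𝓝 0) :=
      tendsto_const_nhds.div_atTop (tendsto_pow_atTop two_ne_zero)
    have hlim2 := (ENNReal.tendsto_ofReal hlim).add (ENNReal.tendsto_ofReal hlim)
    rw [ENNReal.ofReal_zero, add_zero] at hlim2
    have hev := hlim2.eventually (ge_mem_nhds (ENNReal.half_pos hκ.ne'))
    obtain ⟨M, h⟩ := ((eventually_ge_atTop (1 : ℝ)).and hev).exists
    exact ⟨M, h.1, h.2⟩
  -- one constant dominating the scales of the truth, of the samples and of the perturbations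
  set L := 2 * Λ + 2 * M ^ 2 + ∑ t ∈ T, |t| with hL
  have hTsum : 0 ≤ ∑ t ∈ T, |t| := Finset.sum_nonneg fun _ _ => abs_nonneg _
  have hL1 : 2 * Λ ≤ L := by rw [hL]; nlinarith [sq_nonneg M]
  have hL2 : 2 * M ^ 2 ≤ L := by rw [hL]; linarith
  have hL3 : ∀ t ∈ T, |t| ≤ L := fun t ht => by
    have := Finset.single_le_sum (f := fun t : ℝ => |t|) (fun _ _ => abs_nonneg _) ht
    rw [hL]; nlinarith [sq_nonneg M]
  set ρ : ℕ → ℝ := fun n => |δ n| + Real.sqrt ((p n : ℝ) ^ 3 / n) with hρ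
  have hρ0 : Tendsto ρ atTop (𝓝 0) := by
    have h := hδ.abs.add ((Real.continuous_sqrt.tendsto _).comp hp)
    rw [abs_zero, Real.sqrt_zero, add_zero] at h
    exact h
  have hsmall : ∀ᶠ n in atTop, 8 * L ^ 3 * ρ n ≤ 1 := by
    have := hρ0.const_mul (8 * L ^ 3)
    rw [mul_zero] at this
    exact this.eventually (ge_mem_nhds one_pos)
  have herr : ∀ᶠ n in atTop, 226 * L ^ 9 * ρ n ≤ η / 2 := by
    have := hρ0.const_mul (226 * L ^ 9)
    rw [mul_zero] at this
    exact this.eventually (ge_mem_nhds (by positivity))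
  -- the assumptions of the theorem, as bounds on the probability of the remaining bad events
  have hbad : Tendsto (fun n => QDA.dataLaw n (θs n)
        {D | ε ≤ |QDA.posterior (prior n) D (A n) - 1|}
      + ∑ t ∈ T, QDA.dataLaw n (θs n)
        {D | γ ≤ |(QDA.likIntegral (prior n) D (QDA.perturb n (z n) (θs n) t) (A n) /
          QDA.likIntegral (prior n) D id (A n)).toReal - 1|}) atTop (𝓝 0) := by
    have := (h1 ε hε0).add (tendsto_finsetSum T fun t _ => h2 t γ hγ0)
    simpa using this
  have hp3 : ∀ᶠ n : ℕ in atTop, (p n : ℝ) ^ 3 / n < 1 := hp.eventually (gt_mem_nhds one_pos)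
  filter_upwards [hΛ₀, hVc, hsmall, herr, hp3, eventually_ge_atTop 1,
    hbad.eventually (ge_mem_nhds (ENNReal.half_pos hκ.ne'))] with n hb hVn hsm her hpn hn1 hbd
  -- `V = 0` in dimension zero, so the lower bound on `V` forces `p ≥ 1`
  have hp1 : 1 ≤ p n := by
    rw [Nat.one_le_iff_ne_zero]
    intro h0
    rw [QDA.stdDev_eq_zero_of_dim_zero h0] at hVn
    linarith
  have hple : p n ≤ n := by
    have hn0 : (0 : ℝ) < n := by exact_mod_cast hn1
    rw [div_lt_one hn0] at hpn
    have : p n ^ 3 < n := by exact_mod_cast hpn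
    exact (Nat.le_self_pow (by norm_num) _).trans this.le
  have hΛle : Λ₀ ≤ Λ := le_max_left _ _
  obtain ⟨hS1, hS2⟩ := QDA.classScale_of_stdDev (z := z n) hΛ1 (hθs n) (hb.1.trans hΛle)
    (hb.2.1.trans hΛle) (hb.2.2.1.trans hΛle) (hb.2.2.2.trans hΛle) hp1
  have hsc : QDA.Scales n (p n) L (ρ n) := QDA.scales_of_dim hn1 hp1 hsm
  have hgood := QDA.dataLaw_not_goodSample_le hM1 (z n) (hθs n) (hb.1.trans hΛle)
    (hb.2.2.1.trans hΛle) (by omega) hp1 hple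
  -- outside the bad events, the posterior law is close to normal
  have hsub : {D : QDA.Data n (p n) | ε₀ ≤ |(⨆ t : ℝ, |QDA.posterior (prior n) D
            {θ | Real.sqrt n * (QDA.stdDev (z n) (θs n))⁻¹ *
              (QDA.disc (z n) θ - QDA.discHat (z n) D) ≤ t}
          - (gaussianReal 0 1).real (Set.Iic t)|)|}
      ⊆ {D | ¬ (QDA.GoodSample (2 * M ^ 2) (z n) (θs n).1 D.1
            ∧ QDA.GoodSample (2 * M ^ 2) (z n) (θs n).2 D.2)}
        ∪ ({D | ε ≤ |QDA.posterior (prior n) D (A n) - 1|}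
          ∪ ⋃ t ∈ T, {D | γ ≤ |(QDA.likIntegral (prior n) D
            (QDA.perturb n (z n) (θs n) t) (A n) /
              QDA.likIntegral (prior n) D id (A n)).toReal - 1|}) := by
    intro D hD
    by_contra hcon
    simp only [Set.mem_union, not_or, Set.mem_iUnion, not_exists, Set.mem_ofPred_eq, not_le,
      not_not] at hcon
    obtain ⟨⟨hX, hY⟩, hpost, hR⟩ := hcon
    have hLAN : ∀ t ∈ T, ∀ᵐ θ ∂(prior n), θ ∈ A n →
        |QDA.logLik D (QDA.perturb n (z n) (θs n) t θ) - QDA.logLik D θ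
          - (t * QDA.studentized n (z n) (θs n) D θ - t ^ 2 / 2)| ≤ η / 2 := by
      intro t ht
      filter_upwards [hprior n] with θ hθ hθA
      obtain ⟨c1, c2⟩ := QDA.classClose_of_mem_nbhd hsc
        (show δ n ≤ ρ n from (le_abs_self _).trans (le_add_of_nonneg_right (Real.sqrt_nonneg _)))
        hθ (hA n hθA)
      exact (QDA.abs_logLik_perturb_sub_le (hS1.mono hL1) (hS2.mono hL1) (hX.mono hL2)
        (hY.mono hL2) c1 c2 hsc (hL3 t ht)).trans her
    have hkol := QDA.posterior_kolmogorov_le (min_le_right _ _) hη hT (hAmeas n)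
      (QDA.measurable_studentized (z n) (θs n) D) hLAN hpost hR
    have hsup : |(⨆ t : ℝ, |QDA.posterior (prior n) D
            {θ | Real.sqrt n * (QDA.stdDev (z n) (θs n))⁻¹ *
              (QDA.disc (z n) θ - QDA.discHat (z n) D) ≤ t}
          - (gaussianReal 0 1).real (Set.Iic t)|)| ≤ 2 * ε := by
      rw [abs_of_nonneg (Real.iSup_nonneg fun _ => abs_nonneg _)]
      exact ciSup_le hkol
    have h4 : ε ≤ ε₀ / 4 := min_le_left _ _
    have hD' : ε₀ ≤ _ := hD
    linarith [hD'.trans hsup]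
  calc _ ≤ _ := measure_mono hsub
    _ ≤ _ := measure_union_le _ _
    _ ≤ κ / 2 + κ / 2 := by
        refine add_le_add (hgood.trans hM) (le_trans ?_ hbd)
        refine (measure_union_le _ _).trans (add_le_add le_rfl ?_)
        exact measure_biUnion_finset_le _ _
    _ = κ := ENNReal.add_halves κ
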